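/- **Setting.** Let $\mathcal X$ be a countable set and $\mathcal A\subset\mathcal X\times\mathcal X$ the arcs of a directed graph $(\mathcal X,\to)$ which is symmetric, connected, of bounded degree and without loops. Let $\Omega$ be the set of càdlàg piecewise constant paths $\omega:[0,1]\to\mathcal X$ with finitely many jumps, with $\omega_{1^-}=\omega_1$, and such that $\omega_{t^-}\neq\omega_t$ implies $\omega_{t^-}\to\omega_t$; it carries the canonical process $(X_t)_{0\le t\le1}$ and the $\sigma$-field generated by it. A *random walk* is a probability measure $P$ on $\Omega$; put $P_{01}(x,y)=P(X_0=x,X_1=y)$ and, for $(x,y)\in\operatorname{supp}P_{01}$, let $P^{xy}=P(\,\cdot\mid X_0=x,X_1=y)$ be its bridge. $P$ is *Markov* if $P(X_{[t,1]}\in\cdot\mid X_{[0,t]})=P(X_{[t,1]}\in\cdot\mid X_t)$ for all $0\le t\le 1$. For a $t$-measurable $k:[0,1)\times\mathcal A\to[0,\infty)$ put $\bar k(t,z)=\sum_{z':z\to z'}k(t,z\to z')$; $P$ has *intensity* $k$ if $\int_{[0,1)}\bar k(t,X_t)\,dt<\infty$ $P$-a.s. and, for every finitely supported $u:\mathcal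 X\to\mathbb R$, the process $u(X_t)-\int_0^t\sum_{z':X_s\to z'}k(s,X_s\to z')\,(u(z')-u(X_s))\,ds$, $0\le t<1$, is a local $P$-martingale for the canonical filtration. Let $j:[0,1]\times\mathcal A\to(0,\infty)$ satisfy $\sup_{t\in[0,1],z\in\mathcal X}\bar j(t,z)<\infty$, with $t\mapsto j(t,z\to z')$ continuously differentiable on $[0,1]$ for every arc. Let $R$ be a random walk with intensity $j$ whose initial marginal charges every vertex, and let $$\mathcal R(j)=\Big\{\sum_{x,y}\pi(x,y)R^{xy}:\ \pi \text{ a probability measure on }\mathcal X^2,\ \operatorname{supp}\pi\subset\operatorname{supp}R_{01}\Big\}$$ be its reciprocal class. For an intensity $k$ which is continuously differentiable in $t$ on $[0,1)$ and positive on $(0,1)$, define $$\chi_a[k](t,z\to z')=\partial_t\log k(t,z\to z')+\bar k(t,z')-\bar k(t,z),\qquad \chi_c[k](t,\mathbf c)=\prod_{i=0}^{n-1}k(t,x_i\to x_{i+1})$$ for arcs $z\to z'$ and closed walks $\mathbf c=(x_0\to x_1\to\cdots\to x_n=x_0)$, the derivative at $t=0$ being the right derivative. A *tree* $\mathcal T$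 is a symmetric connected spanning subgraph without simple closed walks of length at least three. For an arc $x\to y$ not in $\mathcal T$, $\mathbf f_{x\to y}$ is the closed walk made of $x\to y$ followed by the only simple walk from $y$ to $x$ in $\mathcal T$. A *$\mathcal T$-basis of closed walks* is a set $\mathcal C_0\cup\mathcal E$, where $\mathcal E=\{(x\to y\to x):(x\to y)\in\mathcal A\}$ and $\mathcal C_0$ is obtained by choosing, for each edge $\{x,y\}$ of the graph that is not in $\mathcal T$, exactly one among $\mathbf f_{x\to y}$ and $\mathbf f_{y\to x}$. **Theorem.** A random walk $P$ belongs to $\mathcal R(j)$ if and only if the following assertions hold for all $(x,y)\in\operatorname{supp}P_{01}$. (i) The bridge $P^{xy}$ is Markov, $P^{xy}\ll R^{xy}$, and $P^{xy}$ has an intensity $k^{xy}$ which is continuously differentiable in $t$ on $[0,1)$ and positive on $(0,1)$ (for every arc). (ii) There exists a tree $\mathcal T$ such that $\chi_a[k^{xy}](t,z\to z')=\chi_a[j](t,z\to z')$ for all $t\in[0,1)$ and all arcs $z\to z'$ of $\mathcal T$. (iii) There exists a $\mathcal T$-basis $\mathcal C$ of closed walks such that $\chi_c[k^{xy}](t,\mathbf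 c)=\chi_c[j](t,\mathbf c)$ for all $t\in(0,1)$ and all $\mathbf c\in\mathcal C$. -/

import Mathlib

open MeasureTheory ProbabilityTheory Set Filter Topology

namespace ReciprocalWalk

variable {X : Type*}

/-! ### The path space -/

/-- The sample paths: càdlàg piecewise constant functions from `[0,1]` to the discrete vertex set,
with finitely many jumps, continuous at time `1`, and jumping only along arcs of `G`.
A symmetric directed graph without loops is the same thing as a `SimpleGraph`; its arcs are
the pairs `(z, z')` with `G.Adj z z'`. -/
structure IsWalkPath (G : SimpleGraph X) (ω : unitInterval → X) : Prop where
  right_cont : ∀ t, ∀ᶠ s in 𝓝[>] t, ω s = ω t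
  left_lim : ∀ t, ∃ z, ∀ᶠ s in 𝓝[<] t, ω s = z
  finite_jumps : {t | ¬ ∀ᶠ s in 𝓝[<] t, ω s = ω t}.Finite
  left_one : ∀ᶠ s in 𝓝[<] (1 : unitInterval), ω s = ω 1
  jump_arc : ∀ t, 0 < t → ∀ z, (∀ᶠ s in 𝓝[<] t, ω s = z) → z ≠ ω t → G.Adj z (ω t)

/-- The path space `Ω`. -/
def PathSpace (G : SimpleGraph X) : Type _ := {ω : unitInterval → X // IsWalkPath G ω}

/-- The canonical process `X_t`. Only times `t ∈ [0,1]` are meaningful (other times are clamped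
to this interval). -/
noncomputable def coord {G : SimpleGraph X} (t : ℝ) (ω : PathSpace G) : X :=
  ω.1 (Set.projIcc 0 1 zero_le_one t)

/-- The `σ`-field on `X` being discrete, this is the `σ`-field generated by `X_s`, `s ∈ S`. -/
@[reducible]
noncomputable def sigmaAt (G : SimpleGraph X) (S : Set ℝ) : MeasurableSpace (PathSpace G) :=
  ⨆ s ∈ S, MeasurableSpace.comap (coord s) ⊤

/-- The canonical `σ`-field. -/
noncomputable instance (G : SimpleGraph X) : MeasurableSpace (PathSpace G) := sigmaAt G (Icc 0 1)

theorem sigmaAt_mono (G : SimpleGraph X) {S S' : Set ℝ} (h : S ⊆ S') :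
    sigmaAt G S ≤ sigmaAt G S' :=
  biSup_mono fun _ hs => h hs

/-- The time interval `[0,1)`. -/
abbrev Time : Type := Set.Ico (0 : ℝ) 1

noncomputable instance : OrderBot Time where
  bot := ⟨0, by norm_num⟩
  bot_le t := t.2.1

/-- The canonical filtration, for times in `[0,1)`. -/
noncomputable def canonicalFiltration (G : SimpleGraph X) :
    Filtration Time (inferInstance : MeasurableSpace (PathSpace G)) where
  seq t := sigmaAt G (Icc 0 t)
  mono' _ _ h := sigmaAt_mono G (Icc_subset_Icc_right h)
  le' t := sigmaAt_mono G (Icc_subset_Icc_right t.2.2.le)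

/-! ### Endpoints, bridges, Markov walks -/

/-- The event `{X_0 = x, X_1 = y}`. Its `P`-probability is `P₀₁(x,y)`. -/
def endpoints (G : SimpleGraph X) (x y : X) : Set (PathSpace G) :=
  {ω | coord 0 ω = x ∧ coord 1 ω = y}

/-- The support of the endpoint marginal `P₀₁`. -/
def endpointSupport {G : SimpleGraph X} (P : Measure (PathSpace G)) : Set (X × X) :=
  {p | P (endpoints G p.1 p.2) ≠ 0}

/-- The bridge `P^{xy} = P(· | X_0 = x, X_1 = y)`, meaningful for `(x,y) ∈ supp P₀₁`. -/
noncomputable def bridge {G : SimpleGraph X} (P : Measure (PathSpace G)) (x y : X) :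
    Measure (PathSpace G) :=
  ProbabilityTheory.cond P (endpoints G x y)

/-- The Markov property: for `0 ≤ t ≤ 1`,
`P(X_{[t,1]} ∈ · | X_{[0,t]}) = P(X_{[t,1]} ∈ · | X_t)`. -/
def IsMarkov {G : SimpleGraph X} (P : Measure (PathSpace G)) : Prop :=
  ∀ t ∈ Icc (0 : ℝ) 1, ∀ B : Set (PathSpace G), MeasurableSet[sigmaAt G (Icc t 1)] B →
    P⟦B | sigmaAt G (Icc 0 t)⟧ =ᵐ[P] P⟦B | sigmaAt G {t}⟧

/-- The reciprocal class: all the mixtures of bridges of `R`. -/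
def reciprocalClass {G : SimpleGraph X} (R : Measure (PathSpace G)) :
    Set (Measure (PathSpace G)) :=
  {P | ∃ π : PMF (X × X), π.support ⊆ endpointSupport R ∧
    P = Measure.sum fun p : X × X => π p • bridge R p.1 p.2}

/-! ### Intensities of jumps -/

/-- The average frequency of jump `k̄(t,z) = ∑_{z' : z → z'} k(t, z → z')`. An intensity is a
function `k`, where `k t z z'` stands for `k(t, z → z')` and matters only on arcs. -/
def totalRate (G : SimpleGraph X) [G.LocallyFinite] (k : ℝ → X → X → ℝ) (t : ℝ) (z : X) : ℝ :=
  ∑ z' ∈ G.neighborFinset z, k t z z'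

/-- The generator `K_t u(z) = ∑_{z' : z → z'} k(t, z → z') (u(z') - u(z))`. -/
def generator (G : SimpleGraph X) [G.LocallyFinite] (k : ℝ → X → X → ℝ) (t : ℝ) (u : X → ℝ)
    (z : X) : ℝ :=
  ∑ z' ∈ G.neighborFinset z, k t z z' * (u z' - u z)

/-- `P` has intensity of jumps `k : [0,1) × A → [0,∞)`: for all finitely supported `u`, the process
`u(X_t) - ∫_0^t K_s u(X_s) ds`, `0 ≤ t < 1`, is a local `P`-martingale with respect to the
canonical filtration. -/
structure HasIntensity {G : SimpleGraph X} [G.LocallyFinite] (P : Measure (PathSpace G))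
    (k : ℝ → X → X → ℝ) : Prop where
  measurable : ∀ z z', G.Adj z z' → Measurable fun t : Time => k t z z'
  nonneg : ∀ t ∈ Ico (0 : ℝ) 1, ∀ z z', G.Adj z z' → 0 ≤ k t z z'
  integrable : ∀ᵐ ω ∂P, IntegrableOn (fun s => totalRate G k s (coord s ω)) (Ico 0 1)
  martingale : ∀ u : X →₀ ℝ,
    Locally (fun M : Time → PathSpace G → ℝ => Martingale M (canonicalFiltration G) P)
      (canonicalFiltration G)
      (fun t ω => u (coord t ω) - ∫ s in (0 : ℝ)..t, generator G k s u (coord s ω)) P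

/-- The requirements on the reference intensity `j`: bounded average frequency of jump,
continuous differentiability in time, and positivity, all on `[0,1]`. -/
structure IsReferenceIntensity (G : SimpleGraph X) [G.LocallyFinite]
    (j : ℝ → X → X → ℝ) : Prop where
  bounded : ∃ C : ℝ, ∀ t ∈ Icc (0 : ℝ) 1, ∀ z, totalRate G j t z ≤ C
  contDiff : ∀ z z', G.Adj z z' → ContDiffOn ℝ 1 (fun t => j t z z') (Icc 0 1)
  pos : ∀ t ∈ Icc (0 : ℝ) 1, ∀ z z', G.Adj z z' → 0 < j t z z'

/-- `k` is continuously `t`-differentiable and positive: for every arc, `t ↦ k(t, z → z')` is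
continuously differentiable on `[0,1)` and positive on `(0,1)`. -/
structure IsRegularIntensity (G : SimpleGraph X) (k : ℝ → X → X → ℝ) : Prop where
  contDiff : ∀ z z', G.Adj z z' → ContDiffOn ℝ 1 (fun t => k t z z') (Ico 0 1)
  pos : ∀ t ∈ Ioo (0 : ℝ) 1, ∀ z z', G.Adj z z' → 0 < k t z z'

/-! ### Reciprocal characteristics -/

/-- The arc component `χ_a[k](t, z → z') = ∂_t log k(t, z → z') + k̄(t,z') - k̄(t,z)`
(with a right derivative at `t = 0`). -/
noncomputable def arcChar (G : SimpleGraph X) [G.LocallyFinite] (k : ℝ → X → X → ℝ)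
    (t : ℝ) (z z' : X) : ℝ :=
  derivWithin (fun s => Real.log (k s z z')) (Ico 0 1) t + totalRate G k t z' - totalRate G k t z

/-- The closed walk component: the product of `k(t, x_i → x_{i+1})` along the walk. -/
def walkChar {G : SimpleGraph X} (k : ℝ → X → X → ℝ) (t : ℝ) {x y : X} (c : G.Walk x y) : ℝ :=
  (c.darts.map fun d => k t d.fst d.snd).prod

/-! ### Spanning trees and bases of closed walks -/

/-- `T` is a (spanning) tree of `G`. -/
def IsSpanningTree (G T : SimpleGraph X) : Prop := T ≤ G ∧ T.IsTree

/-- A walk of `G` together with its base point, from which it starts and to which it returns. -/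
abbrev BasedWalk (G : SimpleGraph X) : Type _ := Σ x : X, G.Walk x x

/-- The closed walk `f_{x → y}`: the arc `x → y` followed by the only simple walk from `y` to `x`
in the tree `T`. -/
noncomputable def fundamentalWalk {G T : SimpleGraph X} (hT : IsSpanningTree G T) {x y : X}
    (h : G.Adj x y) : BasedWalk G :=
  ⟨x, SimpleGraph.Walk.cons h ((hT.2.existsUnique_path y x).choose.mapLe hT.1)⟩

/-- The set of all the closed walks `x → y → x`. -/
def edgeWalks (G : SimpleGraph X) : Set (BasedWalk G) :=
  {c | ∃ (x y : X) (h : G.Adj x y), c = ⟨x, h.toWalk.append h.symm.toWalk⟩}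

/-- `C` is a `T`-basis of closed walks: `C = C₀ ∪ {x → y → x}` where `C₀` is obtained by choosing,
for each edge of `G` which is not in `T`, exactly one among `f_{x → y}` and `f_{y → x}`. -/
def IsClosedWalkBasis {G T : SimpleGraph X} (hT : IsSpanningTree G T)
    (C : Set (BasedWalk G)) : Prop :=
  ∃ C₀ : Set (BasedWalk G),
    (∀ c ∈ C₀, ∃ (x y : X) (h : G.Adj x y), ¬ T.Adj x y ∧ c = fundamentalWalk hT h) ∧
    (∀ (x y : X) (h : G.Adj x y), ¬ T.Adj x y →
      Xor (fundamentalWalk hT h ∈ C₀) (fundamentalWalk hT h.symm ∈ C₀)) ∧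
    C = C₀ ∪ edgeWalks G

end ReciprocalWalk

open ReciprocalWalk

/-!
Why the theorem is true.

An intensity `k` enters only through the forward equation: for an event `A` of the past of `s`, the
masses `P(A, X_t = z)`, `t ≥ s`, solve the master equation of `k` (`HasIntensity.isForward`). The
martingale property is in fact equivalent to it (`IsForward.martingale_dynkin`).

*Sufficiency.* Equality of the closed walk characteristics on the fundamental walks of `T` and on
the edges makes `log (k / j)` exact: it is the gradient of a potential `ψ`, computed along `T`.
Equality of the arc characteristics says that `∂_t ψ(t, z) + k̄(t, z) - j̄(t, z)` does not depend on
`z`; up to a function of time, `exp ψ` is thus a positive solution of the backward equation of `j`,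
and `k` is the corresponding `h`-transform (`exists_isGauge`). The weights `exp ψ` turn the master
equation of `j` into the one of `k`. On paths whose positions up to a given time stay in a
finite set, the master equation is a finite linear system with a unique solution, so the killed
marginals of the two walks differ by these weights only; this yields the finite dimensional distributions
without any non-explosion or growth hypothesis on `k`, because each path visits finitely many
vertices. Letting the end times tend to `0` and `1` identifies the walk pinned at both ends with the
bridge of `R` (`eq_bridge_of_isGauge`). Taking `k = j` and `ψ = 0` in the comparison gives the Markov
property of `R` (`IsForward.markov`).

*Necessity.* The bridge of `R` from `x` to `y` is the `h`-transform of `R` by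
`h(t, z) = R(X_1 = y ∣ X_t = z)`, see `bridgeRate`. The Markov property and the boundedness of the
rates and degrees provide a Taylor expansion of `h` that is uniform in the vertex, whence the
backward equation (`IsForward.hasDerivWithinAt_endProb`); connectedness of the graph and positivity
of the rates make `h` positive. Both characteristics are invariant under `h`-transforms: `h`
telescopes along closed walks, and the backward equation compensates `∂_t log h` in the arc
characteristics (`IsForward.arcChar_bridgeRate`, `walkChar_bridgeRate`).

Finally a walk is the mixture of its bridges (`sum_smul_bridge`), and the bridges of a mixture of
bridges of `R` are those of `R` (`bridge_eq_of_eq_sum`).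
-/

namespace ReciprocalWalk

section CanonicalProcess

variable {X : Type*} {G : SimpleGraph X}

/-! ### Regularity and measurability of the canonical process -/

/-- The event `{X_t = z}`. -/
def visit (G : SimpleGraph X) (t : ℝ) (z : X) : Set (PathSpace G) :=
  {ω | coord t ω = z}

@[simp] theorem mem_visit {t : ℝ} {z : X} {ω : PathSpace G} : ω ∈ visit G t z ↔ coord t ω = z :=
  Iff.rfl

theorem coord_of_le_zero {t : ℝ} (ht : t ≤ 0) (ω : PathSpace G) : coord t ω = coord 0 ω := by
  simp [coord, Set.projIcc_of_le_left _ ht]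

theorem coord_of_one_le {t : ℝ} (ht : 1 ≤ t) (ω : PathSpace G) : coord t ω = coord 1 ω := by
  simp [coord, Set.projIcc_of_right_le _ ht]

theorem coord_right_continuous (t : ℝ) (ω : PathSpace G) :
    ∀ᶠ s in 𝓝[>] t, coord s ω = coord t ω := by
  rcases lt_or_ge t 0 with h0 | h0
  · filter_upwards [mem_nhdsWithin_of_mem_nhds (Iio_mem_nhds h0)] with s hs
    rw [coord_of_le_zero (le_of_lt hs), coord_of_le_zero h0.le]
  rcases lt_or_ge t 1 with h1 | h1
  · have hlim : Tendsto (Set.projIcc (0 : ℝ) 1 zero_le_one) (𝓝[>] t)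
        (𝓝[>] (Set.projIcc (0 : ℝ) 1 zero_le_one t)) := by
      refine tendsto_nhdsWithin_iff.2
        ⟨(continuous_projIcc.tendsto t).mono_left nhdsWithin_le_nhds, ?_⟩
      filter_upwards [self_mem_nhdsWithin, mem_nhdsWithin_of_mem_nhds (Iio_mem_nhds h1)] with s hs hs1
      rw [Set.mem_Ioi, Set.projIcc_of_mem zero_le_one ⟨h0, h1.le⟩,
        Set.projIcc_of_mem zero_le_one ⟨h0.trans (le_of_lt hs), le_of_lt hs1⟩]
      exact hs
    exact hlim.eventually (ω.2.right_cont _)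
  · filter_upwards [self_mem_nhdsWithin] with s hs
    rw [coord_of_one_le (h1.trans (le_of_lt hs)), coord_of_one_le h1]

theorem coord_left_continuous_one (ω : PathSpace G) :
    ∀ᶠ s in 𝓝[<] (1 : ℝ), coord s ω = coord 1 ω := by
  have hp1 : Set.projIcc (0 : ℝ) 1 zero_le_one 1 = 1 := Set.projIcc_right _
  have hlim : Tendsto (Set.projIcc (0 : ℝ) 1 zero_le_one) (𝓝[<] 1) (𝓝[<] (1 : unitInterval)) := by
    refine tendsto_nhdsWithin_iff.2 ⟨?_, ?_⟩
    · have := ((continuous_projIcc (h := zero_le_one (α := ℝ))).tendsto 1).mono_left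
        (nhdsWithin_le_nhds (s := Iio 1))
      rwa [hp1] at this
    · filter_upwards [self_mem_nhdsWithin, mem_nhdsWithin_of_mem_nhds (Ioi_mem_nhds zero_lt_one)]
        with s hs hs0
      rw [Set.projIcc_of_mem zero_le_one ⟨le_of_lt hs0, le_of_lt hs⟩]
      exact hs
  simp only [coord, hp1]
  exact hlim.eventually ω.2.left_one

/-- A path visits finitely many vertices. -/
theorem finite_range_path (ω : PathSpace G) : (Set.range ω.1).Finite := by
  have h : ∀ t : unitInterval, ∃ U ∈ 𝓝 t, (ω.1 '' U).Finite := by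
    intro t
    obtain ⟨z, hz⟩ := ω.2.left_lim t
    refine ⟨{s | ω.1 s ∈ ({z, ω.1 t} : Set X)}, ?_, ?_⟩
    · rw [← nhdsNE_sup_pure, ← nhdsLT_sup_nhdsGT]
      refine ⟨⟨?_, ?_⟩, ?_⟩
      · filter_upwards [hz] with s hs
        simp [hs]
      · filter_upwards [ω.2.right_cont t] with s hs
        simp [hs]
      · simp
    · refine (Set.toFinite ({z, ω.1 t} : Set X)).subset ?_
      rintro _ ⟨s, hs, rfl⟩
      exact hs
  choose U hU hfin using h
  obtain ⟨I, -, hI⟩ := isCompact_univ.elim_nhds_subcover U fun t _ => hU t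
  refine (I.finite_toSet.biUnion fun t _ => hfin t).subset ?_
  rintro _ ⟨s, rfl⟩
  obtain ⟨t, ht, hs⟩ := Set.mem_iUnion₂.1 (hI (Set.mem_univ s))
  exact Set.mem_biUnion ht ⟨s, hs, rfl⟩

theorem finite_range_coord (ω : PathSpace G) : (Set.range fun t : ℝ => coord t ω).Finite :=
  (finite_range_path ω).subset (by rintro _ ⟨t, rfl⟩; exact ⟨_, rfl⟩)

theorem measurableSet_coord_mem {S : Set ℝ} {t : ℝ} (ht : t ∈ S) (U : Set X) :
    MeasurableSet[sigmaAt G S] {ω | coord t ω ∈ U} :=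
  (le_biSup (fun s => MeasurableSpace.comap (coord (G := G) s) ⊤) ht) _ ⟨U, trivial, rfl⟩

theorem measurableSet_visit_sigmaAt {S : Set ℝ} {t : ℝ} (ht : t ∈ S) (z : X) :
    MeasurableSet[sigmaAt G S] (visit G t z) :=
  measurableSet_coord_mem ht {z}

theorem sigmaAt_le {S : Set ℝ} (hS : S ⊆ Icc 0 1) :
    sigmaAt G S ≤ (inferInstance : MeasurableSpace (PathSpace G)) :=
  sigmaAt_mono G hS

theorem measurableSet_visit (t : ℝ) (z : X) : MeasurableSet (visit G t z) := by
  rcases lt_or_ge t 0 with h0 | h0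
  · have : visit G t z = visit G 0 z := by ext ω; simp [coord_of_le_zero h0.le]
    rw [this]
    exact measurableSet_visit_sigmaAt (S := Icc 0 1) (by simp) z
  rcases lt_or_ge t 1 with h1 | h1
  · exact measurableSet_visit_sigmaAt (S := Icc 0 1) ⟨h0, h1.le⟩ z
  · have : visit G t z = visit G 1 z := by ext ω; simp [coord_of_one_le h1]
    rw [this]
    exact measurableSet_visit_sigmaAt (S := Icc 0 1) (by simp) z

theorem measurableSet_visit_sigmaAt_of_le {T t : ℝ} (hT : 0 ≤ T) (ht : t ≤ T) (z : X) :
    MeasurableSet[sigmaAt G (Icc 0 T)] (visit G t z) := by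
  rcases lt_or_ge t 0 with h0 | h0
  · have : visit G t z = visit G 0 z := by ext ω; simp [coord_of_le_zero h0.le]
    rw [this]
    exact measurableSet_visit_sigmaAt (S := Icc 0 T) (left_mem_Icc.2 hT) z
  · exact measurableSet_visit_sigmaAt (S := Icc 0 T) ⟨h0, ht⟩ z

/-- Approximation of a time from the right by times of a countable set. -/
theorem tendsto_floor_add_one_div (r : ℝ) :
    Tendsto (fun n : ℕ => ((⌊((n : ℝ) + 1) * r⌋ : ℝ) + 1) / ((n : ℝ) + 1)) atTop (𝓝[>] r) := by
  refine tendsto_nhdsWithin_iff.2 ⟨?_, Eventually.of_forall fun n => ?_⟩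
  · have h1 : Tendsto (fun n : ℕ => r + 1 / ((n : ℝ) + 1)) atTop (𝓝 r) := by
      simpa using tendsto_one_div_add_atTop_nhds_zero_nat.const_add r
    refine tendsto_of_tendsto_of_tendsto_of_le_of_le tendsto_const_nhds h1 (fun n => ?_) fun n => ?_
    · have hn : (0 : ℝ) < n + 1 := by positivity
      change r ≤ _
      rw [le_div_iff₀ hn]
      have := Int.lt_floor_add_one (((n : ℝ) + 1) * r)
      linarith
    · have hn : (0 : ℝ) < n + 1 := by positivity
      change _ ≤ r + 1 / ((n : ℝ) + 1)
      rw [div_le_iff₀ hn, add_mul r, one_div, inv_mul_cancel₀ hn.ne']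
      have := Int.floor_le (((n : ℝ) + 1) * r)
      linarith
  · have hn : (0 : ℝ) < n + 1 := by positivity
    rw [Set.mem_Ioi, lt_div_iff₀ hn]
    have := Int.lt_floor_add_one (((n : ℝ) + 1) * r)
    linarith

/-- Progressive measurability of the canonical process. -/
theorem measurableSet_progressive {T : ℝ} (hT : 0 ≤ T) (z : X) :
    MeasurableSet[(borel ℝ).prod (sigmaAt G (Icc 0 T))]
      {p : ℝ × PathSpace G | coord (min p.1 T) p.2 = z} := by
  set m : MeasurableSpace (ℝ × PathSpace G) := (borel ℝ).prod (sigmaAt G (Icc 0 T))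
  let a : ℕ → ℝ → ℝ := fun n r => ((⌊((n : ℝ) + 1) * r⌋ : ℝ) + 1) / ((n : ℝ) + 1)
  -- by right-continuity, the event is the liminf of its versions at the discretized times `a n`
  let S : ℕ → Set (ℝ × PathSpace G) := fun n => {p | coord (min (a n p.1) T) p.2 = z}
  have hS : ∀ n, MeasurableSet[m] (S n) := by
    intro n
    have : S n = ⋃ i : ℤ, {r : ℝ | ⌊((n : ℝ) + 1) * r⌋ = i} ×ˢ
        visit G (min (((i : ℝ) + 1) / ((n : ℝ) + 1)) T) z := by
      ext ⟨r, ω⟩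
      simp [S, a]
    rw [this]
    refine MeasurableSet.iUnion fun i => ?_
    refine @MeasurableSet.prod _ _ (borel ℝ) (sigmaAt G (Icc 0 T)) _ _ ?_ ?_
    · have hm : Measurable fun r : ℝ => ⌊((n : ℝ) + 1) * r⌋ := by fun_prop
      have := hm (measurableSet_singleton i)
      rwa [BorelSpace.measurable_eq (α := ℝ)] at this
    · exact measurableSet_visit_sigmaAt_of_le hT (min_le_right _ _) z
  have hlim : ∀ p : ℝ × PathSpace G, ∀ᶠ n in atTop,
      coord (min (a n p.1) T) p.2 = coord (min p.1 T) p.2 := by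
    intro p
    rcases lt_or_ge p.1 T with h | h
    · have h1 : ∀ᶠ s in 𝓝[>] p.1, coord (min s T) p.2 = coord (min p.1 T) p.2 := by
        filter_upwards [coord_right_continuous p.1 p.2,
          mem_nhdsWithin_of_mem_nhds (Iio_mem_nhds h)] with s hs hsT
        rw [min_eq_left (le_of_lt hsT), min_eq_left h.le, hs]
      exact (tendsto_floor_add_one_div p.1).eventually h1
    · refine Eventually.of_forall fun n => ?_
      have hn : (0 : ℝ) < n + 1 := by positivity
      have h2 : p.1 ≤ a n p.1 := by
        simp only [a]
        rw [le_div_iff₀ hn]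
        have := Int.lt_floor_add_one (((n : ℝ) + 1) * p.1)
        linarith
      rw [min_eq_right h, min_eq_right (h.trans h2)]
  have : {p : ℝ × PathSpace G | coord (min p.1 T) p.2 = z} = ⋃ N : ℕ, ⋂ n ≥ N, S n := by
    ext p
    simp only [Set.mem_ofPred_eq, Set.mem_iUnion, Set.mem_iInter, S]
    constructor
    · intro hp
      obtain ⟨N, hN⟩ := eventually_atTop.1 (hlim p)
      exact ⟨N, fun n hn => (hN n hn).trans hp⟩
    · rintro ⟨N, hN⟩
      obtain ⟨N', hN'⟩ := eventually_atTop.1 (hlim p)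
      rw [← hN' (max N N') (le_max_right _ _)]
      exact hN _ (le_max_left _ _)
  rw [this]
  exact MeasurableSet.iUnion fun N => MeasurableSet.iInter fun n => MeasurableSet.iInter fun _ => hS n

theorem measurableSet_visit_uncurry (z : X) :
    MeasurableSet {p : ℝ × PathSpace G | coord p.1 p.2 = z} := by
  have h := measurableSet_progressive (G := G) zero_le_one z
  have h2 : {p : ℝ × PathSpace G | coord (min p.1 1) p.2 = z} = {p | coord p.1 p.2 = z} := by
    ext p
    rcases le_total p.1 1 with h | h
    · simp [min_eq_left h]
    · simp [min_eq_right h, coord_of_one_le h]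
  rw [h2] at h
  have h3 : (borel ℝ) = (inferInstance : MeasurableSpace ℝ) := (BorelSpace.measurable_eq).symm
  rw [h3] at h
  exact h

theorem measurable_measureReal_inter_visit (Q : Measure (PathSpace G)) [IsFiniteMeasure Q]
    {S : Set (ℝ × PathSpace G)} (hS : MeasurableSet S) (z : X) :
    Measurable fun r : ℝ => Q.real ({ω | (r, ω) ∈ S} ∩ visit G r z) := by
  have := measurable_measure_prodMk_left (ν := Q) (hS.inter (measurableSet_visit_uncurry z))
  exact this.ennreal_toReal

theorem measurable_measureReal_visit (Q : Measure (PathSpace G)) [IsFiniteMeasure Q]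
    {A : Set (PathSpace G)} (hA : MeasurableSet A) (z : X) :
    Measurable fun r : ℝ => Q.real (A ∩ visit G r z) := by
  simpa using measurable_measureReal_inter_visit Q (S := univ ×ˢ A) (MeasurableSet.univ.prod hA) z

end CanonicalProcess

section ForwardEquation

variable {X : Type*} {G : SimpleGraph X}

/-! ### The forward equation and the martingale problem -/

/-- All the rates are continuous on `[0,1)`. -/
def ContinuousRates (G : SimpleGraph X) (k : ℝ → X → X → ℝ) : Prop :=
  ∀ ⦃z z' : X⦄, G.Adj z z' → ContinuousOn (fun r => k r z z') (Ico 0 1)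

theorem IsRegularIntensity.continuousRates {k : ℝ → X → X → ℝ} (hk : IsRegularIntensity G k) :
    ContinuousRates G k :=
  fun _ _ h => (hk.contDiff _ _ h).continuousOn

theorem ContinuousRates.integrableOn {k : ℝ → X → X → ℝ} (hk : ContinuousRates G k) {z z' : X}
    (h : G.Adj z z') {s t : ℝ} (hs : 0 ≤ s) (ht : t < 1) :
    IntegrableOn (fun r => k r z z') (Ioc s t) :=
  (((hk h).mono fun _ hr => ⟨hs.trans hr.1, hr.2.trans_lt ht⟩).integrableOn_Icc).mono_set
    Ioc_subset_Icc_self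

theorem single_coord (t : ℝ) (z : X) (ω : PathSpace G) :
    Finsupp.single z (1 : ℝ) (coord t ω) = (visit G t z).indicator (fun _ => 1) ω := by
  by_cases h : coord t ω = z
  · rw [Set.indicator_of_mem (by exact h), h, Finsupp.single_eq_same]
  · rw [Set.indicator_of_notMem (by exact h), Finsupp.single_eq_of_ne h]

theorem integrable_indicator_visit (Q : Measure (PathSpace G)) [IsFiniteMeasure Q] {c : ℝ → ℝ}
    {S : Set ℝ} (hc : IntegrableOn c S) (z : X) :
    Integrable (fun p : ℝ × PathSpace G => (visit G p.1 z).indicator (fun _ => c p.1) p.2)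
      ((volume.restrict S).prod Q) := by
  have h := (hc.comp_fst Q).indicator (measurableSet_visit_uncurry (G := G) z)
  refine h.congr (Eventually.of_forall fun p => ?_)
  by_cases hp : coord p.1 p.2 = z <;> simp [Set.indicator, visit, hp]

variable [G.LocallyFinite]

/-- The right-hand side `∑_{z' : z' → z} m(z') k(r, z' → z) - m(z) k̄(r, z)` of the forward
Kolmogorov equation, for the mass distribution `m`. -/
def masterRate (G : SimpleGraph X) [G.LocallyFinite] (k : ℝ → X → X → ℝ) (r : ℝ) (m : X → ℝ)
    (z : X) : ℝ :=
  ∑ z' ∈ G.neighborFinset z, m z' * k r z' z - m z * totalRate G k r z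

/-- `Q` solves the forward Kolmogorov equation of rates `k`, conditionally on the past: for every
event `A` of the past of `s`, the masses `Q(A, X_t = z)`, `s ≤ t < 1`, solve the (integrated)
forward equation. -/
def IsForward (Q : Measure (PathSpace G)) (k : ℝ → X → X → ℝ) : Prop :=
  ∀ ⦃s t : ℝ⦄, 0 ≤ s → s ≤ t → t < 1 → ∀ ⦃A : Set (PathSpace G)⦄,
    MeasurableSet[sigmaAt G (Icc 0 s)] A → ∀ z,
      Q.real (A ∩ visit G t z) - Q.real (A ∩ visit G s z) =
        ∫ r in s..t, masterRate G k r (fun w => Q.real (A ∩ visit G r w)) z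

theorem IsReferenceIntensity.continuousRates {j : ℝ → X → X → ℝ} (hj : IsReferenceIntensity G j) :
    ContinuousRates G j :=
  fun _ _ h => (hj.contDiff _ _ h).continuousOn.mono Ico_subset_Icc_self

theorem ContinuousRates.continuousOn_totalRate {k : ℝ → X → X → ℝ} (hk : ContinuousRates G k) (z : X) :
    ContinuousOn (fun r => totalRate G k r z) (Ico 0 1) :=
  continuousOn_finsetSum _ fun z' hz' => hk ((G.mem_neighborFinset z z').1 hz')

theorem generator_single (k : ℝ → X → X → ℝ) (r : ℝ) (z : X) (ω : PathSpace G) :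
    generator G k r (Finsupp.single z 1) (coord r ω) =
      ∑ z' ∈ G.neighborFinset z, (visit G r z').indicator (fun _ => k r z' z) ω
        - (visit G r z).indicator (fun _ => totalRate G k r z) ω := by
  classical
  by_cases h : coord r ω = z
  · have h0 : ∀ z' ∈ G.neighborFinset z, (visit G r z').indicator (fun _ => k r z' z) ω = 0 := by
      intro z' hz'
      rw [Set.indicator_of_notMem]
      rw [mem_visit, h]
      exact ((G.mem_neighborFinset z z').1 hz').ne
    rw [Finset.sum_eq_zero h0, Set.indicator_of_mem (by exact h), generator, h, totalRate,
      zero_sub, ← Finset.sum_neg_distrib]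
    refine Finset.sum_congr rfl fun z' hz' => ?_
    have hne : z' ≠ z := ((G.mem_neighborFinset z z').1 hz').ne'
    rw [Finsupp.single_eq_of_ne hne, Finsupp.single_eq_same]
    ring
  · rw [Set.indicator_of_notMem (by exact h), generator, sub_zero]
    by_cases hadj : G.Adj z (coord r ω)
    · rw [Finset.sum_eq_single z, Finset.sum_eq_single (coord r ω)]
      · rw [Set.indicator_of_mem (by rfl), Finsupp.single_eq_same, Finsupp.single_eq_of_ne h]
        ring
      · intro b _ hb
        exact Set.indicator_of_notMem (by rw [mem_visit]; exact hb.symm) _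
      · intro hn
        exact absurd ((G.mem_neighborFinset _ _).2 hadj) hn
      · intro b _ hb
        rw [Finsupp.single_eq_of_ne hb, Finsupp.single_eq_of_ne h]
        ring
      · intro hn
        exact absurd ((G.mem_neighborFinset _ _).2 hadj.symm) hn
    · rw [Finset.sum_eq_zero, Finset.sum_eq_zero]
      · intro b hb
        refine Set.indicator_of_notMem (fun hb' => hadj ?_) _
        rw [mem_visit] at hb'
        rw [hb']
        exact (G.mem_neighborFinset _ _).1 hb
      · intro b hb
        have hbz : b ≠ z := by
          rintro rfl
          exact hadj ((G.mem_neighborFinset _ _).1 hb).symm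
        rw [Finsupp.single_eq_of_ne hbz, Finsupp.single_eq_of_ne h]
        ring

theorem ContinuousRates.exists_bound {k : ℝ → X → X → ℝ} (hk : ContinuousRates G k) (z : X)
    {t : ℝ} (ht : t < 1) :
    ∃ C : ℝ, 0 ≤ C ∧ ∀ r ∈ Icc 0 t, ∀ ω : PathSpace G,
      |generator G k r (Finsupp.single z 1) (coord r ω)| ≤ C := by
  classical
  have hc : ContinuousOn (fun r => ∑ z' ∈ G.neighborFinset z, |k r z' z| + |totalRate G k r z|)
      (Icc 0 t) := by
    refine ContinuousOn.mono ?_ (Icc_subset_Ico_right ht)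
    refine (continuousOn_finsetSum _ fun z' hz' => ?_).add (hk.continuousOn_totalRate z).abs
    exact (hk ((G.mem_neighborFinset z z').1 hz').symm).abs
  obtain ⟨C, hC⟩ := isCompact_Icc.exists_bound_of_continuousOn hc
  refine ⟨max C 0, le_max_right _ _, fun r hr ω => ?_⟩
  rw [generator_single]
  refine le_trans ?_ ((le_abs_self _).trans ((hC r hr).trans (le_max_left _ _)))
  refine (abs_sub _ _).trans (add_le_add ((Finset.abs_sum_le_sum_abs _ _).trans
    (Finset.sum_le_sum fun z' _ => ?_)) ?_)
  · by_cases h : ω ∈ visit G r z' <;> simp only [Set.indicator, h, if_true, if_false, le_refl,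
      abs_zero, abs_nonneg]
  · by_cases h : ω ∈ visit G r z <;> simp only [Set.indicator, h, if_true, if_false, le_refl,
      abs_zero, abs_nonneg]

theorem ContinuousRates.integrableOn_totalRate {k : ℝ → X → X → ℝ} (hk : ContinuousRates G k)
    (z : X) {s t : ℝ} (hs : 0 ≤ s) (ht : t < 1) :
    IntegrableOn (fun r => totalRate G k r z) (Ioc s t) :=
  (((hk.continuousOn_totalRate z).mono fun _ hr => ⟨hs.trans hr.1, hr.2.trans_lt ht⟩).integrableOn_Icc).mono_set
    Ioc_subset_Icc_self

theorem ContinuousRates.integrable_generator {k : ℝ → X → X → ℝ} (hk : ContinuousRates G k)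
    (Q : Measure (PathSpace G)) [IsFiniteMeasure Q] (z : X) {s t : ℝ} (hs : 0 ≤ s) (ht : t < 1) :
    Integrable (fun p : ℝ × PathSpace G => generator G k p.1 (Finsupp.single z 1) (coord p.1 p.2))
      ((volume.restrict (Ioc s t)).prod Q) := by
  simp only [generator_single]
  refine Integrable.sub (integrable_finsetSum _ fun z' hz' => ?_) ?_
  · exact integrable_indicator_visit Q
      (hk.integrableOn ((G.mem_neighborFinset z z').1 hz').symm hs ht) z'
  · exact integrable_indicator_visit Q (hk.integrableOn_totalRate z hs ht) z

theorem setIntegral_generator_single (Q : Measure (PathSpace G)) [IsFiniteMeasure Q]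
    (k : ℝ → X → X → ℝ) (r : ℝ) (z : X) (A : Set (PathSpace G)) :
    ∫ ω in A, generator G k r (Finsupp.single z 1) (coord r ω) ∂Q =
      masterRate G k r (fun w => Q.real (A ∩ visit G r w)) z := by
  simp only [generator_single]
  have hi : ∀ w c, Integrable ((visit G r w).indicator fun _ => (c : ℝ)) (Q.restrict A) :=
    fun w c => (integrable_const c).indicator (measurableSet_visit r w)
  have he : ∀ w c, ∫ ω in A, (visit G r w).indicator (fun _ => (c : ℝ)) ω ∂Q =
      Q.real (A ∩ visit G r w) * c := by
    intro w c
    rw [integral_indicator_const _ (measurableSet_visit r w), smul_eq_mul,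
      measureReal_restrict_apply (measurableSet_visit r w), Set.inter_comm]
  rw [integral_sub (integrable_finsetSum _ fun w _ => hi w _) (hi z _),
    integral_finsetSum _ fun w _ => hi w _, he, masterRate]
  simp only [he]

/-- Fubini's theorem turns the compensator of `1_{X_t = z}` into the forward equation. -/
theorem ContinuousRates.setIntegral_integral_generator {k : ℝ → X → X → ℝ}
    (hk : ContinuousRates G k) (Q : Measure (PathSpace G)) [IsFiniteMeasure Q] (z : X) {s t : ℝ}
    (hs : 0 ≤ s) (hst : s ≤ t) (ht : t < 1) (A : Set (PathSpace G)) :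
    ∫ ω in A, (∫ r in s..t, generator G k r (Finsupp.single z 1) (coord r ω)) ∂Q =
      ∫ r in s..t, masterRate G k r (fun w => Q.real (A ∩ visit G r w)) z := by
  simp only [intervalIntegral.integral_of_le hst]
  rw [← integral_integral_swap (f := fun r ω => generator G k r (Finsupp.single z 1) (coord r ω))
    (hk.integrable_generator (Q.restrict A) z hs ht)]
  simp only [setIntegral_generator_single Q k _ z A]

theorem ContinuousRates.intervalIntegrable_generator {k : ℝ → X → X → ℝ}
    (hk : ContinuousRates G k) (z : X) {s t : ℝ} (hs : 0 ≤ s) (hst : s ≤ t) (ht : t < 1)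
    (ω : PathSpace G) :
    IntervalIntegrable (fun r => generator G k r (Finsupp.single z 1) (coord r ω)) volume s t := by
  rw [intervalIntegrable_iff_integrableOn_Ioc_of_le hst]
  have hm : ∀ w, MeasurableSet {r : ℝ | coord r ω = w} := fun w =>
    (measurableSet_visit_uncurry (G := G) w).preimage (measurable_id.prodMk measurable_const)
  have hi : ∀ w (c : ℝ → ℝ), IntegrableOn c (Ioc s t) →
      IntegrableOn (fun r => (visit G r w).indicator (fun _ => c r) ω) (Ioc s t) := by
    intro w c hc
    refine (Integrable.indicator hc (hm w)).congr (Eventually.of_forall fun r => ?_)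
    by_cases hr : coord r ω = w <;> simp [Set.indicator, visit, hr]
  simp only [generator_single]
  exact Integrable.sub (integrable_finsetSum _ fun z' hz' =>
    hi z' _ (hk.integrableOn ((G.mem_neighborFinset z z').1 hz').symm hs ht))
    (hi z _ (hk.integrableOn_totalRate z hs ht))

/-- The compensator `∫_0^t K_s u(X_s) ds` is adapted. -/
theorem ContinuousRates.stronglyMeasurable_compensator {k : ℝ → X → X → ℝ}
    (hk : ContinuousRates G k) (z : X) {t : ℝ} (ht0 : 0 ≤ t) (ht : t < 1) :
    StronglyMeasurable[sigmaAt G (Icc 0 t)] fun ω : PathSpace G =>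
      ∫ r in (0 : ℝ)..t, generator G k r (Finsupp.single z 1) (coord r ω) := by
  let c : X → ℝ → ℝ := fun z' => (Ico (0 : ℝ) 1).indicator fun r => k r z' z
  let d : ℝ → ℝ := (Ico (0 : ℝ) 1).indicator fun r => totalRate G k r z
  have hind : ∀ f : ℝ → ℝ, ContinuousOn f (Ico 0 1) → Measurable ((Ico (0 : ℝ) 1).indicator f) := by
    intro f hf
    classical
    rw [← Set.piecewise_eq_indicator]
    exact hf.measurable_piecewise continuousOn_const measurableSet_Ico
  let F : ℝ → PathSpace G → ℝ := fun r ω =>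
    ∑ z' ∈ G.neighborFinset z, (visit G (min r t) z').indicator (fun _ => c z' r) ω
      - (visit G (min r t) z).indicator (fun _ => d r) ω
  have hF : ∀ ω : PathSpace G, ∫ r in (0 : ℝ)..t,
      generator G k r (Finsupp.single z 1) (coord r ω) = ∫ r in Ioc 0 t, F r ω := by
    intro ω
    rw [intervalIntegral.integral_of_le ht0]
    refine setIntegral_congr_fun measurableSet_Ioc fun r hr => ?_
    have hr1 : r ∈ Ico (0 : ℝ) 1 := ⟨hr.1.le, hr.2.trans_lt ht⟩
    simp only [generator_single, F, c, d, min_eq_left hr.2, Set.indicator_of_mem hr1]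
  simp only [hF]
  let _ : MeasurableSpace (PathSpace G) := sigmaAt G (Icc 0 t)
  have hv : ∀ w, MeasurableSet {p : PathSpace G × ℝ | coord (min p.2 t) p.1 = w} := by
    intro w
    have h := measurableSet_progressive (G := G) ht0 w
    have h3 : (borel ℝ) = (inferInstance : MeasurableSpace ℝ) := (BorelSpace.measurable_eq).symm
    rw [h3] at h
    exact h.preimage measurable_swap
  have hmeas : ∀ w (f : ℝ → ℝ), Measurable f → Measurable fun p : PathSpace G × ℝ =>
      (visit G (min p.2 t) w).indicator (fun _ => f p.2) p.1 := by
    intro w f hf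
    have := (hf.comp (measurable_snd (α := PathSpace G))).indicator (hv w)
    exact this
  have hFm : Measurable fun p : PathSpace G × ℝ => F p.2 p.1 := by
    refine Measurable.sub (Finset.measurable_sum _ fun z' hz' => hmeas z' _ (hind _ ?_))
      (hmeas z _ (hind _ (hk.continuousOn_totalRate z)))
    exact hk ((G.mem_neighborFinset z z').1 hz').symm
  exact hFm.stronglyMeasurable.integral_prod_right (ν := volume.restrict (Ioc 0 t))

/-- The process `u(X_t) - ∫_0^t K_s u(X_s) ds`, in the form used by `HasIntensity`. -/
noncomputable def dynkin (G : SimpleGraph X) [G.LocallyFinite] (k : ℝ → X → X → ℝ) (u : X →₀ ℝ)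
    (t : Time) (ω : PathSpace G) : ℝ :=
  u (coord t ω) - ∫ s in (0 : ℝ)..t, generator G k s u (coord s ω)

theorem ContinuousRates.stronglyMeasurable_dynkin {k : ℝ → X → X → ℝ}
    (hk : ContinuousRates G k) (z : X) (t : Time) :
    StronglyMeasurable[sigmaAt G (Icc 0 t)] (dynkin G k (Finsupp.single z 1) t) := by
  refine StronglyMeasurable.sub ?_ (hk.stronglyMeasurable_compensator z t.2.1 t.2.2)
  simp only [single_coord]
  exact stronglyMeasurable_const.indicator
    (measurableSet_visit_sigmaAt (S := Icc 0 (t : ℝ)) (right_mem_Icc.2 t.2.1) z)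

theorem ContinuousRates.exists_bound_dynkin {k : ℝ → X → X → ℝ}
    (hk : ContinuousRates G k) (z : X) (t : Time) :
    ∃ C : ℝ, 0 ≤ C ∧ ∀ r ≤ t, ∀ ω, ‖dynkin G k (Finsupp.single z 1) r ω‖ ≤ C := by
  obtain ⟨C, hC0, hC⟩ := hk.exists_bound z t.2.2
  refine ⟨1 + C, by positivity, fun r hr ω => ?_⟩
  refine (norm_sub_le _ _).trans (add_le_add ?_ ?_)
  · rw [single_coord]
    by_cases h : ω ∈ visit G r z <;> simp [Set.indicator, h]
  · have hr0 : (0 : ℝ) ≤ r := r.2.1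
    refine (intervalIntegral.norm_integral_le_of_norm_le_const (C := C) fun x hx => ?_).trans ?_
    · rw [Set.uIoc_of_le hr0] at hx
      exact hC x ⟨hx.1.le, hx.2.trans hr⟩ ω
    · rw [sub_zero, abs_of_nonneg hr0]
      exact mul_le_of_le_one_right hC0 r.2.2.le

theorem ContinuousRates.integrable_dynkin {k : ℝ → X → X → ℝ} (hk : ContinuousRates G k)
    (Q : Measure (PathSpace G)) [IsFiniteMeasure Q] (z : X) (t : Time) :
    Integrable (dynkin G k (Finsupp.single z 1) t) Q := by
  obtain ⟨C, -, hC⟩ := hk.exists_bound_dynkin z t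
  exact Integrable.of_bound ((hk.stronglyMeasurable_dynkin z t).mono
    ((canonicalFiltration G).le t)).aestronglyMeasurable C (Eventually.of_forall (hC t le_rfl))

theorem ContinuousRates.setIntegral_dynkin {k : ℝ → X → X → ℝ} (hk : ContinuousRates G k)
    (Q : Measure (PathSpace G)) [IsFiniteMeasure Q] (z : X) {s t : Time} (hst : s ≤ t)
    (A : Set (PathSpace G)) :
    ∫ ω in A, dynkin G k (Finsupp.single z 1) t ω ∂Q
        - ∫ ω in A, dynkin G k (Finsupp.single z 1) s ω ∂Q =
      Q.real (A ∩ visit G t z) - Q.real (A ∩ visit G s z)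
        - ∫ r in (s : ℝ)..t, masterRate G k r (fun w => Q.real (A ∩ visit G r w)) z := by
  have hst' : (s : ℝ) ≤ t := hst
  rw [← hk.setIntegral_integral_generator Q z s.2.1 hst t.2.2 A]
  have hvi : ∀ r : Time, Integrable (fun ω => Finsupp.single z (1 : ℝ) (coord r ω))
      (Q.restrict A) := fun r => by
    simp only [single_coord]
    exact (integrable_const _).indicator (measurableSet_visit r z)
  have hv : ∀ r : Time, ∫ ω in A, Finsupp.single z (1 : ℝ) (coord r ω) ∂Q =
      Q.real (A ∩ visit G r z) := fun r => by
    simp only [single_coord]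
    rw [integral_indicator_const _ (measurableSet_visit _ z), smul_eq_mul, mul_one,
      measureReal_restrict_apply (measurableSet_visit _ z), Set.inter_comm]
  have hci : ∀ r : Time, Integrable (fun ω => ∫ x in (0 : ℝ)..r,
      generator G k x (Finsupp.single z 1) (coord x ω)) (Q.restrict A) := fun r =>
    ((hvi r).sub (hk.integrable_dynkin (Q.restrict A) z r)).congr
      (Eventually.of_forall fun ω => by simp [dynkin])
  simp only [dynkin]
  rw [integral_sub (hvi t) (hci t), integral_sub (hvi s) (hci s), hv, hv]
  have hsplit : ∀ ω : PathSpace G, ∫ r in (s : ℝ)..t,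
      generator G k r (Finsupp.single z 1) (coord r ω) =
      (∫ r in (0 : ℝ)..t, generator G k r (Finsupp.single z 1) (coord r ω))
      - ∫ r in (0 : ℝ)..s, generator G k r (Finsupp.single z 1) (coord r ω) := fun ω => by
    rw [← intervalIntegral.integral_add_adjacent_intervals
      (hk.intervalIntegrable_generator z le_rfl s.2.1 s.2.2 ω)
      (hk.intervalIntegrable_generator z s.2.1 hst t.2.2 ω)]
    ring
  simp only [hsplit]
  rw [integral_sub (hci t) (hci s)]
  ring

/-- Local martingales that are bounded on each `[0,t]` are martingales; hence the intensity of a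
walk governs its forward equation. -/
theorem HasIntensity.isForward {Q : Measure (PathSpace G)} [IsFiniteMeasure Q] {k : ℝ → X → X → ℝ}
    (hQ : HasIntensity Q k) (hk : ContinuousRates G k) : IsForward Q k := by
  intro s t hs hst ht A hA z
  let s' : Time := ⟨s, hs, hst.trans_lt ht⟩
  let t' : Time := ⟨t, hs.trans hst, ht⟩
  have hst' : s' ≤ t' := hst
  obtain ⟨τ, hτ, hmart⟩ := hQ.martingale (Finsupp.single z 1)
  change ∀ n, Martingale (stoppedProcess (fun i => {ω | ⊥ < τ n ω}.indicator
    (dynkin G k (Finsupp.single z 1) i)) (τ n)) (canonicalFiltration G) Q at hmart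
  obtain ⟨C, hC0, hC⟩ := hk.exists_bound_dynkin z t'
  -- the stopped martingales converge boundedly to the unstopped process
  have hlim : ∀ r : Time, r ≤ t' → Tendsto (fun n => ∫ ω in A,
      stoppedProcess (fun i => {ω | ⊥ < τ n ω}.indicator (dynkin G k (Finsupp.single z 1) i))
        (τ n) r ω ∂Q) atTop (𝓝 (∫ ω in A, dynkin G k (Finsupp.single z 1) r ω ∂Q)) := by
    intro r hr
    refine tendsto_integral_of_dominated_convergence (fun _ => C) (fun n => ?_)
      (integrable_const C) (fun n => Eventually.of_forall fun ω => ?_) ?_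
    · exact ((hmart n).integrable r).aestronglyMeasurable.restrict
    · simp only [stoppedProcess]
      by_cases h : ω ∈ {ω | ⊥ < τ n ω}
      · rw [Set.indicator_of_mem h]
        refine hC _ ?_ ω
        have h1 : min (r : WithTop Time) (τ n ω) ≤ r := min_le_left _ _
        obtain ⟨q, hq⟩ := WithTop.ne_top_iff_exists.1 (ne_top_of_le_ne_top WithTop.coe_ne_top h1)
        rw [← hq] at h1 ⊢
        rw [WithTop.untopA_eq_untop (by simp), WithTop.untop_coe]
        exact (WithTop.coe_le_coe.1 h1).trans hr
      · rw [Set.indicator_of_notMem h, norm_zero]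
        exact hC0
    · filter_upwards [ae_restrict_of_ae hτ.tendsto_top] with ω hω
      refine tendsto_const_nhds.congr' ?_
      filter_upwards [hω.eventually (lt_mem_nhds (WithTop.coe_lt_top r))] with n hn
      simp only [stoppedProcess]
      rw [min_eq_left hn.le, WithTop.untopA_eq_untop (by simp), WithTop.untop_coe, Set.indicator_of_mem]
      exact lt_of_le_of_lt bot_le hn
  have heq := tendsto_nhds_unique (hlim s' hst') ((hlim t' le_rfl).congr fun n =>
    ((hmart n).setIntegral_eq hst' (s := A) hA).symm)
  have := hk.setIntegral_dynkin Q z hst' A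
  rw [heq, sub_self] at this
  change 0 = Q.real (A ∩ visit G t z) - Q.real (A ∩ visit G s z)
        - ∫ r in s..t, masterRate G k r (fun w => Q.real (A ∩ visit G r w)) z at this
  linarith

theorem generator_add (k : ℝ → X → X → ℝ) (t : ℝ) (u v : X →₀ ℝ) (z : X) :
    generator G k t (u + v : X →₀ ℝ) z = generator G k t u z + generator G k t v z := by
  simp only [generator, Finsupp.add_apply, ← Finset.sum_add_distrib]
  exact Finset.sum_congr rfl fun _ _ => by ring

theorem generator_smul (k : ℝ → X → X → ℝ) (t : ℝ) (c : ℝ) (u : X →₀ ℝ) (z : X) :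
    generator G k t (c • u : X →₀ ℝ) z = c * generator G k t u z := by
  simp only [generator, Finsupp.smul_apply, smul_eq_mul, Finset.mul_sum]
  exact Finset.sum_congr rfl fun _ _ => by ring

/-- Conversely, a solution of the forward equation solves the martingale problem. -/
theorem IsForward.martingale_dynkin {Q : Measure (PathSpace G)} [IsFiniteMeasure Q]
    {k : ℝ → X → X → ℝ} (hQ : IsForward Q k) (hk : ContinuousRates G k) (u : X →₀ ℝ) :
    Martingale (dynkin G k u) (canonicalFiltration G) Q := by
  suffices h : Martingale (dynkin G k u) (canonicalFiltration G) Q ∧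
      ∀ (t : Time) (ω : PathSpace G),
        IntervalIntegrable (fun r => generator G k r u (coord r ω)) volume 0 t from h.1
  induction u using Finsupp.induction_linear with
  | zero =>
    refine ⟨?_, fun t ω => ?_⟩
    · have : dynkin G k (0 : X →₀ ℝ) = 0 := by
        ext t ω
        simp [dynkin, generator]
      rw [this]
      exact martingale_zero _ _ _
    · simp [generator]
  | add u v hu hv =>
    refine ⟨?_, fun t ω => ?_⟩
    · have : dynkin G k (u + v) = dynkin G k u + dynkin G k v := by
        ext t ω
        simp only [dynkin, generator_add, Pi.add_apply, Finsupp.add_apply]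
        rw [intervalIntegral.integral_add (hu.2 t ω) (hv.2 t ω)]
        ring
      rw [this]
      exact hu.1.add hv.1
    · simp only [generator_add]
      exact (hu.2 t ω).add (hv.2 t ω)
  | single z c =>
    have hc : Finsupp.single z c = c • Finsupp.single z (1 : ℝ) := by simp
    refine ⟨?_, fun t ω => ?_⟩
    · have : dynkin G k (Finsupp.single z c) = c • dynkin G k (Finsupp.single z 1) := by
        ext t ω
        rw [hc]
        simp only [dynkin, generator_smul, Pi.smul_apply, Finsupp.smul_apply, smul_eq_mul,
          intervalIntegral.integral_const_mul]
        ring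
      rw [this]
      refine Martingale.smul c ⟨fun t => hk.stronglyMeasurable_dynkin z t, fun s t hst => ?_⟩
      refine (ae_eq_condExp_of_forall_setIntegral_eq ((canonicalFiltration G).le s)
        (hk.integrable_dynkin Q z t) (fun A _ _ => (hk.integrable_dynkin Q z s).integrableOn)
        (fun A hA _ => ?_) (hk.stronglyMeasurable_dynkin z s).aestronglyMeasurable).symm
      have h1 := hk.setIntegral_dynkin Q z hst A
      have h2 := hQ s.2.1 hst t.2.2 hA z
      linarith
    · rw [hc]
      simp only [generator_smul]
      exact (hk.intervalIntegrable_generator z le_rfl t.2.1 t.2.2 ω).const_mul c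

end ForwardEquation

section Killing

variable {X : Type*} {G : SimpleGraph X}

/-! ### Killing the walk at the exit of a finite set -/

/-- The event that the walk is in `F` at all the times of `D ∩ [s,r]`. -/
def stay (G : SimpleGraph X) (F : Set X) (D : Set ℝ) (s r : ℝ) : Set (PathSpace G) :=
  {ω | ∀ q ∈ D, s ≤ q → q ≤ r → coord q ω ∈ F}

theorem measurableSet_stay (F : Set X) {D : Set ℝ} (hD : D.Countable) {s : ℝ} (hs : 0 ≤ s) (r : ℝ) :
    MeasurableSet[sigmaAt G (Icc 0 r)] (stay G F D s r) := by
  have : stay G F D s r = ⋂ q ∈ D ∩ Icc s r, {ω | coord q ω ∈ F} := by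
    ext ω
    simp only [stay, Set.mem_ofPred_eq, Set.mem_iInter, Set.mem_inter_iff, Set.mem_Icc, and_imp]
  rw [this]
  refine MeasurableSet.biInter (hD.mono Set.inter_subset_left) fun q hq => ?_
  exact measurableSet_coord_mem (S := Icc 0 r) ⟨hs.trans hq.2.1, hq.2.2⟩ F

theorem measurableSet_coord_mem' (t : ℝ) (U : Set X) :
    MeasurableSet {ω : PathSpace G | coord t ω ∈ U} := by
  have : {ω : PathSpace G | coord t ω ∈ U} = {ω | coord (max 0 (min t 1)) ω ∈ U} := by
    ext ω
    rcases le_total t 1 with h1 | h1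
    · rcases le_total t 0 with h0 | h0
      · simp [h0, coord_of_le_zero h0, min_eq_left h1]
      · simp [h0, min_eq_left h1]
    · simp [h1, coord_of_one_le h1]
  rw [this]
  exact measurableSet_coord_mem (S := Icc 0 1) ⟨le_max_left _ _, by simp⟩ U

theorem measurableSet_stay_uncurry (F : Set X) {D : Set ℝ} (hD : D.Countable) (s : ℝ) :
    MeasurableSet {p : ℝ × PathSpace G | p.2 ∈ stay G F D s p.1} := by
  have : {p : ℝ × PathSpace G | p.2 ∈ stay G F D s p.1} =
      ⋂ q ∈ D ∩ Ici s, (Iio q ×ˢ univ ∪ univ ×ˢ {ω | coord q ω ∈ F}) := by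
    ext p
    simp only [stay, Set.mem_ofPred_eq, Set.mem_iInter, Set.mem_inter_iff, Set.mem_Ici, and_imp,
      Set.mem_union, Set.mem_prod, Set.mem_univ, and_true, true_and, Set.mem_Iio]
    refine forall_congr' fun q => forall_congr' fun _ => forall_congr' fun _ => ?_
    rw [← not_le, ← imp_iff_not_or]
  rw [this]
  refine MeasurableSet.biInter (hD.mono Set.inter_subset_left) fun q _ => ?_
  exact (measurableSet_Iio.prod MeasurableSet.univ).union
    (MeasurableSet.univ.prod (measurableSet_coord_mem' q F))

theorem measurable_measureReal_stay (Q : Measure (PathSpace G)) [IsFiniteMeasure Q] (F : Set X)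
    {D : Set ℝ} (hD : D.Countable) (s : ℝ) {A : Set (PathSpace G)} (hA : MeasurableSet A) (w : X) :
    Measurable fun r => Q.real (A ∩ stay G F D s r ∩ visit G r w) := by
  have h := measurable_measureReal_inter_visit Q
    ((MeasurableSet.univ.prod hA).inter (measurableSet_stay_uncurry (G := G) F hD s)) w
  have e : ∀ r, {ω | (r, ω) ∈ univ ×ˢ A ∩ {p : ℝ × PathSpace G | p.2 ∈ stay G F D s p.1}} =
      A ∩ stay G F D s r := fun r => by
    ext ω
    simp
  simpa only [e] using h

theorem abs_measureReal_le (Q : Measure (PathSpace G)) [IsFiniteMeasure Q] (A : Set (PathSpace G)) :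
    |Q.real A| ≤ Q.real univ := by
  rw [abs_of_nonneg measureReal_nonneg]
  exact measureReal_mono (Set.subset_univ _)

/-- The rational times, at which the càdlàg walk is observed. -/
def ratTimes : Set ℝ := Set.range ((↑) : ℚ → ℝ)

theorem countable_ratTimes : ratTimes.Countable := Set.countable_range _

/-- The walk, killed at the exit of `F`, does not charge the complement of `F`, except at
countably many times. -/
theorem ae_measureReal_stay_eq_zero (Q : Measure (PathSpace G)) [IsFiniteMeasure Q] (F : Set X)
    (s : ℝ) {A : Set (PathSpace G)} (hA : MeasurableSet A) {w : X} (hw : w ∉ F) :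
    ∀ᵐ r : ℝ, s < r → Q.real (A ∩ stay G F ratTimes s r ∩ visit G r w) = 0 := by
  let E : Ioi s → Set (PathSpace G) := fun r => A ∩ stay G F ratTimes s r ∩ visit G r w
  have hE : ∀ r, MeasurableSet (E r) := fun r => by
    refine (hA.inter ?_).inter (measurableSet_visit _ w)
    exact (measurableSet_stay_uncurry (G := G) F countable_ratTimes s).preimage
        (measurable_const.prodMk measurable_id)
  have hlt : ∀ r r' : Ioi s, r < r' → Disjoint (E r) (E r') := by
    intro r r' hrr
    rw [Set.disjoint_left]
    rintro ω ⟨-, hω⟩ ⟨⟨-, hω'⟩, -⟩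
    have h1 : ∀ᶠ q in 𝓝[>] (r : ℝ), coord q ω = w ∧ q < r' := by
      filter_upwards [coord_right_continuous (r : ℝ) ω,
        mem_nhdsWithin_of_mem_nhds (Iio_mem_nhds (show (r : ℝ) < r' from hrr))] with q hq hq'
      exact ⟨hq.trans hω, hq'⟩
    obtain ⟨b, hb, hbs⟩ := (mem_nhdsGT_iff_exists_Ioo_subset).1 h1
    obtain ⟨q, hq1, hq2⟩ := exists_rat_btwn (show (r : ℝ) < b from hb)
    have h2 := hbs ⟨hq1, hq2⟩
    have h3 := hω' q ⟨q, rfl⟩ ((le_of_lt r.2).trans hq1.le) h2.2.le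
    rw [h2.1] at h3
    exact hw h3
  have hdisj : Pairwise (Function.onFun Disjoint E) := by
    intro r r' hne
    rcases lt_or_gt_of_ne hne with h | h
    · exact hlt r r' h
    · exact (hlt r' r h).symm
  have hc := Measure.countable_meas_pos_of_disjoint_iUnion (μ := Q) hE hdisj
  have hc' : (Subtype.val '' {r | 0 < Q (E r)}).Countable := hc.image _
  filter_upwards [hc'.ae_notMem volume] with r hr hsr
  by_contra h
  refine hr ⟨⟨r, hsr⟩, ?_, rfl⟩
  refine (bot_lt_iff_ne_bot (a := Q (E ⟨r, hsr⟩))).2 fun h0 => h ?_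
  change Q (A ∩ stay G F ratTimes s r ∩ visit G r w) = 0 at h0
  simp [measureReal_def, h0]

/-- Since paths visit finitely many vertices, killing at the exit of `F` disappears as `F` grows. -/
theorem tendsto_measureReal_stay [Countable X] (Q : Measure (PathSpace G)) [IsFiniteMeasure Q] (s t : ℝ)
    {A : Set (PathSpace G)} (z : X) :
    Tendsto (fun F : Finset X => Q.real (A ∩ stay G F ratTimes s t ∩ visit G t z)) atTop
      (𝓝 (Q.real (A ∩ visit G t z))) := by
  have hU : A ∩ visit G t z = ⋃ F : Finset X, A ∩ stay G F ratTimes s t ∩ visit G t z := by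
    ext ω
    simp only [Set.mem_inter_iff, Set.mem_iUnion]
    refine ⟨fun h => ⟨(finite_range_coord ω).toFinset, ⟨h.1, fun q _ _ _ => ?_⟩, h.2⟩,
      fun ⟨F, h⟩ => ⟨h.1.1, h.2⟩⟩
    simp
  rw [hU]
  refine (ENNReal.tendsto_toReal (measure_ne_top Q _)).comp (tendsto_measure_iUnion_atTop ?_)
  intro F F' hF ω hω
  exact ⟨⟨hω.1.1, fun q hq h1 h2 => hF (hω.1.2 q hq h1 h2)⟩, hω.2⟩

variable [G.LocallyFinite]

theorem ContinuousRates.exists_rate_bound {k : ℝ → X → X → ℝ} (hk : ContinuousRates G k) (z : X)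
    {s t : ℝ} (hs : 0 ≤ s) (ht : t < 1) :
    ∃ C : ℝ, 0 ≤ C ∧ ∀ r ∈ Icc s t, ∀ (m : X → ℝ) (c : ℝ), (∀ w, |m w| ≤ c) →
      |masterRate G k r m z| ≤ c * C := by
  have hc : ContinuousOn (fun r => ∑ z' ∈ G.neighborFinset z, |k r z' z| + |totalRate G k r z|)
      (Icc s t) := by
    refine ContinuousOn.mono ?_ (fun r hr => ⟨hs.trans hr.1, hr.2.trans_lt ht⟩ : Icc s t ⊆ Ico 0 1)
    refine (continuousOn_finsetSum _ fun z' hz' => ?_).add (hk.continuousOn_totalRate z).abs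
    exact (hk ((G.mem_neighborFinset z z').1 hz').symm).abs
  obtain ⟨C, hC⟩ := isCompact_Icc.exists_bound_of_continuousOn hc
  refine ⟨max C 0, le_max_right _ _, fun r hr m c hm => ?_⟩
  have hc0 : 0 ≤ c := (abs_nonneg _).trans (hm z)
  refine le_trans ?_ (mul_le_mul_of_nonneg_left
    ((le_abs_self _).trans ((hC r hr).trans (le_max_left _ _))) hc0)
  rw [mul_add, Finset.mul_sum]
  refine (abs_sub _ _).trans (add_le_add ((Finset.abs_sum_le_sum_abs _ _).trans
    (Finset.sum_le_sum fun z' _ => ?_)) ?_)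
  · rw [abs_mul]
    exact mul_le_mul_of_nonneg_right (hm _) (abs_nonneg _)
  · rw [abs_mul]
    exact mul_le_mul_of_nonneg_right (hm _) (abs_nonneg _)

theorem ContinuousRates.aestronglyMeasurable_masterRate {k : ℝ → X → X → ℝ}
    (hk : ContinuousRates G k) (z : X) {s t : ℝ} (hs : 0 ≤ s) (ht : t < 1) {m : ℝ → X → ℝ}
    (hm : ∀ w, Measurable fun r => m r w) :
    AEStronglyMeasurable (fun r => masterRate G k r (m r) z) (volume.restrict (Ioc s t)) := by
  refine AEStronglyMeasurable.sub
    (Finset.aestronglyMeasurable_fun_sum _ fun z' hz' => ?_) ?_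
  · exact (hm z').aestronglyMeasurable.mul
      (hk.integrableOn ((G.mem_neighborFinset z z').1 hz').symm hs ht).aestronglyMeasurable
  · exact (hm z).aestronglyMeasurable.mul
      (hk.integrableOn_totalRate z hs ht).aestronglyMeasurable

theorem ContinuousRates.intervalIntegrable_masterRate {k : ℝ → X → X → ℝ}
    (hk : ContinuousRates G k) (z : X) {s t : ℝ} (hs : 0 ≤ s) (hst : s ≤ t) (ht : t < 1)
    {m : ℝ → X → ℝ} (hm : ∀ w, Measurable fun r => m r w) {c : ℝ} (hc : ∀ r w, |m r w| ≤ c) :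
    IntervalIntegrable (fun r => masterRate G k r (m r) z) volume s t := by
  obtain ⟨C, -, hC⟩ := hk.exists_rate_bound z hs ht
  rw [intervalIntegrable_iff_integrableOn_Ioc_of_le hst]
  refine IntegrableOn.of_bound (by simp) (hk.aestronglyMeasurable_masterRate z hs ht hm) (c * C) ?_
  refine (ae_restrict_iff' measurableSet_Ioc).2 (Eventually.of_forall fun r hr => ?_)
  exact hC r ⟨hr.1.le, hr.2⟩ _ _ (hc r)

/-- The forward equation of the walk observed at finitely many times and killed when it is seen
outside of `F`. -/
theorem IsForward.killed_finset {Q : Measure (PathSpace G)} [IsFiniteMeasure Q]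
    {k : ℝ → X → X → ℝ} (hQ : IsForward Q k) (hk : ContinuousRates G k) (F : Set X)
    (D : Finset ℝ) {s : ℝ} (hs : 0 ≤ s) {A : Set (PathSpace G)}
    (hA : MeasurableSet[sigmaAt G (Icc 0 s)] A) {z : X} (hz : z ∈ F) :
    ∀ t, s ≤ t → t < 1 → Q.real (A ∩ stay G F D s t ∩ visit G t z) - Q.real (A ∩ visit G s z) =
      ∫ r in s..t, masterRate G k r (fun w => Q.real (A ∩ stay G F D s r ∩ visit G r w)) z := by
  induction D using Finset.induction_on_max with
  | empty =>
    intro t hst ht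
    simpa [stay] using hQ hs hst ht hA z
  | insert d D hD ih =>
    intro t hst ht
    -- the last time `d` of observation only matters after `d`, where its effect is to replace the
    -- event of the past by the smaller one `B`
    by_cases hd : s ≤ d ∧ d ≤ t
    · obtain ⟨hsd, hdt⟩ := hd
      have hA1 : MeasurableSet A := sigmaAt_le (Icc_subset_Icc_right (hst.trans ht.le)) _ hA
      set E : Set ℝ := ↑(insert d D)
      have hE : E.Countable := Finset.countable_toSet _
      set B := A ∩ stay G F E s d
      have hB : MeasurableSet[sigmaAt G (Icc 0 d)] B :=
        (sigmaAt_mono G (Icc_subset_Icc_right hsd) _ hA).inter (measurableSet_stay F hE hs d)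
      have h1 : ∀ r, d ≤ r → stay G F E s r = stay G F E s d := by
        intro r hr
        ext ω
        refine ⟨fun h q hq h1 h2 => h q hq h1 (h2.trans hr), fun h q hq h1 h2 => h q hq h1 ?_⟩
        rcases Finset.mem_insert.1 (Finset.mem_coe.1 hq) with rfl | hq
        · exact le_rfl
        · exact (hD q hq).le
      have h2 : ∀ r, r < d → stay G F E s r = stay G F (D : Set ℝ) s r := by
        intro r hr
        ext ω
        refine ⟨fun h q hq h1 h2 => h q (Finset.mem_coe.2 (Finset.mem_insert_of_mem hq)) h1 h2,
          fun h q hq h1 h2 => ?_⟩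
        rcases Finset.mem_insert.1 (Finset.mem_coe.1 hq) with rfl | hq
        · exact absurd hr (not_lt.2 h2)
        · exact h q hq h1 h2
      have h3 : B ∩ visit G d z = A ∩ stay G F (D : Set ℝ) s d ∩ visit G d z := by
        ext ω
        simp only [B, Set.mem_inter_iff, mem_visit]
        refine and_congr_left fun hω => and_congr_right fun _ => ?_
        refine ⟨fun h q hq h1 h2 => h q (Finset.mem_coe.2 (Finset.mem_insert_of_mem hq)) h1 h2,
          fun h q hq h1 h2 => ?_⟩
        rcases Finset.mem_insert.1 (Finset.mem_coe.1 hq) with rfl | hq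
        · rw [hω]
          exact hz
        · exact h q hq h1 h2
      have hint : ∀ a b, s ≤ a → a ≤ b → b ≤ t → IntervalIntegrable (fun r => masterRate G k r
          (fun w => Q.real (A ∩ stay G F E s r ∩ visit G r w)) z) volume a b :=
        fun a b ha hab hb => hk.intervalIntegrable_masterRate z (hs.trans ha) hab (hb.trans_lt ht)
          (fun w => measurable_measureReal_stay Q F hE s hA1 w) (fun r w => abs_measureReal_le Q _)
      rw [← intervalIntegral.integral_add_adjacent_intervals (hint s d le_rfl hsd hdt)
        (hint d t hsd hdt le_rfl)]
      have e1 := ih d hsd (hdt.trans_lt ht)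
      rw [← h3] at e1
      have e2 := hQ (hs.trans hsd) hdt ht hB z
      have e3 : ∫ r in s..d, masterRate G k r
          (fun w => Q.real (A ∩ stay G F E s r ∩ visit G r w)) z = ∫ r in s..d, masterRate G k r
          (fun w => Q.real (A ∩ stay G F (D : Set ℝ) s r ∩ visit G r w)) z := by
        refine intervalIntegral.integral_congr_ae ?_
        have hne : ∀ᵐ r : ℝ, r ≠ d := by simp [ae_iff]
        filter_upwards [hne] with r hr hr'
        rw [Set.uIoc_of_le hsd] at hr'
        simp only [h2 r (lt_of_le_of_ne hr'.2 hr)]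
      have e4 : ∫ r in d..t, masterRate G k r
          (fun w => Q.real (A ∩ stay G F E s r ∩ visit G r w)) z = ∫ r in d..t, masterRate G k r
          (fun w => Q.real (B ∩ visit G r w)) z := by
        refine intervalIntegral.integral_congr fun r hr => ?_
        rw [Set.uIcc_of_le hdt] at hr
        simp only [h1 r hr.1, B]
      rw [e3, e4, ← e1, ← e2, h1 t hdt]
      ring
    · have h : ∀ r, r ≤ t → stay G F (↑(insert d D) : Set ℝ) s r = stay G F (D : Set ℝ) s r := by
        intro r hr
        ext ω
        refine ⟨fun h q hq h1 h2 => h q (Finset.mem_coe.2 (Finset.mem_insert_of_mem hq)) h1 h2,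
          fun h q hq h1 h2 => ?_⟩
        rcases Finset.mem_insert.1 (Finset.mem_coe.1 hq) with rfl | hq
        · exact absurd ⟨h1, h2.trans hr⟩ hd
        · exact h q hq h1 h2
      rw [h t le_rfl, ih t hst ht]
      refine intervalIntegral.integral_congr fun r hr => ?_
      rw [Set.uIcc_of_le hst] at hr
      simp only [h r hr.2]

theorem tendsto_masterRate {ι : Type*} {l : Filter ι} {m : ι → X → ℝ} {m' : X → ℝ}
    (h : ∀ w, Tendsto (fun i => m i w) l (𝓝 (m' w))) (k : ℝ → X → X → ℝ) (r : ℝ) (z : X) :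
    Tendsto (fun i => masterRate G k r (m i) z) l (𝓝 (masterRate G k r m' z)) :=
  (tendsto_finsetSum _ fun z' _ => (h z').mul_const _).sub ((h z).mul_const _)

/-- The limit of `IsForward.killed_finset` along an exhaustion of the rational times. -/
theorem IsForward.killed_rat {Q : Measure (PathSpace G)} [IsFiniteMeasure Q]
    {k : ℝ → X → X → ℝ} (hQ : IsForward Q k) (hk : ContinuousRates G k) (F : Set X)
    {s t : ℝ} (hs : 0 ≤ s) (hst : s ≤ t) (ht : t < 1) {A : Set (PathSpace G)}
    (hA : MeasurableSet[sigmaAt G (Icc 0 s)] A) {z : X} (hz : z ∈ F) :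
    Q.real (A ∩ stay G F ratTimes s t ∩ visit G t z) - Q.real (A ∩ visit G s z) =
      ∫ r in s..t, masterRate G k r
        (fun w => Q.real (A ∩ stay G F ratTimes s r ∩ visit G r w)) z := by
  classical
  have hA1 : MeasurableSet A := sigmaAt_le (Icc_subset_Icc_right (hst.trans ht.le)) _ hA
  obtain ⟨e, he⟩ := exists_surjective_nat ℚ
  let D : ℕ → Finset ℝ := fun n => (Finset.range n).image fun i => (e i : ℝ)
  have hD : Monotone D := fun a b hab => Finset.image_subset_image (by simpa using hab)
  have hDQ : ∀ x, x ∈ ratTimes ↔ ∃ n, x ∈ D n := by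
    intro x
    constructor
    · rintro ⟨q, rfl⟩
      obtain ⟨i, rfl⟩ := he q
      exact ⟨i + 1, Finset.mem_image.2 ⟨i, by simp, rfl⟩⟩
    · rintro ⟨n, hn⟩
      obtain ⟨i, -, rfl⟩ := Finset.mem_image.1 hn
      exact ⟨_, rfl⟩
  have hlim : ∀ r w, Tendsto (fun n => Q.real (A ∩ stay G F (D n : Set ℝ) s r ∩ visit G r w)) atTop
      (𝓝 (Q.real (A ∩ stay G F ratTimes s r ∩ visit G r w))) := by
    intro r w
    have hi : A ∩ stay G F ratTimes s r ∩ visit G r w =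
        ⋂ n, A ∩ stay G F (D n : Set ℝ) s r ∩ visit G r w := by
      ext ω
      simp only [Set.mem_inter_iff, Set.mem_iInter, stay, Set.mem_ofPred_eq, hDQ]
      constructor
      · rintro ⟨⟨h1, h2⟩, h3⟩ n
        exact ⟨⟨h1, fun q hq => h2 q ⟨n, hq⟩⟩, h3⟩
      · intro h
        exact ⟨⟨(h 0).1.1, fun q ⟨n, hq⟩ => (h n).1.2 q hq⟩, (h 0).2⟩
    rw [hi]
    refine (ENNReal.tendsto_toReal (measure_ne_top Q _)).comp
      (tendsto_measure_iInter_atTop (fun n => ?_) ?_ ⟨0, measure_ne_top Q _⟩)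
    · refine ((hA1.inter ?_).inter (measurableSet_visit r w)).nullMeasurableSet
      exact (measurableSet_stay_uncurry (G := G) F (Finset.countable_toSet (D n)) s).preimage
        (measurable_const.prodMk measurable_id)
    · intro a b hab ω hω
      exact ⟨⟨hω.1.1, fun q hq => hω.1.2 q (hD hab hq)⟩, hω.2⟩
  obtain ⟨C, -, hC⟩ := hk.exists_rate_bound z hs ht
  refine tendsto_nhds_unique (((hlim t z).sub_const _).congr fun n =>
    hQ.killed_finset hk F (D n) hs hA hz t hst ht) ?_
  refine intervalIntegral.tendsto_integral_filter_of_dominated_convergence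
    (fun _ => Q.real univ * C) (Eventually.of_forall fun n => ?_)
    (Eventually.of_forall fun n => Eventually.of_forall fun r hr => ?_) (by simp)
    (Eventually.of_forall fun r _ => tendsto_masterRate (hlim r) k r z)
  · rw [Set.uIoc_of_le hst]
    exact hk.aestronglyMeasurable_masterRate z hs ht fun w =>
      measurable_measureReal_stay Q F (Finset.countable_toSet _) s hA1 w
  · rw [Set.uIoc_of_le hst] at hr
    exact hC r ⟨hr.1.le, hr.2⟩ _ _ fun w => abs_measureReal_le Q _

/-- The forward equation of the walk killed at the exit of `F`: a closed system for the masses of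
the points of `F`. -/
theorem IsForward.killed {Q : Measure (PathSpace G)} [IsFiniteMeasure Q]
    {k : ℝ → X → X → ℝ} (hQ : IsForward Q k) (hk : ContinuousRates G k) (F : Set X)
    {s t : ℝ} (hs : 0 ≤ s) (hst : s ≤ t) (ht : t < 1) {A : Set (PathSpace G)}
    (hA : MeasurableSet[sigmaAt G (Icc 0 s)] A) {z : X} (hz : z ∈ F) :
    Q.real (A ∩ stay G F ratTimes s t ∩ visit G t z) = Q.real (A ∩ visit G s z) +
      ∫ r in s..t, masterRate G k r
        (F.indicator fun w => Q.real (A ∩ stay G F ratTimes s r ∩ visit G r w)) z := by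
  have hA1 : MeasurableSet A := sigmaAt_le (Icc_subset_Icc_right (hst.trans ht.le)) _ hA
  rw [← sub_eq_iff_eq_add', hQ.killed_rat hk F hs hst ht hA hz]
  refine intervalIntegral.integral_congr_ae ?_
  -- no mass flows in from the complement of `F`
  have h : ∀ᵐ r : ℝ, ∀ w ∈ G.neighborFinset z, w ∉ F → s < r →
      Q.real (A ∩ stay G F ratTimes s r ∩ visit G r w) = 0 := by
    rw [Filter.eventually_all_finset]
    intro w _
    by_cases hw : w ∈ F
    · exact Eventually.of_forall fun _ h => absurd hw h
    · filter_upwards [ae_measureReal_stay_eq_zero Q F s hA1 hw] with r hr _ using hr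
  filter_upwards [h] with r hr hr'
  rw [Set.uIoc_of_le hst] at hr'
  unfold masterRate
  rw [Set.indicator_of_mem hz]
  congr 1
  refine Finset.sum_congr rfl fun w hw => ?_
  by_cases hwF : w ∈ F
  · rw [Set.indicator_of_mem hwF]
  · rw [Set.indicator_of_notMem hwF]
    simp only [hr w hw hwF hr'.1]

end Killing

section Comparison

variable {X : Type*} {G : SimpleGraph X}

/-! ### Comparison of two walks with gauge-equivalent intensities -/

theorem continuousOn_of_eq_integral {f φ : ℝ → ℝ} {a b : ℝ}
    (hφ : ∀ t ∈ Ico a b, IntervalIntegrable φ volume a t)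
    (h : ∀ t ∈ Ico a b, f t = f a + ∫ r in a..t, φ r) : ContinuousOn f (Ico a b) := by
  intro t ht
  obtain ⟨T, htT, hTb⟩ := exists_between ht.2
  have haT : a ≤ T := ht.1.trans htT.le
  have h1 : ContinuousOn f (Icc a T) := by
    have h2 := intervalIntegral.continuousOn_primitive_interval' (hφ T ⟨haT, hTb⟩)
      (left_mem_uIcc)
    rw [Set.uIcc_of_le haT] at h2
    exact (continuousOn_const.add h2).congr fun x hx => h x ⟨hx.1, hx.2.trans_lt hTb⟩
  refine (h1 t ⟨ht.1, htT.le⟩).mono_of_mem_nhdsWithin ?_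
  filter_upwards [self_mem_nhdsWithin, mem_nhdsWithin_of_mem_nhds (Iio_mem_nhds htT)] with x hx hx'
  exact ⟨hx.1, le_of_lt hx'⟩

theorem hasDerivWithinAt_of_eq_integral {f φ : ℝ → ℝ} {a b : ℝ} (hφ : ContinuousOn φ (Ico a b))
    (h : ∀ t ∈ Ico a b, f t = f a + ∫ r in a..t, φ r) {t : ℝ} (ht : t ∈ Ico a b) :
    HasDerivWithinAt f (φ t) (Ico a b) t := by
  obtain ⟨T, htT, hTb⟩ := exists_between ht.2
  have haT : a ≤ T := ht.1.trans htT.le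
  have hφT : ContinuousOn φ (Icc a T) := hφ.mono (Icc_subset_Ico_right hTb)
  set ψ : ℝ → ℝ := Set.IccExtend haT ((Icc a T).domRestrict φ)
  have hψ : Continuous ψ := (continuousOn_iff_continuous_domRestrict.1 hφT).Icc_extend'
  have hψe : ∀ x ∈ Icc a T, ψ x = φ x := fun x hx => by
    simp [ψ, Set.IccExtend_of_mem haT _ hx]
  have h1 : HasDerivAt (fun t => f a + ∫ r in a..t, ψ r) (ψ t) t :=
    (intervalIntegral.integral_hasDerivAt_right (hψ.intervalIntegrable _ _)
      hψ.aestronglyMeasurable.stronglyMeasurableAtFilter hψ.continuousAt).const_add _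
  rw [hψe t ⟨ht.1, htT.le⟩] at h1
  have h2 : HasDerivWithinAt f (φ t) (Icc a T) t := by
    refine h1.hasDerivWithinAt.congr (fun x hx => ?_) ?_
    · rw [h x ⟨hx.1, hx.2.trans_lt hTb⟩]
      congr 1
      refine intervalIntegral.integral_congr fun r hr => ?_
      rw [Set.uIcc_of_le hx.1] at hr
      exact (hψe r ⟨hr.1, hr.2.trans hx.2⟩).symm
    · rw [h t ht]
      congr 1
      refine intervalIntegral.integral_congr fun r hr => ?_
      rw [Set.uIcc_of_le ht.1] at hr
      exact (hψe r ⟨hr.1, hr.2.trans htT.le⟩).symm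
  refine h2.mono_of_mem_nhdsWithin ?_
  filter_upwards [self_mem_nhdsWithin, mem_nhdsWithin_of_mem_nhds (Iio_mem_nhds htT)] with x hx hx'
  exact ⟨hx.1, le_of_lt hx'⟩

/-- The cylinder `{X_q = f(q), q ∈ D}`. -/
def cyl (G : SimpleGraph X) (D : Finset ℝ) (f : ℝ → X) : Set (PathSpace G) :=
  {ω | ∀ q ∈ D, coord q ω = f q}

theorem cyl_eq_biInter (D : Finset ℝ) (f : ℝ → X) :
    cyl G D f = ⋂ q ∈ D, visit G q (f q) := by
  ext ω
  simp [cyl]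

@[simp] theorem cyl_empty (f : ℝ → X) : cyl G ∅ f = univ := by
  simp [cyl]

theorem measurableSet_cyl_sigmaAt {S : Set ℝ} {D : Finset ℝ} (hD : (D : Set ℝ) ⊆ S) (f : ℝ → X) :
    MeasurableSet[sigmaAt G S] (cyl G D f) := by
  rw [cyl_eq_biInter]
  exact D.measurableSet_biInter fun q hq => measurableSet_visit_sigmaAt (hD hq) _

theorem measurableSet_cyl (D : Finset ℝ) (f : ℝ → X) : MeasurableSet (cyl G D f) := by
  rw [cyl_eq_biInter]
  exact D.measurableSet_biInter fun q _ => measurableSet_visit _ _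

theorem cyl_mem_piiUnionInter [Nonempty X] {S : Set ℝ} {C : Set (PathSpace G)}
    (hC : C ∈ piiUnionInter (fun r => Set.range (visit G r)) S) :
    ∃ (D : Finset ℝ) (f : ℝ → X), (D : Set ℝ) ⊆ S ∧ C = cyl G D f := by
  classical
  obtain ⟨D, hD, g, hg, rfl⟩ := hC
  choose f hf using fun q : D => hg q q.2
  refine ⟨D, fun q => if h : q ∈ D then f ⟨q, h⟩ else Classical.arbitrary X, hD, ?_⟩
  rw [cyl_eq_biInter]
  refine Set.iInter₂_congr fun q hq => ?_
  rw [dif_pos hq]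
  exact (hf ⟨q, hq⟩).symm

theorem sigmaAt_eq_generateFrom [Nonempty X] [Countable X] (S : Set ℝ) :
    sigmaAt G S = MeasurableSpace.generateFrom
      (piiUnionInter (fun r => Set.range (visit G r)) S) := by
  refine le_antisymm ?_ ?_
  · refine iSup₂_le fun r hr => ?_
    rintro _ ⟨U, -, rfl⟩
    have : coord r ⁻¹' U = ⋃ x ∈ U, visit G r x := by
      ext ω
      simp
    rw [this]
    refine MeasurableSet.biUnion (Set.to_countable U) fun x _ => ?_
    exact (le_generateFrom_piiUnionInter (π := fun r => Set.range (visit G r)) S hr) _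
      (MeasurableSpace.measurableSet_generateFrom ⟨x, rfl⟩)
  · refine MeasurableSpace.generateFrom_le ?_
    intro C hC
    obtain ⟨D, f, hD, rfl⟩ := cyl_mem_piiUnionInter hC
    exact measurableSet_cyl_sigmaAt hD f

theorem isPiSystem_cyl (S : Set ℝ) :
    IsPiSystem (piiUnionInter (fun r => Set.range (visit G r)) S) := by
  refine isPiSystem_piiUnionInter _ (fun r => ?_) S
  rintro _ ⟨x, rfl⟩ _ ⟨y, rfl⟩ ⟨ω, hx, hy⟩
  have : x = y := by
    rw [← mem_visit.1 hx, mem_visit.1 hy]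
  subst this
  exact ⟨x, by simp⟩

/-- A finite measure on paths is determined by its finite-dimensional marginals. -/
theorem measure_eq_of_cyl [Nonempty X] [Countable X] {μ ν : Measure (PathSpace G)} [IsFiniteMeasure μ]
    {S : Set ℝ} (hS : S ⊆ Icc 0 1)
    (h : ∀ (D : Finset ℝ) (f : ℝ → X), (D : Set ℝ) ⊆ S → μ (cyl G D f) = ν (cyl G D f))
    (hu : μ univ = ν univ)
    {B : Set (PathSpace G)} (hB : MeasurableSet[sigmaAt G S] B) : μ B = ν B := by
  refine ext_on_measurableSpace_of_generate_finite _ _ ?_ (sigmaAt_le hS)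
    (sigmaAt_eq_generateFrom S) (isPiSystem_cyl S) hu hB
  intro C hC
  obtain ⟨D, f, hD, rfl⟩ := cyl_mem_piiUnionInter hC
  exact h D f hD

variable [G.LocallyFinite]

/-- On the time interval `[s,1)`, the intensity `k` is the `h`-transform of `j` by the positive
function `g = exp θ`: one has `k(t, z → z') = j(t, z → z') g(t,z') / g(t,z)`, and `g` solves the
backward Kolmogorov equation `∂_t g + J_t g = 0`, which reads `∂_t θ = j̄ - k̄`. -/
structure IsGauge (G : SimpleGraph X) [G.LocallyFinite] (k j : ℝ → X → X → ℝ) (θ : ℝ → X → ℝ)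
    (s : ℝ) : Prop where
  rate : ∀ r ∈ Ico s 1, ∀ z z', G.Adj z z' →
    k r z z' * Real.exp (θ r z) = j r z z' * Real.exp (θ r z')
  deriv : ∀ r ∈ Ico s 1, ∀ z, HasDerivWithinAt (fun r => θ r z)
    (totalRate G j r z - totalRate G k r z) (Ico s 1) r

theorem IsGauge.mono {k j : ℝ → X → X → ℝ} {θ : ℝ → X → ℝ} {s t : ℝ} (h : IsGauge G k j θ s)
    (hst : s ≤ t) : IsGauge G k j θ t :=
  ⟨fun r hr => h.rate r ⟨hst.trans hr.1, hr.2⟩, fun r hr z =>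
    (h.deriv r ⟨hst.trans hr.1, hr.2⟩ z).mono (Ico_subset_Ico_left hst)⟩

theorem isGauge_zero (j : ℝ → X → X → ℝ) (s : ℝ) : IsGauge G j j (fun _ _ => 0) s :=
  ⟨fun _ _ _ _ _ => rfl, fun r _ z => by simpa using hasDerivWithinAt_const r (Ico s 1) (0 : ℝ)⟩

section Killed

variable {Q : Measure (PathSpace G)} [IsFiniteMeasure Q] {k : ℝ → X → X → ℝ}

theorem IsForward.continuousOn_killed (hQ : IsForward Q k) (hk : ContinuousRates G k) (F : Set X)
    {s : ℝ} (hs : 0 ≤ s) (hs1 : s < 1) {A : Set (PathSpace G)}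
    (hA : MeasurableSet[sigmaAt G (Icc 0 s)] A) {z : X} (hz : z ∈ F) :
    ContinuousOn (fun t => Q.real (A ∩ stay G F ratTimes s t ∩ visit G t z)) (Ico s 1) := by
  have hA1 : MeasurableSet A := sigmaAt_le (Icc_subset_Icc_right hs1.le) _ hA
  refine continuousOn_of_eq_integral (φ := fun r => masterRate G k r
        (F.indicator fun w => Q.real (A ∩ stay G F ratTimes s r ∩ visit G r w)) z)
        (fun t ht => ?_) fun t ht => ?_
  · refine hk.intervalIntegrable_masterRate z hs ht.1 ht.2 (c := Q.real univ) (fun w => ?_)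
      fun r w => ?_
    · by_cases hw : w ∈ F
      · simpa [hw] using measurable_measureReal_stay Q F countable_ratTimes s hA1 w
      · simp [hw]
    · by_cases hw : w ∈ F
      · simpa [hw] using abs_measureReal_le Q _
      · simp [hw]
  · simp only [hQ.killed hk F hs ht.1 ht.2 hA hz, hQ.killed hk F hs le_rfl hs1 hA hz,
      intervalIntegral.integral_same, add_zero]

theorem continuousOn_masterRate (hk : ContinuousRates G k) {s : ℝ} (hs : 0 ≤ s) {m : ℝ → X → ℝ}
    (hm : ∀ w, ContinuousOn (fun r => m r w) (Ico s 1)) (z : X) :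
    ContinuousOn (fun r => masterRate G k r (m r) z) (Ico s 1) := by
  have hsub : Ico s 1 ⊆ Ico (0 : ℝ) 1 := Ico_subset_Ico_left hs
  refine ContinuousOn.sub (continuousOn_finsetSum _ fun w hw => (hm w).mul ?_)
    ((hm z).mul ((hk.continuousOn_totalRate z).mono hsub))
  exact (hk ((G.mem_neighborFinset z w).1 hw).symm).mono hsub

theorem IsForward.hasDerivWithinAt_killed (hQ : IsForward Q k) (hk : ContinuousRates G k)
    (F : Set X) {s : ℝ} (hs : 0 ≤ s) (hs1 : s < 1) {A : Set (PathSpace G)}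
    (hA : MeasurableSet[sigmaAt G (Icc 0 s)] A) {z : X} (hz : z ∈ F) {t : ℝ} (ht : t ∈ Ico s 1) :
    HasDerivWithinAt (fun t => Q.real (A ∩ stay G F ratTimes s t ∩ visit G t z))
      (masterRate G k t (F.indicator fun w => Q.real (A ∩ stay G F ratTimes s t ∩ visit G t w)) z)
      (Ico s 1) t := by
  refine hasDerivWithinAt_of_eq_integral (φ := fun r => masterRate G k r
    (F.indicator fun w => Q.real (A ∩ stay G F ratTimes s r ∩ visit G r w)) z)
    (continuousOn_masterRate hk hs (fun w => ?_) z) (fun t ht => ?_) ht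
  · by_cases hw : w ∈ F
    · simpa [hw] using hQ.continuousOn_killed hk F hs hs1 hA hw
    · simpa [hw] using continuousOn_const
  · simp only [hQ.killed hk F hs ht.1 ht.2 hA hz, hQ.killed hk F hs le_rfl hs1 hA hz,
      intervalIntegral.integral_same, add_zero]

/-- After division by the gauge, the killed masses of the walk of intensity `k` solve the killed
forward equation of intensity `j`. -/
theorem IsForward.hasDerivWithinAt_killed_gauge (hQ : IsForward Q k) (hk : ContinuousRates G k)
    {j : ℝ → X → X → ℝ} {θ : ℝ → X → ℝ} {s : ℝ} (hθ : IsGauge G k j θ s)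
    (F : Set X) (hs : 0 ≤ s) (hs1 : s < 1) {A : Set (PathSpace G)}
    (hA : MeasurableSet[sigmaAt G (Icc 0 s)] A) {z : X} (hz : z ∈ F) {t : ℝ} (ht : t ∈ Ico s 1) :
    HasDerivWithinAt
      (fun t => Q.real (A ∩ stay G F ratTimes s t ∩ visit G t z) * Real.exp (-θ t z))
      (masterRate G j t (F.indicator fun w =>
        Q.real (A ∩ stay G F ratTimes s t ∩ visit G t w) * Real.exp (-θ t w)) z)
      (Ico s 1) t := by
  have h1 := (hQ.hasDerivWithinAt_killed hk F hs hs1 hA hz ht).mul ((hθ.deriv t ht z).neg.exp)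
  refine h1.congr_deriv ?_
  set N : X → ℝ := fun w => Q.real (A ∩ stay G F ratTimes s t ∩ visit G t w)
  change masterRate G k t (F.indicator N) z * Real.exp (-θ t z) + N z *
    (Real.exp (-θ t z) * -(totalRate G j t z - totalRate G k t z)) =
    masterRate G j t (F.indicator fun w => N w * Real.exp (-θ t w)) z
  unfold masterRate
  rw [Set.indicator_of_mem hz, Set.indicator_of_mem hz, sub_mul, Finset.sum_mul]
  have h2 : ∀ w ∈ G.neighborFinset z, F.indicator N w * k t w z * Real.exp (-θ t z) =
      F.indicator (fun w => N w * Real.exp (-θ t w)) w * j t w z := by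
    intro w hw
    by_cases hwF : w ∈ F
    · rw [Set.indicator_of_mem hwF, Set.indicator_of_mem hwF]
      have h3 := hθ.rate t ht w z ((G.mem_neighborFinset z w).1 hw).symm
      rw [Real.exp_neg, Real.exp_neg]
      field_simp
      linear_combination N w * h3
    · rw [Set.indicator_of_notMem hwF, Set.indicator_of_notMem hwF]
      ring
  rw [Finset.sum_congr rfl h2]
  ring

end Killed

theorem masterRate_linear (j : ℝ → X → X → ℝ) (r : ℝ) (m m' : X → ℝ) (a b : ℝ) (z : X) :
    masterRate G j r (fun w => a * m w - b * m' w) z =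
      a * masterRate G j r m z - b * masterRate G j r m' z := by
  simp only [masterRate, mul_sub, Finset.mul_sum]
  rw [sub_sub_sub_comm, ← Finset.sum_sub_distrib]
  congr 1
  · exact Finset.sum_congr rfl fun _ _ => by ring
  · ring

/-- Uniqueness for the killed forward equation, a finite linear system. -/
theorem killed_unique {j : ℝ → X → X → ℝ} (hj : ContinuousRates G j) (F : Finset X) {s : ℝ}
    (hs : 0 ≤ s) {e : ℝ → X → ℝ}
    (he : ∀ z ∈ F, ∀ t ∈ Ico s 1, HasDerivWithinAt (fun t => e t z)
      (masterRate G j t ((F : Set X).indicator (e t)) z) (Ico s 1) t)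
    (h0 : ∀ z ∈ F, e s z = 0) : ∀ t ∈ Ico s 1, ∀ z ∈ F, e t z = 0 := by
  intro t ht z hz
  choose! C hC0 hC using fun z => hj.exists_rate_bound z hs ht.2
  let f : ℝ → F → ℝ := fun r w => e r w
  have key := eq_zero_of_abs_deriv_le_mul_abs_self_of_eq_zero_right (f := f)
    (f' := fun r w => masterRate G j r ((F : Set X).indicator (e r)) w) (a := s) (b := t)
    (K := ∑ z ∈ F, C z) ?_ ?_ ?_ ?_ t ⟨ht.1, le_rfl⟩
  · exact congrFun key ⟨z, hz⟩
  · refine continuousOn_pi.2 fun w r hr => ?_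
    exact ((he w w.2 r ⟨hr.1, hr.2.trans_lt ht.2⟩).continuousWithinAt).mono
      fun x hx => ⟨hx.1, hx.2.trans_lt ht.2⟩
  · intro r hr
    refine hasDerivWithinAt_pi.2 fun w => ?_
    refine (he w w.2 r ⟨hr.1, hr.2.trans ht.2⟩).mono_of_mem_nhdsWithin ?_
    filter_upwards [self_mem_nhdsWithin,
      mem_nhdsWithin_of_mem_nhds (Iio_mem_nhds (hr.2.trans ht.2))] with x hx hx'
    exact ⟨hr.1.trans hx, hx'⟩
  · ext w
    exact h0 w w.2
  · intro r hr
    have hnn : 0 ≤ ∑ z ∈ F, C z := Finset.sum_nonneg fun z _ => hC0 z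
    refine (pi_norm_le_iff_of_nonneg (by positivity)).2 fun w => ?_
    refine (hC w r ⟨hr.1, hr.2.le⟩ _ ‖f r‖ fun v => ?_).trans ?_
    · by_cases hv : v ∈ (F : Set X)
      · rw [Set.indicator_of_mem hv]
        exact norm_le_pi_norm (f r) ⟨v, hv⟩
      · rw [Set.indicator_of_notMem hv, abs_zero]
        exact norm_nonneg _
    · rw [mul_comm]
      exact mul_le_mul_of_nonneg_right
        (Finset.single_le_sum (fun z _ => hC0 z) w.2) (norm_nonneg _)

section Compare

variable [Countable X] {Q R : Measure (PathSpace G)} [IsFiniteMeasure Q] [IsFiniteMeasure R]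
  {k j : ℝ → X → X → ℝ} {θ : ℝ → X → ℝ}

/-- One-step comparison: given `X_s = a`, the law of `X_t` under `Q` has the density
`exp (θ(t, ·) - θ(s, a))` with respect to its law under `R`, whatever the pasts `A`, `A'`. -/
theorem compare_step (hQ : IsForward Q k) (hR : IsForward R j) (hk : ContinuousRates G k)
    (hj : ContinuousRates G j) {s t : ℝ} (hθ : IsGauge G k j θ s) (hs : 0 ≤ s) (hst : s ≤ t)
    (ht : t < 1) {A A' : Set (PathSpace G)} (hA : MeasurableSet[sigmaAt G (Icc 0 s)] A)
    (hA' : MeasurableSet[sigmaAt G (Icc 0 s)] A') {a : X} (hAa : A ⊆ visit G s a)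
    (hAa' : A' ⊆ visit G s a) (z : X) :
    Q.real (A ∩ visit G t z) * Real.exp (-θ t z) * R.real A' =
      Q.real A * Real.exp (-θ s a) * R.real (A' ∩ visit G t z) := by
  have hs1 := hst.trans_lt ht
  set α := R.real A'
  set β := Q.real A * Real.exp (-θ s a)
  have key : ∀ F : Finset X, z ∈ F →
      α * (Q.real (A ∩ stay G F ratTimes s t ∩ visit G t z) * Real.exp (-θ t z)) -
      β * R.real (A' ∩ stay G F ratTimes s t ∩ visit G t z) = 0 := by
    intro F hzF
    -- the difference of the two suitably weighted killed masses solves the killed equation of `j`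
    -- and vanishes at time `s`
    let e : ℝ → X → ℝ := fun r w =>
      α * (Q.real (A ∩ stay G F ratTimes s r ∩ visit G r w) * Real.exp (-θ r w)) -
      β * R.real (A' ∩ stay G F ratTimes s r ∩ visit G r w)
    refine killed_unique hj F hs (e := e) (fun w hw r hr => ?_) (fun w hw => ?_) t ⟨hst, ht⟩ z hzF
    · have h1 := hQ.hasDerivWithinAt_killed_gauge hk hθ (F : Set X) hs hs1 hA
        (Finset.mem_coe.2 hw) hr
      have h2 := hR.hasDerivWithinAt_killed hj (F : Set X) hs hs1 hA' (Finset.mem_coe.2 hw) hr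
      refine ((h1.const_mul α).sub (h2.const_mul β)).congr_deriv ?_
      rw [← masterRate_linear]
      congr 1
      ext v
      by_cases hv : v ∈ (F : Set X)
      · simp only [Set.indicator_of_mem hv, e]
      · simp only [Set.indicator_of_notMem hv]
        ring
    · have hwF : w ∈ (F : Set X) := Finset.mem_coe.2 hw
      have h1 := hQ.killed hk (F : Set X) hs le_rfl hs1 hA hwF
      have h2 := hR.killed hj (F : Set X) hs le_rfl hs1 hA' hwF
      rw [intervalIntegral.integral_same, add_zero] at h1 h2
      simp only [e]
      rw [h1, h2]
      by_cases hwa : w = a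
      · subst hwa
        rw [Set.inter_eq_left.2 hAa, Set.inter_eq_left.2 hAa']
        ring
      · have h0 : visit G s a ∩ visit G s w = ∅ := by
          ext ω
          simp only [Set.mem_inter_iff, mem_visit, Set.mem_empty_iff_false, iff_false, not_and]
          intro h h'
          exact hwa (h'.symm.trans h)
        have h3 : A ∩ visit G s w = ∅ :=
          Set.subset_eq_empty (Set.inter_subset_inter_left _ hAa) h0
        have h4 : A' ∩ visit G s w = ∅ :=
          Set.subset_eq_empty (Set.inter_subset_inter_left _ hAa') h0
        rw [h3, h4]
        simp
  -- let `F` grow to the whole of `X`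
  have h1 := ((tendsto_measureReal_stay Q s t (A := A) z).mul_const (Real.exp (-θ t z))).const_mul α
  have h2 := (tendsto_measureReal_stay R s t (A := A') z).const_mul β
  have h3 := tendsto_nhds_unique (h1.sub h2) (tendsto_const_nhds.congr'
    ((eventually_ge_atTop {z}).mono fun F hF => (key F (hF (by simp))).symm))
  linarith

/-- Comparison along cylinders, by iteration of the one-step comparison. -/
theorem compare_cyl (hQ : IsForward Q k) (hR : IsForward R j) (hk : ContinuousRates G k)
    (hj : ContinuousRates G j) {s : ℝ} (hθ : IsGauge G k j θ s) (hs : 0 ≤ s)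
    {A A' : Set (PathSpace G)} (hA : MeasurableSet[sigmaAt G (Icc 0 s)] A)
    (hA' : MeasurableSet[sigmaAt G (Icc 0 s)] A') {a : X} (hAa : A ⊆ visit G s a)
    (hAa' : A' ⊆ visit G s a) (f : ℝ → X) (D : Finset ℝ) :
    ∀ t, s ≤ t → t < 1 → (D : Set ℝ) ⊆ Icc s t → ∀ z,
      Q.real (A ∩ cyl G D f ∩ visit G t z) * Real.exp (-θ t z) * R.real A' =
        Q.real A * Real.exp (-θ s a) * R.real (A' ∩ cyl G D f ∩ visit G t z) := by
  induction D using Finset.induction_on_max with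
  | empty =>
    intro t hst ht _ z
    simpa using compare_step hQ hR hk hj hθ hs hst ht hA hA' hAa hAa' z
  | insert d D hD ih =>
    intro t hst ht hDt z
    have hd : d ∈ Icc s t := hDt (by simp)
    have hDd : (D : Set ℝ) ⊆ Icc s d := fun q hq =>
      ⟨(hDt (by simp [Finset.mem_coe.1 hq])).1, (hD q hq).le⟩
    have e1 := ih d hd.1 (hd.2.trans_lt ht) hDd (f d)
    have hc : ∀ B : Set (PathSpace G), B ∩ cyl G (insert d D) f = B ∩ cyl G D f ∩ visit G d (f d) := by
      intro B
      ext ω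
      simp only [cyl, Set.mem_inter_iff, Set.mem_ofPred_eq, Finset.mem_insert, forall_eq_or_imp,
        mem_visit]
      tauto
    have hm : ∀ B : Set (PathSpace G), MeasurableSet[sigmaAt G (Icc 0 s)] B →
        MeasurableSet[sigmaAt G (Icc 0 d)] (B ∩ cyl G D f ∩ visit G d (f d)) := by
      intro B hB
      refine ((sigmaAt_mono G (Icc_subset_Icc_right hd.1) _ hB).inter
        (measurableSet_cyl_sigmaAt (hDd.trans (Icc_subset_Icc_left hs)) f)).inter ?_
      exact measurableSet_visit_sigmaAt (S := Icc 0 d) (right_mem_Icc.2 (hs.trans hd.1)) _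
    have e2 := compare_step hQ hR hk hj (hθ.mono hd.1) (hs.trans hd.1) hd.2 ht (hm A hA) (hm A' hA')
      Set.inter_subset_right Set.inter_subset_right z
    rw [hc A, hc A']
    set B := A ∩ cyl G D f ∩ visit G d (f d)
    set B' := A' ∩ cyl G D f ∩ visit G d (f d)
    -- when `R` does not charge `B'`, the comparison up to `d` shows that `Q` does not charge `B`
    by_cases h0 : R.real B' = 0
    · have h1 : R.real (B' ∩ visit G t z) = 0 :=
        le_antisymm (h0 ▸ measureReal_mono Set.inter_subset_left) measureReal_nonneg
      rw [h0, mul_zero] at e1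
      rw [h1, mul_zero]
      rcases mul_eq_zero.1 e1 with h2 | h2
      · have h3 : Q.real B = 0 := (mul_eq_zero.1 h2).resolve_right (Real.exp_ne_zero _)
        have h4 : Q.real (B ∩ visit G t z) = 0 :=
          le_antisymm (h3 ▸ measureReal_mono Set.inter_subset_left) measureReal_nonneg
        rw [h4]
        ring
      · rw [h2, mul_zero]
    · refine mul_right_cancel₀ h0 ?_
      linear_combination R.real A' * e2 + R.real (B' ∩ visit G t z) * e1

/-- Two walks with gauge-equivalent intensities have the same bridges between interior times. -/
theorem compare (hQ : IsForward Q k) (hR : IsForward R j) (hk : ContinuousRates G k)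
    (hj : ContinuousRates G j) {s t : ℝ} (hθ : IsGauge G k j θ s) (hs : 0 ≤ s) (hst : s ≤ t)
    (ht : t < 1) (a z : X) (f : ℝ → X) {D : Finset ℝ} (hD : (D : Set ℝ) ⊆ Icc s t) :
    Q.real (visit G s a ∩ cyl G D f ∩ visit G t z) * R.real (visit G s a ∩ visit G t z) =
      R.real (visit G s a ∩ cyl G D f ∩ visit G t z) * Q.real (visit G s a ∩ visit G t z) := by
  have hm : MeasurableSet[sigmaAt G (Icc 0 s)] (visit G s a) :=
    measurableSet_visit_sigmaAt (S := Icc 0 s) (right_mem_Icc.2 hs) a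
  have e1 := compare_cyl hQ hR hk hj hθ hs hm hm subset_rfl subset_rfl f D t hst ht hD z
  have e2 := compare_step hQ hR hk hj hθ hs hst ht hm hm subset_rfl subset_rfl z
  by_cases h0 : R.real (visit G s a) = 0
  · have h1 : ∀ B : Set (PathSpace G), B ⊆ visit G s a → R.real B = 0 := fun B hB =>
      le_antisymm (h0 ▸ measureReal_mono hB) measureReal_nonneg
    rw [h1 _ Set.inter_subset_left, h1 _ (Set.inter_subset_left.trans Set.inter_subset_left)]
    ring
  · refine mul_right_cancel₀ h0 (mul_right_cancel₀ (Real.exp_ne_zero (-θ t z)) ?_)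
    linear_combination R.real (visit G s a ∩ visit G t z) * e1 -
      R.real (visit G s a ∩ cyl G D f ∩ visit G t z) * e2

end Compare

end Comparison

section EndTimes

variable {X : Type*} {G : SimpleGraph X}

/-! ### Passage to the end times -/

theorem tendsto_measureReal_inter_visit (Q : Measure (PathSpace G)) [IsFiniteMeasure Q]
    {ι : Type*} {l : Filter ι} [l.IsCountablyGenerated] {s t : ι → ℝ}
    (hs : Tendsto s l (𝓝[>] 0)) (ht : Tendsto t l (𝓝[<] 1)) {C : Set (PathSpace G)}
    (hC : MeasurableSet C) (x y : X) :
    Tendsto (fun i => Q.real (visit G (s i) x ∩ C ∩ visit G (t i) y)) l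
      (𝓝 (Q.real (visit G 0 x ∩ C ∩ visit G 1 y))) := by
  refine (ENNReal.tendsto_toReal (measure_ne_top Q _)).comp
    (tendsto_measure_of_tendsto_indicator_of_isFiniteMeasure l Q (fun i =>
      ((measurableSet_visit _ x).inter hC).inter (measurableSet_visit _ y)) fun ω => ?_)
  filter_upwards [hs.eventually (coord_right_continuous 0 ω),
    ht.eventually (coord_left_continuous_one ω)] with i h0 h1
  simp [h0, h1]

theorem tendsto_measureReal_inter_visit_one (Q : Measure (PathSpace G)) [IsFiniteMeasure Q]
    {C : Set (PathSpace G)} (hC : MeasurableSet C) (y : X) :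
    Tendsto (fun t => Q.real (C ∩ visit G t y)) (𝓝[<] 1) (𝓝 (Q.real (C ∩ visit G 1 y))) := by
  refine (ENNReal.tendsto_toReal (measure_ne_top Q _)).comp
    (tendsto_measure_of_tendsto_indicator_of_isFiniteMeasure _ Q (fun t =>
      hC.inter (measurableSet_visit _ y)) fun ω => ?_)
  filter_upwards [coord_left_continuous_one ω] with t h1
  simp [h1]

/-- Two finite measures under which the positions at the times of `E` are deterministic, and the
same, are equal as soon as they have the same finite-dimensional marginals at other times. -/
theorem measure_eq_of_cyl_of_deterministic [Nonempty X] [Countable X] {μ ν : Measure (PathSpace G)}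
    [IsFiniteMeasure μ] {S : Set ℝ} (hS : S ⊆ Icc 0 1) (E : Finset ℝ) (g : ℝ → X)
    (hμ : ∀ q ∈ E, ∀ᵐ ω ∂μ, coord q ω = g q) (hν : ∀ q ∈ E, ∀ᵐ ω ∂ν, coord q ω = g q)
    (h : ∀ (D : Finset ℝ) (f : ℝ → X), (D : Set ℝ) ⊆ S \ E → μ (cyl G D f) = ν (cyl G D f))
    {B : Set (PathSpace G)} (hB : MeasurableSet[sigmaAt G S] B) : μ B = ν B := by
  classical
  refine measure_eq_of_cyl hS (fun D f hD => ?_) ?_ hB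
  · by_cases hf : ∀ q ∈ D, q ∈ E → f q = g q
    · have key : ∀ ρ : Measure (PathSpace G), (∀ q ∈ E, ∀ᵐ ω ∂ρ, coord q ω = g q) →
          ρ (cyl G D f) = ρ (cyl G (D \ E) f) := by
        intro ρ hρ
        refine measure_congr ?_
        filter_upwards [(Filter.eventually_all_finset E).2 hρ] with ω hω
        refine propext ⟨fun h' q hq => h' q (Finset.mem_sdiff.1 hq).1, fun h' q hq => ?_⟩
        by_cases hqE : q ∈ E
        · rw [hω q hqE, hf q hq hqE]
        · exact h' q (Finset.mem_sdiff.2 ⟨hq, hqE⟩)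
      rw [key μ hμ, key ν hν]
      refine h _ f fun q hq => ?_
      rw [Finset.mem_coe, Finset.mem_sdiff] at hq
      exact ⟨hD hq.1, hq.2⟩
    · push Not at hf
      obtain ⟨q, hq, hqE, hne⟩ := hf
      have key : ∀ ρ : Measure (PathSpace G), (∀ q ∈ E, ∀ᵐ ω ∂ρ, coord q ω = g q) →
          ρ (cyl G D f) = 0 := by
        intro ρ hρ
        rw [measure_eq_zero_iff_ae_notMem]
        filter_upwards [hρ q hqE] with ω hω hω'
        exact hne ((hω' q hq).symm.trans hω)
      rw [key μ hμ, key ν hν]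
  · have := h ∅ g (by simp)
    simpa using this

theorem ae_restrict_coord (Q : Measure (PathSpace G)) {A : Set (PathSpace G)} {t : ℝ} {y : X}
    (hA : A ⊆ visit G t y) : ∀ᵐ ω ∂(Q.restrict A), coord t ω = y := by
  have h : ∀ᵐ ω ∂(Q.restrict (visit G t y)), coord t ω = y :=
    ae_restrict_mem (measurableSet_visit t y)
  exact (Measure.restrict_mono hA le_rfl).absolutelyContinuous.ae_le h

theorem endpoints_eq (x y : X) : endpoints G x y = visit G 0 x ∩ visit G 1 y := rfl

theorem measurableSet_endpoints (x y : X) : MeasurableSet (endpoints G x y) :=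
  (measurableSet_visit 0 x).inter (measurableSet_visit 1 y)

variable [G.LocallyFinite] [Nonempty X] [Countable X]

/-- The Markov property of a solution of the forward equation, up to the final time. -/
theorem IsForward.markov {R : Measure (PathSpace G)} [IsFiniteMeasure R] {j : ℝ → X → X → ℝ}
    (hR : IsForward R j) (hj : ContinuousRates G j) {s : ℝ} (hs : 0 ≤ s) (hs1 : s < 1)
    {A B : Set (PathSpace G)} (hA : MeasurableSet[sigmaAt G (Icc 0 s)] A)
    (hB : MeasurableSet[sigmaAt G (Icc s 1)] B) (a y : X) :
    R.real (A ∩ visit G s a ∩ (B ∩ visit G 1 y)) * R.real (visit G s a) =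
      R.real (A ∩ visit G s a) * R.real (visit G s a ∩ (B ∩ visit G 1 y)) := by
  have hV : MeasurableSet[sigmaAt G (Icc 0 s)] (visit G s a) :=
    measurableSet_visit_sigmaAt (S := Icc 0 s) (right_mem_Icc.2 hs) a
  have hsub : Icc 0 s ⊆ Icc (0 : ℝ) 1 := Icc_subset_Icc_right hs1.le
  have hV1 : MeasurableSet (visit G s a) := measurableSet_visit s a
  have hA1 : MeasurableSet A := sigmaAt_le hsub _ hA
  have hB1 : MeasurableSet B := sigmaAt_le (Icc_subset_Icc_left hs) _ hB
  have hy : MeasurableSet (visit G 1 y) := measurableSet_visit 1 y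
  -- the claim is the equality of two measures on the future of `s`, which is read on cylinders
  -- at times before `1`, as `X_1 = y` under both of them
  let μ : Measure (PathSpace G) := R (visit G s a) • R.restrict (A ∩ visit G s a ∩ visit G 1 y)
  let ν : Measure (PathSpace G) := R (A ∩ visit G s a) • R.restrict (visit G s a ∩ visit G 1 y)
  have : IsFiniteMeasure μ := Measure.smul_finite _ (measure_ne_top _ _)
  have hμν : μ B = ν B := by
    refine measure_eq_of_cyl_of_deterministic (Icc_subset_Icc_left hs) {1} (fun _ => y)
      (fun q hq => ?_) (fun q hq => ?_) (fun D f hD => ?_) hB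
    · rw [Finset.mem_singleton.1 hq]
      exact Measure.ae_smul_measure (ae_restrict_coord R Set.inter_subset_right) _
    · rw [Finset.mem_singleton.1 hq]
      exact Measure.ae_smul_measure (ae_restrict_coord R Set.inter_subset_right) _
    · have hev : ∀ᶠ t in 𝓝[<] (1 : ℝ), s ≤ t ∧ t < 1 ∧ (D : Set ℝ) ⊆ Icc s t := by
        have hDt : ∀ᶠ t in 𝓝[<] (1 : ℝ), ∀ q ∈ D, q < t := by
          rw [Filter.eventually_all_finset]
          intro q hq
          have hq' := hD (Finset.mem_coe.2 hq)
          exact mem_nhdsWithin_of_mem_nhds (Ioi_mem_nhds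
            (lt_of_le_of_ne hq'.1.2 (fun h => hq'.2 (by simp [h]))))
        filter_upwards [hDt, self_mem_nhdsWithin, mem_nhdsWithin_of_mem_nhds (Ioi_mem_nhds hs1)]
          with t h1 h2 h3
        exact ⟨le_of_lt h3, h2, fun q hq => ⟨(hD hq).1.1, (h1 q hq).le⟩⟩
      have hC : MeasurableSet (cyl G D f) := measurableSet_cyl D f
      have l1 := (tendsto_measureReal_inter_visit_one R ((hA1.inter hV1).inter hC) y).mul_const
        (R.real (visit G s a))
      have l2 := (tendsto_measureReal_inter_visit_one R (hV1.inter hC) y).const_mul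
        (R.real (A ∩ visit G s a))
      have heq := tendsto_nhds_unique (l1.congr' (hev.mono fun t ht => ?_)) l2
      · rw [← ENNReal.toReal_eq_toReal_iff' (measure_ne_top _ _)
          (by
            have : IsFiniteMeasure ν := Measure.smul_finite _ (measure_ne_top _ _)
            exact measure_ne_top _ _)]
        simp only [μ, ν, Measure.smul_apply, smul_eq_mul, ENNReal.toReal_mul,
          Measure.restrict_apply hC]
        change R.real _ * R.real _ = R.real _ * R.real _
        rw [mul_comm, ← Set.inter_assoc, Set.inter_comm (cyl G D f), heq, ← Set.inter_assoc,
          Set.inter_comm (cyl G D f)]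
      -- `R` is compared with itself: the gauge is trivial, but the pasts differ
      · have := compare_cyl hR hR hj hj (isGauge_zero j s) hs (hA.inter hV) hV
          Set.inter_subset_right subset_rfl f D t ht.1 ht.2.1 ht.2.2 y
        simpa using this
  have h2 := congrArg ENNReal.toReal hμν
  simp only [μ, ν, Measure.smul_apply, smul_eq_mul, ENNReal.toReal_mul,
          Measure.restrict_apply hB1] at h2
  change R.real _ * R.real _ = R.real _ * R.real _ at h2
  rw [mul_comm]
  convert h2 using 3
  · ext ω
    simp only [Set.mem_inter_iff]
    tauto
  · ext ω
    simp only [Set.mem_inter_iff]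
    tauto

/-- A walk pinned at `x` and `y`, whose intensity is gauge-equivalent to that of `R` on `(0,1)`,
is the bridge of `R` between `x` and `y`. -/
theorem eq_bridge_of_isGauge {Q R : Measure (PathSpace G)} [IsProbabilityMeasure Q]
    [IsProbabilityMeasure R] {k j : ℝ → X → X → ℝ} {θ : ℝ → X → ℝ} (hQ : IsForward Q k)
    (hR : IsForward R j) (hk : ContinuousRates G k) (hj : ContinuousRates G j)
    (hθ : ∀ s, 0 < s → IsGauge G k j θ s) {x y : X} (hQE : Q (endpoints G x y) = 1)
    (hRE : R (endpoints G x y) ≠ 0) : Q = bridge R x y := by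
  have hE : MeasurableSet (endpoints G x y) := measurableSet_endpoints x y
  have : IsProbabilityMeasure (bridge R x y) := cond_isProbabilityMeasure hRE
  have aeQ : ∀ᵐ ω ∂Q, ω ∈ endpoints G x y := (prob_compl_eq_zero_iff hE).2 hQE
  have aeR : ∀ᵐ ω ∂(bridge R x y), ω ∈ endpoints G x y :=
    (prob_compl_eq_zero_iff hE).2 (cond_apply_self hRE (measure_ne_top _ _))
  let g : ℝ → X := fun q => if q = 0 then x else y
  refine Measure.ext fun B hB => ?_
  refine measure_eq_of_cyl_of_deterministic (S := Icc 0 1) subset_rfl {0, 1} g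
    (fun q hq => ?_) (fun q hq => ?_) (fun D f hD => ?_) hB
  · rcases Finset.mem_insert.1 hq with rfl | hq
    · filter_upwards [aeQ] with ω hω
      simpa [g] using hω.1
    · rw [Finset.mem_singleton.1 hq]
      filter_upwards [aeQ] with ω hω
      simpa [g] using hω.2
  · rcases Finset.mem_insert.1 hq with rfl | hq
    · filter_upwards [aeR] with ω hω
      simpa [g] using hω.1
    · rw [Finset.mem_singleton.1 hq]
      filter_upwards [aeR] with ω hω
      simpa [g] using hω.2
  · have hC : MeasurableSet (cyl G D f) := measurableSet_cyl D f
    -- the bridges coincide on `[s, 1 - s]`, and `s` tends to `0`; `s ≤ 1 / 2` makes this an interval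
    let s : ℕ → ℝ := fun n => 1 / ((n : ℝ) + 2)
    have hs0 : ∀ n, 0 < s n := fun n => by positivity
    have hs : Tendsto s atTop (𝓝[>] 0) := by
      refine tendsto_nhdsWithin_iff.2 ⟨?_, Eventually.of_forall hs0⟩
      have := (tendsto_one_div_add_atTop_nhds_zero_nat (𝕜 := ℝ)).comp (tendsto_add_atTop_nat 1)
      refine this.congr fun n => ?_
      simp only [Function.comp, s]
      push_cast
      ring
    have ht : Tendsto (fun n => 1 - s n) atTop (𝓝[<] 1) := by
      refine tendsto_nhdsWithin_iff.2 ⟨?_, Eventually.of_forall fun n => ?_⟩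
      · simpa using (tendsto_nhds_of_tendsto_nhdsWithin hs).const_sub 1
      · have := hs0 n
        simp only [Set.mem_Iio]
        linarith
    have hst : ∀ n, s n ≤ 1 - s n := by
      intro n
      have : s n ≤ 1 / 2 := by
        simp only [s]
        gcongr
        have : (0 : ℝ) ≤ n := n.cast_nonneg
        linarith
      linarith
    have hev : ∀ᶠ n in atTop, (D : Set ℝ) ⊆ Icc (s n) (1 - s n) := by
      have : ∀ᶠ n in atTop, ∀ q ∈ D, q ∈ Icc (s n) (1 - s n) := by
        rw [Filter.eventually_all_finset]
        intro q hq
        have hq' := hD (Finset.mem_coe.2 hq)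
        simp only [Finset.coe_insert, Finset.coe_singleton, Set.mem_sdiff, Set.mem_Icc,
          Set.mem_insert_iff, Set.mem_singleton_iff, not_or] at hq'
        have h0 : 0 < q := lt_of_le_of_ne hq'.1.1 (Ne.symm hq'.2.1)
        have h1 : q < 1 := lt_of_le_of_ne hq'.1.2 hq'.2.2
        filter_upwards [(tendsto_nhds_of_tendsto_nhdsWithin hs).eventually (gt_mem_nhds h0),
          (tendsto_nhds_of_tendsto_nhdsWithin ht).eventually (lt_mem_nhds h1)] with n hn hn'
        exact ⟨hn.le, hn'.le⟩
      exact this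
    have lim := fun (ρ : Measure (PathSpace G)) (_ : IsFiniteMeasure ρ) (C : Set (PathSpace G))
      (hC : MeasurableSet C) => tendsto_measureReal_inter_visit ρ hs ht hC x y
    have heq := tendsto_nhds_unique
      (((lim Q inferInstance _ hC).mul (lim R inferInstance _ MeasurableSet.univ)).congr'
        (hev.mono fun n hn => by
          have := compare hQ hR hk hj (hθ (s n) (hs0 n)) (hs0 n).le (hst n)
            (by linarith [hs0 n]) x y f hn
          simpa only [Set.inter_univ] using this))
      ((lim R inferInstance _ hC).mul (lim Q inferInstance _ MeasurableSet.univ))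
    simp only [Set.inter_univ, ← endpoints_eq] at heq
    have hQ1 : Q.real (endpoints G x y) = 1 := by simp [measureReal_def, hQE]
    have hQC : Q.real (visit G 0 x ∩ cyl G D f ∩ visit G 1 y) = Q.real (cyl G D f) := by
      refine measureReal_congr ?_
      filter_upwards [aeQ] with ω hω
      refine propext ⟨fun h => h.1.2, fun h => ⟨⟨hω.1, h⟩, hω.2⟩⟩
    have hR0 : R.real (endpoints G x y) ≠ 0 := by
      rw [measureReal_def, ENNReal.toReal_ne_zero]
      exact ⟨hRE, measure_ne_top _ _⟩
    rw [hQ1, mul_one, hQC] at heq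
    rw [← ENNReal.toReal_eq_toReal_iff' (measure_ne_top _ _) (measure_ne_top _ _), bridge,
      cond_apply hE, ENNReal.toReal_mul, ENNReal.toReal_inv]
    change Q.real _ = (R.real _)⁻¹ * R.real _
    rw [eq_inv_mul_iff_mul_eq₀ hR0, mul_comm, heq]
    congr 1
    ext ω
    simp only [endpoints_eq, Set.mem_inter_iff]
    tauto

end EndTimes

section Gauge

variable {X : Type*} {G : SimpleGraph X}

/-! ### From the characteristics to a gauge -/

@[simp] theorem walkChar_nil (k : ℝ → X → X → ℝ) (t : ℝ) (x : X) :
    walkChar k t (SimpleGraph.Walk.nil : G.Walk x x) = 1 := rfl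

@[simp] theorem walkChar_cons (k : ℝ → X → X → ℝ) (t : ℝ) {x y z : X} (h : G.Adj x y)
    (p : G.Walk y z) : walkChar k t (SimpleGraph.Walk.cons h p) = k t x y * walkChar k t p := by
  simp [walkChar]

theorem walkChar_pos {k : ℝ → X → X → ℝ} {t : ℝ} (hk : ∀ z z', G.Adj z z' → 0 < k t z z')
    {x y : X} (p : G.Walk x y) : 0 < walkChar k t p := by
  induction p with
  | nil => simp
  | cons h p ih => simpa using mul_pos (hk _ _ h) ih

/-- The sum of `ℓ` along the path from `o` to `z` in the tree `T`. -/
noncomputable def treePotential {T : SimpleGraph X} (hT : T.IsTree) (o : X) (ℓ : X → X → ℝ)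
    (z : X) : ℝ :=
  ((hT.existsUnique_path o z).choose.darts.map fun d => ℓ d.fst d.snd).sum

theorem treePotential_self {T : SimpleGraph X} (hT : T.IsTree) (o : X) (ℓ : X → X → ℝ) :
    treePotential hT o ℓ o = 0 := by
  have h := (hT.existsUnique_path o o).choose_spec.2 SimpleGraph.Walk.nil
    SimpleGraph.Walk.IsPath.nil
  rw [treePotential, ← h]
  simp

/-- On a tree, an antisymmetric function of the arcs is the gradient of its potential. -/
theorem treePotential_adj {T : SimpleGraph X} (hT : T.IsTree) (o : X) {ℓ : X → X → ℝ}
    (hℓ : ∀ z z', T.Adj z z' → ℓ z' z = -ℓ z z') {z z' : X} (h : T.Adj z z') :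
    treePotential hT o ℓ z' = treePotential hT o ℓ z + ℓ z z' := by
  classical
  obtain ⟨hp, -⟩ := (hT.existsUnique_path o z).choose_spec
  have huniq := (hT.existsUnique_path o z').choose_spec.2
  unfold treePotential
  set p := (hT.existsUnique_path o z).choose
  set p' := (hT.existsUnique_path o z').choose
  by_cases hz' : z' ∈ p.support
  · have h1 : p.takeUntil z' hz' = p' := huniq _ (hp.takeUntil hz')
    have h2 : p.dropUntil z' hz' = h.symm.toWalk :=
      (hT.existsUnique_path z' z).unique (hp.dropUntil hz') (by simp [h.ne'])
    have h3 := p.take_spec hz'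
    rw [h1, h2] at h3
    have h4 : p.darts = p'.darts ++ h.symm.toWalk.darts := by
      rw [← h3, SimpleGraph.Walk.darts_append]
    rw [h4]
    simp [hℓ z z' h]
  · have h1 : p.concat h = p' := huniq _ (hp.concat hz' h)
    rw [← h1]
    simp [SimpleGraph.Walk.darts_concat]

/-- The logarithm of the walk characteristic, along a walk of the tree. -/
theorem log_walkChar_mapLe {T : SimpleGraph X} (hTG : T ≤ G) {k j : ℝ → X → X → ℝ} {t : ℝ}
    (hk : ∀ z z', G.Adj z z' → 0 < k t z z') (hj : ∀ z z', G.Adj z z' → 0 < j t z z') {ψ : X → ℝ}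
    (hψ : ∀ z z', T.Adj z z' → Real.log (k t z z') - Real.log (j t z z') = ψ z' - ψ z)
    {x y : X} (p : T.Walk x y) :
    Real.log (walkChar k t (p.mapLe hTG)) - Real.log (walkChar j t (p.mapLe hTG)) = ψ y - ψ x := by
  induction p with
  | nil => simp [SimpleGraph.Walk.mapLe]
  | cons h p ih =>
    have h1 := hψ _ _ h
    have hG := hTG h
    change Real.log (walkChar k t (SimpleGraph.Walk.cons hG (p.mapLe hTG))) -
      Real.log (walkChar j t (SimpleGraph.Walk.cons hG (p.mapLe hTG))) = _
    rw [walkChar_cons, walkChar_cons]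
    rw [Real.log_mul (hk _ _ hG).ne' (walkChar_pos hk _).ne',
      Real.log_mul (hj _ _ hG).ne' (walkChar_pos hj _).ne']
    linarith

/-- Equality of the closed walk characteristics on a basis: the ratio of the intensities is the
exponential of a gradient, on all the arcs of the graph. -/
theorem log_ratio_eq_treePotential {T : SimpleGraph X} (hT : IsSpanningTree G T)
    {C : Set (BasedWalk G)} (hC : IsClosedWalkBasis hT C) {k j : ℝ → X → X → ℝ} {t : ℝ}
    (hk : ∀ z z', G.Adj z z' → 0 < k t z z') (hj : ∀ z z', G.Adj z z' → 0 < j t z z')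
    (hCeq : ∀ c ∈ C, walkChar k t c.2 = walkChar j t c.2) (o : X) {z z' : X} (h : G.Adj z z') :
    Real.log (k t z z') - Real.log (j t z z') =
      treePotential hT.2 o (fun z z' => Real.log (k t z z') - Real.log (j t z z')) z' -
      treePotential hT.2 o (fun z z' => Real.log (k t z z') - Real.log (j t z z')) z := by
  obtain ⟨C₀, -, hC₀, rfl⟩ := hC
  set ℓ : X → X → ℝ := fun z z' => Real.log (k t z z') - Real.log (j t z z')
  have hanti : ∀ z z', G.Adj z z' → ℓ z' z = -ℓ z z' := by
    intro z z' h
    have h1 := hCeq ⟨z, h.toWalk.append h.symm.toWalk⟩ (Or.inr ⟨z, z', h, rfl⟩)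
    have h2 := congrArg Real.log h1
    simp only [SimpleGraph.Adj.toWalk, SimpleGraph.Walk.cons_append, SimpleGraph.Walk.nil_append,
      walkChar_cons, walkChar_nil, mul_one] at h2
    rw [Real.log_mul (hk _ _ h).ne' (hk _ _ h.symm).ne',
      Real.log_mul (hj _ _ h).ne' (hj _ _ h.symm).ne'] at h2
    simp only [ℓ]
    linarith
  have htree : ∀ z z', T.Adj z z' → Real.log (k t z z') - Real.log (j t z z') =
      treePotential hT.2 o ℓ z' - treePotential hT.2 o ℓ z := by
    intro z z' h
    have := treePotential_adj hT.2 o (fun z z' h => hanti z z' (hT.1 h)) h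
    simp only [ℓ] at this ⊢
    linarith
  have hfund : ∀ z z' (h : G.Adj z z'), fundamentalWalk hT h ∈ C₀ →
      ℓ z z' = treePotential hT.2 o ℓ z' - treePotential hT.2 o ℓ z := by
    intro z z' h hm
    have h1 := congrArg Real.log (hCeq _ (Or.inl hm))
    simp only [fundamentalWalk, walkChar_cons] at h1
    rw [Real.log_mul (hk _ _ h).ne' (walkChar_pos hk _).ne',
      Real.log_mul (hj _ _ h).ne' (walkChar_pos hj _).ne'] at h1
    have h2 := log_walkChar_mapLe hT.1 hk hj htree (hT.2.existsUnique_path z' z).choose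
    simp only [ℓ] at h2 ⊢
    linarith
  by_cases hTz : T.Adj z z'
  · exact htree z z' hTz
  · rcases hC₀ z z' h hTz with ⟨hm, -⟩ | ⟨hm, -⟩
    · exact hfund z z' h hm
    · have h1 := hfund z' z h.symm hm
      have h2 := hanti z z' h
      change ℓ z z' = _
      linarith

variable [G.LocallyFinite]

/-- Equality of the reciprocal characteristics, on a tree and on a basis of closed walks, makes
`k` the `h`-transform of `j` by a positive solution of the backward equation. -/
theorem exists_isGauge {T : SimpleGraph X} (hT : IsSpanningTree G T)
    {C : Set (BasedWalk G)} (hC : IsClosedWalkBasis hT C) {k j : ℝ → X → X → ℝ}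
    (hk : IsRegularIntensity G k) (hj : IsRegularIntensity G j)
    (harc : ∀ t ∈ Ico (0 : ℝ) 1, ∀ z z', T.Adj z z' → arcChar G k t z z' = arcChar G j t z z')
    (hwalk : ∀ t ∈ Ioo (0 : ℝ) 1, ∀ c ∈ C, walkChar k t c.2 = walkChar j t c.2) :
    ∃ θ : ℝ → X → ℝ, ∀ s, 0 < s → IsGauge G k j θ s := by
  obtain ⟨o⟩ : Nonempty X := hT.2.1.nonempty
  let ℓ : ℝ → X → X → ℝ := fun t z z' => Real.log (k t z z') - Real.log (j t z z')
  let ψ : ℝ → X → ℝ := fun t => treePotential hT.2 o (ℓ t)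
  have hψ : ∀ t ∈ Ioo (0 : ℝ) 1, ∀ z z', G.Adj z z' → ℓ t z z' = ψ t z' - ψ t z :=
    fun t ht z z' h => log_ratio_eq_treePotential hT hC (hk.pos t ht) (hj.pos t ht)
      (hwalk t ht) o h
  let c : ℝ → ℝ := fun t => totalRate G k t o - totalRate G j t o
  have hlogd : ∀ {k : ℝ → X → X → ℝ}, IsRegularIntensity G k → ∀ t ∈ Ioo (0 : ℝ) 1, ∀ z z',
      G.Adj z z' → HasDerivAt (fun s => Real.log (k s z z'))
        (derivWithin (fun s => Real.log (k s z z')) (Ico 0 1) t) t := by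
    intro k hk t ht z z' h
    have hnhds : Ico (0 : ℝ) 1 ∈ 𝓝 t := Ico_mem_nhds ht.1 ht.2
    have hd : DifferentiableAt ℝ (fun s => k s z z') t :=
      ((hk.contDiff z z' h).differentiableOn one_ne_zero t ⟨ht.1.le, ht.2⟩).differentiableAt hnhds
    rw [derivWithin_of_mem_nhds hnhds]
    exact (hd.log (hk.pos t ht z z' h).ne').hasDerivAt
  -- propagation along the tree, from the root `o` where `ψ` vanishes identically
  have hψd : ∀ t ∈ Ioo (0 : ℝ) 1, ∀ z, HasDerivAt (fun s => ψ s z)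
      (c t - (totalRate G k t z - totalRate G j t z)) t := by
    intro t ht z
    obtain ⟨p⟩ := hT.2.1.preconnected z o
    induction p with
    | nil =>
      simp only [c, sub_self]
      refine (hasDerivAt_const t (0 : ℝ)).congr_of_eventuallyEq (Eventually.of_forall fun s => ?_)
      exact treePotential_self hT.2 _ _
    | @cons z z' o h p ih =>
      have h1 := ih hψ
      have hG : G.Adj z' z := (hT.1 h).symm
      have h2 := (hlogd hk t ht z' z hG).sub (hlogd hj t ht z' z hG)
      have h3 := harc t ⟨ht.1.le, ht.2⟩ z' z h.symm
      simp only [arcChar] at h3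
      refine ((h1.add h2).congr_of_eventuallyEq ?_).congr_deriv ?_
      · filter_upwards [Ioo_mem_nhds ht.1 ht.2] with s hs
        have := hψ s hs z' z hG
        simp only [Pi.add_apply, Pi.sub_apply, ℓ] at this ⊢
        linarith
      · linarith
  have hcc : ContinuousOn c (Ioo 0 1) :=
    ((hk.continuousRates.continuousOn_totalRate o).sub
      (hj.continuousRates.continuousOn_totalRate o)).mono Ioo_subset_Ico_self
  -- the rates are controlled on compact subsets of `(0,1)` only: the function of time that
  -- normalizes `ψ` is integrated from an interior time
  refine ⟨fun t z => ψ t z - ∫ r in (1 / 2 : ℝ)..t, c r, fun s hs => ⟨fun r hr z z' h => ?_,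
    fun r hr z => ?_⟩⟩
  · have hr' : r ∈ Ioo (0 : ℝ) 1 := ⟨hs.trans_le hr.1, hr.2⟩
    have h1 := hψ r hr' z z' h
    have hk0 := hk.pos r hr' z z' h
    have hj0 := hj.pos r hr' z z' h
    nth_rewrite 1 [← Real.exp_log hk0, ← Real.exp_log hj0]
    rw [← Real.exp_add, ← Real.exp_add]
    congr 1
    simp only [ℓ] at h1
    linarith
  · have hr' : r ∈ Ioo (0 : ℝ) 1 := ⟨hs.trans_le hr.1, hr.2⟩
    have hsub : Set.uIcc (1 / 2 : ℝ) r ⊆ Ioo 0 1 :=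
      Set.OrdConnected.uIcc_subset Set.ordConnected_Ioo (by norm_num) hr'
    have h1 : HasDerivAt (fun t => ∫ r in (1 / 2 : ℝ)..t, c r) (c r) r :=
      intervalIntegral.integral_hasDerivAt_right (hcc.mono hsub).intervalIntegrable
        (hcc.stronglyMeasurableAtFilter isOpen_Ioo r hr') (hcc.continuousAt (isOpen_Ioo.mem_nhds hr'))
    refine (((hψd r hr' z).sub h1).congr_deriv ?_).hasDerivWithinAt
    ring

theorem IsReferenceIntensity.isRegularIntensity {j : ℝ → X → X → ℝ}
    (hj : IsReferenceIntensity G j) : IsRegularIntensity G j :=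
  ⟨fun z z' h => (hj.contDiff z z' h).mono Ico_subset_Icc_self,
    fun t ht => hj.pos t (Ioo_subset_Icc_self ht)⟩

end Gauge

section Positivity

variable {X : Type*} {G : SimpleGraph X}

/-- The probability `R(X_1 = y ∣ X_t = z)` of ending at `y`. -/
noncomputable def endProb (R : Measure (PathSpace G)) (y : X) (t : ℝ) (z : X) : ℝ :=
  R.real (visit G t z ∩ visit G 1 y) / R.real (visit G t z)

theorem endProb_nonneg (R : Measure (PathSpace G)) (y : X) (t : ℝ) (z : X) :
    0 ≤ endProb R y t z :=
  div_nonneg measureReal_nonneg measureReal_nonneg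

theorem endProb_le_one (R : Measure (PathSpace G)) [IsFiniteMeasure R] (y : X) (t : ℝ) (z : X) :
    endProb R y t z ≤ 1 :=
  div_le_one_of_le₀ (measureReal_mono Set.inter_subset_left) measureReal_nonneg

theorem sum_measureReal_visit_le (R : Measure (PathSpace G)) [IsFiniteMeasure R]
    (A : Set (PathSpace G)) (t : ℝ) (S : Finset X) :
    R.real (A ∩ {ω | coord t ω ∈ (S : Set X)}) = ∑ b ∈ S, R.real (A ∩ visit G t b) := by
  have h : {ω : PathSpace G | coord t ω ∈ (S : Set X)} = ⋃ b ∈ S, visit G t b := by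
    ext ω
    simp
  have h2 : A ∩ {ω : PathSpace G | coord t ω ∈ (S : Set X)} = ⋃ b ∈ S, (visit G t b ∩ A) := by
    rw [h, Set.inter_iUnion₂]
    simp only [Set.inter_comm]
  rw [h2]
  have := measureReal_biUnion_finset (μ := R.restrict A) (s := S) (f := fun b => visit G t b)
    (fun b _ b' _ hne => Set.disjoint_left.2 fun ω hω hω' => hne (hω.symm.trans hω'))
    (fun b _ => measurableSet_visit t b)
  rw [measureReal_restrict_apply (Finset.measurableSet_biUnion _ fun b _ => measurableSet_visit t b)]
    at this
  simp only [measureReal_restrict_apply (measurableSet_visit _ _)] at this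
  rw [← Set.iUnion₂_inter, this]
  simp only [Set.inter_comm]

/-! ### Positivity of the transition probabilities -/

@[simp] theorem stay_univ (D : Set ℝ) (s t : ℝ) : stay G univ D s t = univ := by
  simp [stay]

variable [G.LocallyFinite]

section Forward

variable {R : Measure (PathSpace G)} [IsFiniteMeasure R] {j : ℝ → X → X → ℝ}

theorem IsForward.continuousOn (hR : IsForward R j) (hj : ContinuousRates G j) {s : ℝ} (hs : 0 ≤ s)
    (hs1 : s < 1) {A : Set (PathSpace G)} (hA : MeasurableSet[sigmaAt G (Icc 0 s)] A) (z : X) :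
    ContinuousOn (fun t => R.real (A ∩ visit G t z)) (Ico s 1) := by
  simpa using hR.continuousOn_killed hj univ hs hs1 hA (mem_univ z)

theorem IsForward.hasDerivWithinAt (hR : IsForward R j) (hj : ContinuousRates G j) {s : ℝ}
    (hs : 0 ≤ s) (hs1 : s < 1) {A : Set (PathSpace G)} (hA : MeasurableSet[sigmaAt G (Icc 0 s)] A)
    (z : X) {t : ℝ} (ht : t ∈ Ico s 1) :
    HasDerivWithinAt (fun t => R.real (A ∩ visit G t z))
      (masterRate G j t (fun w => R.real (A ∩ visit G t w)) z) (Ico s 1) t := by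
  simpa using hR.hasDerivWithinAt_killed hj univ hs hs1 hA (mem_univ z) ht

/-- The walk leaves a vertex at rate at most `C`. -/
theorem IsForward.exp_mul_le (hR : IsForward R j) (hj : IsReferenceIntensity G j) {C : ℝ}
    (hC : ∀ t ∈ Icc (0 : ℝ) 1, ∀ z, totalRate G j t z ≤ C) {s t : ℝ} (hs : 0 ≤ s) (hst : s ≤ t)
    (ht : t < 1) {A : Set (PathSpace G)} (hA : MeasurableSet[sigmaAt G (Icc 0 s)] A) (z : X) :
    R.real (A ∩ visit G s z) * Real.exp (-(C * (t - s))) ≤ R.real (A ∩ visit G t z) := by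
  have hs1 := hst.trans_lt ht
  have hcont := hR.continuousOn hj.continuousRates hs hs1 hA z
  have hmono : MonotoneOn (fun r => Real.exp (C * r) * R.real (A ∩ visit G r z)) (Ico s 1) := by
    have hd : ∀ r ∈ Ioo s 1, HasDerivAt (fun r => Real.exp (C * r) * R.real (A ∩ visit G r z))
        (Real.exp (C * r) * (C * R.real (A ∩ visit G r z) +
          masterRate G j r (fun w => R.real (A ∩ visit G r w)) z)) r := by
      intro r hr
      have h1 := (hR.hasDerivWithinAt hj.continuousRates hs hs1 hA z ⟨hr.1.le, hr.2⟩).hasDerivAt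
        (Ico_mem_nhds hr.1 hr.2)
      have h2 := (((hasDerivAt_id r).const_mul C).exp).mul h1
      refine h2.congr_deriv ?_
      simp only [id, mul_one]
      ring
    refine monotoneOn_of_deriv_nonneg (convex_Ico s 1) ?_ ?_ ?_
    · exact (Continuous.continuousOn (by fun_prop)).mul hcont
    · rw [interior_Ico]
      exact fun r hr => (hd r hr).differentiableAt.differentiableWithinAt
    · rw [interior_Ico]
      intro r hr
      rw [(hd r hr).deriv]
      have hr' : r ∈ Icc (0 : ℝ) 1 := ⟨hs.trans hr.1.le, hr.2.le⟩
      refine mul_nonneg (Real.exp_pos _).le ?_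
      have h1 : 0 ≤ ∑ w ∈ G.neighborFinset z, R.real (A ∩ visit G r w) * j r w z :=
        Finset.sum_nonneg fun w hw => mul_nonneg measureReal_nonneg
          (hj.pos r hr' w z ((G.mem_neighborFinset z w).1 hw).symm).le
      have h2 : R.real (A ∩ visit G r z) * totalRate G j r z ≤ R.real (A ∩ visit G r z) * C :=
        mul_le_mul_of_nonneg_left (hC r hr' z) measureReal_nonneg
      simp only [masterRate]
      linarith
  have h := hmono ⟨le_rfl, hs1⟩ ⟨hst, ht⟩ hst
  simp only at h
  have e : Real.exp (-(C * (t - s))) = Real.exp (C * s) / Real.exp (C * t) := by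
    rw [← Real.exp_sub]
    congr 1
    ring
  rw [e, ← mul_div_assoc, div_le_iff₀ (Real.exp_pos _)]
  linarith

theorem IsForward.pos_of_adj (hR : IsForward R j) (hj : IsReferenceIntensity G j) {s t : ℝ}
    (hs : 0 ≤ s) (hst : s < t) (ht : t < 1) {A : Set (PathSpace G)}
    (hA : MeasurableSet[sigmaAt G (Icc 0 s)] A) {w z : X} (h : G.Adj w z)
    (hw : ∀ r ∈ Ioo s 1, 0 < R.real (A ∩ visit G r w)) : 0 < R.real (A ∩ visit G t z) := by
  obtain ⟨C, hC⟩ := hj.bounded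
  have hs1 := hst.trans ht
  refine lt_of_le_of_ne measureReal_nonneg fun h0 => ?_
  have hzero : ∀ r ∈ Ioo s t, R.real (A ∩ visit G r z) = 0 := by
    intro r hr
    have h1 := hR.exp_mul_le hj hC (hs.trans hr.1.le) hr.2.le ht
      (sigmaAt_mono G (Icc_subset_Icc_right hr.1.le) _ hA) z
    rw [← h0] at h1
    refine le_antisymm ?_ measureReal_nonneg
    by_contra hneg
    exact absurd h1 (not_le.2 (mul_pos (not_le.1 hneg) (Real.exp_pos _)))
  obtain ⟨r, hr⟩ := exists_between hst
  have hr1 : r ∈ Ioo s 1 := ⟨hr.1, hr.2.trans ht⟩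
  have d1 := (hR.hasDerivWithinAt hj.continuousRates hs hs1 hA z ⟨hr.1.le, hr1.2⟩).hasDerivAt
    (Ico_mem_nhds hr1.1 hr1.2)
  have d2 : HasDerivAt (fun t => R.real (A ∩ visit G t z)) 0 r :=
    (hasDerivAt_const r (0 : ℝ)).congr_of_eventuallyEq
      (by filter_upwards [Ioo_mem_nhds hr.1 hr.2] with x hx using hzero x hx)
  have h2 := d1.unique d2
  have hr' : r ∈ Icc (0 : ℝ) 1 := ⟨hs.trans hr.1.le, hr1.2.le⟩
  simp only [masterRate, hzero r hr, zero_mul, sub_zero] at h2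
  have h3 := (Finset.sum_eq_zero_iff_of_nonneg (fun w hw => mul_nonneg measureReal_nonneg
          (hj.pos r hr' w z ((G.mem_neighborFinset z w).1 hw).symm).le)).1 h2 w
    ((G.mem_neighborFinset z w).2 h.symm)
  exact (mul_pos (hw r hr1) (hj.pos r hr' w z h)).ne' h3

/-- Since the graph is connected and the rates are positive, every vertex is reached from every
other one in an arbitrarily short time. -/
theorem IsForward.pos (hR : IsForward R j) (hj : IsReferenceIntensity G j) (hG : G.Connected)
    {s : ℝ} (hs : 0 ≤ s) {A : Set (PathSpace G)}
    (hA : MeasurableSet[sigmaAt G (Icc 0 s)] A) {a : X} (ha : 0 < R.real (A ∩ visit G s a)) (b : X) :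
    ∀ t ∈ Ioo s 1, 0 < R.real (A ∩ visit G t b) := by
  obtain ⟨C, hC⟩ := hj.bounded
  obtain ⟨p⟩ := hG.preconnected b a
  induction p with
  | nil =>
    intro t ht
    exact (mul_pos ha (Real.exp_pos _)).trans_le (hR.exp_mul_le hj hC hs ht.1.le ht.2 hA _)
  | cons h p ih =>
    intro t ht
    exact hR.pos_of_adj hj hs ht.1 ht.2 hA h.symm (ih ha)

theorem IsForward.visit_pos (hR : IsForward R j) (hj : IsReferenceIntensity G j)
    (hR₀ : ∀ x, 0 < R.real (visit G 0 x)) {t : ℝ} (ht : t ∈ Ico (0 : ℝ) 1) (z : X) :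
    0 < R.real (visit G t z) := by
  obtain ⟨C, hC⟩ := hj.bounded
  have h := hR.exp_mul_le hj hC le_rfl ht.1 ht.2 (A := univ) MeasurableSet.univ z
  simp only [Set.univ_inter] at h
  exact (mul_pos (hR₀ z) (Real.exp_pos _)).trans_le h

theorem IsForward.visit_one_pos (hR : IsForward R j) (hj : IsReferenceIntensity G j)
    (hG : G.Connected) (hR₀ : ∀ x, 0 < R.real (visit G 0 x)) {t : ℝ} (ht : t ∈ Ico (0 : ℝ) 1)
    (z y : X) : 0 < R.real (visit G t z ∩ visit G 1 y) := by
  obtain ⟨C, hC⟩ := hj.bounded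
  obtain ⟨r₀, hr₀⟩ := exists_between ht.2
  have hm : MeasurableSet[sigmaAt G (Icc 0 t)] (visit G t z) :=
    measurableSet_visit_sigmaAt (S := Icc 0 t) (right_mem_Icc.2 ht.1) z
  have hpos := hR.pos hj hG ht.1 (A := visit G t z) hm (a := z)
    (by rw [Set.inter_self]; exact hR.visit_pos hj hR₀ ht z) y r₀ hr₀
  refine (mul_pos hpos (Real.exp_pos (-(|C| * 1)))).trans_le ?_
  refine ge_of_tendsto (tendsto_measureReal_inter_visit_one R (measurableSet_visit t z) y) ?_
  filter_upwards [self_mem_nhdsWithin, mem_nhdsWithin_of_mem_nhds (Ioi_mem_nhds hr₀.2)]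
    with r hr hr'
  refine le_trans ?_ (hR.exp_mul_le hj hC (ht.1.trans hr₀.1.le) (le_of_lt hr') hr
    (sigmaAt_mono G (Icc_subset_Icc_right hr₀.1.le) _ hm) y)
  refine mul_le_mul_of_nonneg_left (Real.exp_le_exp.2 (neg_le_neg ?_)) measureReal_nonneg
  have h0 : 0 ≤ r - r₀ := sub_nonneg.2 (le_of_lt hr')
  have h1 : r - r₀ ≤ 1 := by
    have h2 : r < 1 := hr
    linarith [ht.1.trans hr₀.1.le]
  calc C * (r - r₀) ≤ |C| * (r - r₀) := mul_le_mul_of_nonneg_right (le_abs_self C) h0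
    _ ≤ |C| * 1 := mul_le_mul_of_nonneg_left h1 (abs_nonneg C)

end Forward

/-! ### The backward equation -/

/-- The forward rates of the Dirac mass at `a`. -/
theorem sum_masterRate_single [DecidableEq X] (j : ℝ → X → X → ℝ) (r : ℝ) (a : X) (f : X → ℝ) :
    ∑ b ∈ insert a (G.neighborFinset a), masterRate G j r (Pi.single a 1) b * f b =
      generator G j r f a := by
  have ha : a ∉ G.neighborFinset a := by simp
  rw [Finset.sum_insert ha]
  have h1 : masterRate G j r (Pi.single a 1) a = -totalRate G j r a := by
    unfold masterRate
    rw [Finset.sum_eq_zero, Pi.single_eq_same]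
    · ring
    · intro w hw
      have : w ≠ a := ((G.mem_neighborFinset a w).1 hw).ne'
      rw [Pi.single_eq_of_ne this, zero_mul]
  have h2 : ∀ b ∈ G.neighborFinset a, masterRate G j r (Pi.single a 1) b = j r a b := by
    intro b hb
    have hab := (G.mem_neighborFinset a b).1 hb
    unfold masterRate
    rw [Finset.sum_eq_single a, Pi.single_eq_same, Pi.single_eq_of_ne hab.ne']
    · ring
    · intro w _ hw
      rw [Pi.single_eq_of_ne hw, zero_mul]
    · intro hn
      exact absurd ((G.mem_neighborFinset b a).2 hab.symm) hn
  rw [h1, Finset.sum_congr rfl fun b hb => by rw [h2 b hb], generator, totalRate, neg_mul,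
    Finset.sum_mul, neg_add_eq_sub, ← Finset.sum_sub_distrib]
  exact Finset.sum_congr rfl fun b _ => by ring

section Backward

variable {j : ℝ → X → X → ℝ} {C : ℝ}

theorem IsReferenceIntensity.le_bound (hj : IsReferenceIntensity G j)
    (hC : ∀ t ∈ Icc (0 : ℝ) 1, ∀ z, totalRate G j t z ≤ C) {t : ℝ} (ht : t ∈ Icc (0 : ℝ) 1)
    {z z' : X} (h : G.Adj z z') : j t z z' ≤ C :=
  (Finset.single_le_sum (f := fun z' => j t z z')
    (fun w hw => (hj.pos t ht z w ((G.mem_neighborFinset z w).1 hw)).le)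
    ((G.mem_neighborFinset z z').2 h)).trans (hC t ht z)

theorem IsReferenceIntensity.totalRate_nonneg (hj : IsReferenceIntensity G j) {t : ℝ}
    (ht : t ∈ Icc (0 : ℝ) 1) (z : X) : 0 ≤ totalRate G j t z :=
  Finset.sum_nonneg fun w hw => (hj.pos t ht z w ((G.mem_neighborFinset z w).1 hw)).le

theorem IsReferenceIntensity.abs_masterRate_le [DecidableEq X] (hj : IsReferenceIntensity G j)
    (hC : ∀ t ∈ Icc (0 : ℝ) 1, ∀ z, totalRate G j t z ≤ C) {t : ℝ} (ht : t ∈ Icc (0 : ℝ) 1)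
    (v : X → ℝ) (b : X) :
    |masterRate G j t v b| ≤ C * ∑ c ∈ insert b (G.neighborFinset b), |v c| := by
  have hb : b ∉ G.neighborFinset b := by simp
  rw [Finset.sum_insert hb, mul_add, add_comm, Finset.mul_sum]
  refine (abs_sub _ _).trans (add_le_add ((Finset.abs_sum_le_sum_abs _ _).trans
    (Finset.sum_le_sum fun c hc => ?_)) ?_)
  · have h := ((G.mem_neighborFinset b c).1 hc).symm
    rw [abs_mul, abs_of_pos (hj.pos t ht c b h), mul_comm]
    exact mul_le_mul_of_nonneg_right (hj.le_bound hC ht h) (abs_nonneg _)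
  · rw [abs_mul, abs_of_nonneg (hj.totalRate_nonneg ht b), mul_comm]
    exact mul_le_mul_of_nonneg_right (hC t ht b) (abs_nonneg _)

theorem IsReferenceIntensity.abs_generator_le (hj : IsReferenceIntensity G j)
    (hC : ∀ t ∈ Icc (0 : ℝ) 1, ∀ z, totalRate G j t z ≤ C) {t : ℝ} (ht : t ∈ Icc (0 : ℝ) 1)
    {f : X → ℝ} {ε : ℝ} (hf : ∀ z z', |f z' - f z| ≤ ε) (a : X) :
    |generator G j t f a| ≤ C * ε := by
  have hε : 0 ≤ ε := (abs_nonneg _).trans (hf a a)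
  refine (Finset.abs_sum_le_sum_abs _ _).trans ?_
  refine le_trans (Finset.sum_le_sum fun b hb => ?_)
    ((Finset.sum_mul (G.neighborFinset a) (fun b => j t a b) ε).symm.le.trans
    (mul_le_mul_of_nonneg_right (hC t ht a) hε))
  rw [abs_mul, abs_of_pos (hj.pos t ht a b ((G.mem_neighborFinset a b).1 hb))]
  exact mul_le_mul_of_nonneg_left (hf a b)
    (hj.pos t ht a b ((G.mem_neighborFinset a b).1 hb)).le

theorem ContinuousRates.intervalIntegrable_generator_apply (hj : ContinuousRates G j) (f : X → ℝ)
    (a : X) {s t : ℝ} (hs : 0 ≤ s) (hst : s ≤ t) (ht : t < 1) :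
    IntervalIntegrable (fun r => generator G j r f a) volume s t := by
  refine ContinuousOn.intervalIntegrable (continuousOn_finsetSum _ fun b hb => ?_)
  refine ContinuousOn.mul ((hj ((G.mem_neighborFinset a b).1 hb)).mono ?_) continuousOn_const
  rw [Set.uIcc_of_le hst]
  exact fun r hr => ⟨hs.trans hr.1, hr.2.trans_lt ht⟩

variable {R : Measure (PathSpace G)} [IsFiniteMeasure R]

/-- Short-time expansion of the transition probabilities from `a`, with an error that is quadratic
in the duration and uniform in the target. -/
theorem IsForward.abs_transition_sub_le [DecidableEq X] (hR : IsForward R j)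
    (hj : IsReferenceIntensity G j) (hC : ∀ t ∈ Icc (0 : ℝ) 1, ∀ z, totalRate G j t z ≤ C)
    {s t : ℝ} (hs : 0 ≤ s) (hst : s ≤ t) (ht : t < 1) (a b : X) :
    |R.real (visit G s a ∩ visit G t b) - R.real (visit G s a) * (Pi.single a 1 : X → ℝ) b -
      R.real (visit G s a) * ∫ r in s..t, masterRate G j r (Pi.single a 1) b| ≤
      R.real (visit G s a) * (2 * C ^ 2 * (t - s) ^ 2) := by
  set V := visit G s a
  set M := R.real V
  have hV : MeasurableSet[sigmaAt G (Icc 0 s)] V :=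
    measurableSet_visit_sigmaAt (S := Icc 0 s) (right_mem_Icc.2 hs) a
  have hV1 : MeasurableSet V := measurableSet_visit s a
  have hM : 0 ≤ M := measureReal_nonneg
  have hC0 : 0 ≤ C := (hj.totalRate_nonneg (t := 0) (by simp) a).trans (hC 0 (by simp) a)
  let m : ℝ → X → ℝ := fun r w => R.real (V ∩ visit G r w)
  have hms : m s b = M * (Pi.single a 1 : X → ℝ) b := by
    by_cases hab : b = a
    · subst hab
      simp [m, V, M]
    · rw [Pi.single_eq_of_ne hab, mul_zero]
      have : V ∩ visit G s b = ∅ := by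
        ext ω
        simp only [V, Set.mem_inter_iff, mem_visit, Set.mem_empty_iff_false, iff_false, not_and]
        intro h h'
        exact hab (h'.symm.trans h)
      simp [m, this]
  -- the defect `m_r - M δ_a` has total variation at most `2 M C (r - s)`
  have hdef : ∀ r ∈ Icc s t, ∀ S : Finset X,
      ∑ c ∈ S, |m r c - M * (Pi.single a 1 : X → ℝ) c| ≤ 2 * (M * (C * (t - s))) := by
    intro r hr S
    have h1 : M - m r a ≤ M * (C * (t - s)) := by
      have e1 := hR.exp_mul_le hj hC hs hr.1 (hr.2.trans_lt ht) hV a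
      have e2 : V ∩ visit G s a = V := Set.inter_self _
      rw [e2] at e1
      have e3 := Real.add_one_le_exp (-(C * (r - s)))
      have e4 : C * (r - s) ≤ C * (t - s) := mul_le_mul_of_nonneg_left (by linarith [hr.2]) hC0
      have e5 : M * (1 - C * (t - s)) ≤ M * Real.exp (-(C * (r - s))) :=
        mul_le_mul_of_nonneg_left (by linarith) hM
      change M * Real.exp (-(C * (r - s))) ≤ m r a at e1
      linarith
    have h2 : ∀ T : Finset X, ∑ c ∈ T, m r c ≤ M := by
      intro T
      rw [← sum_measureReal_visit_le]
      exact measureReal_mono Set.inter_subset_left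
    have h0 : ∀ c, 0 ≤ m r c := fun c => measureReal_nonneg
    have h3 : ∑ c ∈ insert a S, |m r c - M * (Pi.single a 1 : X → ℝ) c| ≤ 2 * (M - m r a) := by
      rw [← Finset.add_sum_erase _ _ (Finset.mem_insert_self a S), Pi.single_eq_same, mul_one]
      have e1 : |m r a - M| = M - m r a := by
        rw [abs_sub_comm]
        exact abs_of_nonneg (sub_nonneg.2 (by simpa using h2 {a}))
      have e2 : ∑ c ∈ (insert a S).erase a, |m r c - M * (Pi.single a 1 : X → ℝ) c| =
          ∑ c ∈ (insert a S).erase a, m r c := by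
        refine Finset.sum_congr rfl fun c hc => ?_
        rw [Pi.single_eq_of_ne (Finset.ne_of_mem_erase hc), mul_zero, sub_zero,
          abs_of_nonneg (h0 c)]
      have e3 := h2 (insert a S)
      rw [← Finset.add_sum_erase _ _ (Finset.mem_insert_self a S)] at e3
      rw [e1, e2]
      linarith
    refine (Finset.sum_le_sum_of_subset_of_nonneg (Finset.subset_insert a S)
      fun c _ _ => abs_nonneg _).trans (h3.trans ?_)
    linarith
  have hmi : IntervalIntegrable (fun r => masterRate G j r (m r) b) volume s t :=
    hj.continuousRates.intervalIntegrable_masterRate b hs hst ht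
      (fun w => measurable_measureReal_visit R hV1 w) (fun r w => abs_measureReal_le R _)
  have hsi : IntervalIntegrable (fun r => masterRate G j r (Pi.single a 1) b) volume s t :=
    hj.continuousRates.intervalIntegrable_masterRate (m := fun _ => Pi.single a 1) b hs hst ht
      (fun w => measurable_const) (c := 1) (fun r w => by
        by_cases hw : w = a
        · subst hw; simp
        · simp [Pi.single_eq_of_ne hw])
  have hfw : m t b - m s b = ∫ r in s..t, masterRate G j r (m r) b := hR hs hst ht hV b
  have heq : m t b - M * (Pi.single a 1 : X → ℝ) b -
      M * ∫ r in s..t, masterRate G j r (Pi.single a 1) b =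
      ∫ r in s..t, masterRate G j r (fun w => 1 * m r w - M * (Pi.single a 1 : X → ℝ) w) b := by
    simp only [masterRate_linear]
    simp only [one_mul]
    rw [intervalIntegral.integral_sub hmi (hsi.const_mul M), intervalIntegral.integral_const_mul,
      ← hfw, hms]
  change |m t b - M * (Pi.single a 1 : X → ℝ) b -
      M * ∫ r in s..t, masterRate G j r (Pi.single a 1) b| ≤ _
  rw [heq]
  have hb := intervalIntegral.norm_integral_le_of_norm_le_const (a := s) (b := t)
    (f := fun r => masterRate G j r (fun w => 1 * m r w - M * (Pi.single a 1 : X → ℝ) w) b)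
    (C := C * (2 * (M * (C * (t - s))))) (fun r hr => ?_)
  · refine hb.trans (le_of_eq ?_)
    rw [abs_of_nonneg (sub_nonneg.2 hst)]
    ring
  · rw [Set.uIoc_of_le hst] at hr
    refine (hj.abs_masterRate_le hC ⟨hs.trans hr.1.le, (hr.2.trans_lt ht).le⟩ _ b).trans ?_
    refine mul_le_mul_of_nonneg_left ?_ hC0
    simpa only [one_mul] using hdef r ⟨hr.1.le, hr.2⟩ _

variable [Nonempty X] [Countable X]

/-- The Markov property, for the final position. -/
theorem IsForward.measureReal_inter_end (hR : IsForward R j) (hj : ContinuousRates G j) {s : ℝ}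
    (hs : 0 ≤ s) (hs1 : s < 1) {A : Set (PathSpace G)} (hA : MeasurableSet[sigmaAt G (Icc 0 s)] A)
    (z y : X) : R.real (A ∩ visit G s z ∩ visit G 1 y) =
      R.real (A ∩ visit G s z) * endProb R y s z := by
  have h := hR.markov hj hs hs1 hA (B := univ) MeasurableSet.univ z y
  simp only [Set.univ_inter] at h
  by_cases h0 : R.real (visit G s z) = 0
  · have h1 : ∀ B : Set (PathSpace G), B ⊆ visit G s z → R.real B = 0 := fun B hB =>
      le_antisymm (h0 ▸ measureReal_mono hB) measureReal_nonneg
    rw [h1 _ Set.inter_subset_right, h1 _ (Set.inter_subset_left.trans Set.inter_subset_right)]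
    ring
  · rw [endProb, ← mul_div_assoc, eq_div_iff h0, h]

/-- The backward equation, in its short-time form. -/
theorem IsForward.abs_endProb_sub_le (hR : IsForward R j) (hj : IsReferenceIntensity G j)
    (hC : ∀ t ∈ Icc (0 : ℝ) 1, ∀ z, totalRate G j t z ≤ C) (hpos : ∀ t ∈ Ico (0 : ℝ) 1, ∀ z,
    0 < R.real (visit G t z)) {s t : ℝ} (hs : 0 ≤ s) (hst : s ≤ t) (ht : t < 1) (a y : X) :
    |endProb R y s a - endProb R y t a - ∫ r in s..t, generator G j r (endProb R y t) a| ≤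
      4 * (G.degree a + 1) * C ^ 2 * (t - s) ^ 2 := by
  classical
  set V := visit G s a
  set M := R.real V
  set S := insert a (G.neighborFinset a)
  set U : Set (PathSpace G) := {ω | coord t ω ∈ (S : Set X)}
  have hS : (S.card : ℝ) = G.degree a + 1 := by
    rw [Finset.card_insert_of_notMem (by simp), G.card_neighborFinset_eq_degree]
    push_cast
    rfl
  have hV : MeasurableSet[sigmaAt G (Icc 0 s)] V :=
    measurableSet_visit_sigmaAt (S := Icc 0 s) (right_mem_Icc.2 hs) a
  have hU : MeasurableSet U := measurableSet_coord_mem' t _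
  have hM : 0 < M := hpos s ⟨hs, hst.trans_lt ht⟩ a
  let e : X → ℝ := fun b => R.real (V ∩ visit G t b) - M * (Pi.single a 1 : X → ℝ) b -
      M * ∫ r in s..t, masterRate G j r (Pi.single a 1) b
  set δ := 2 * C ^ 2 * (t - s) ^ 2
  have he : ∀ b, |e b| ≤ M * δ := fun b => hR.abs_transition_sub_le hj hC hs hst ht a b
  have hsi : ∀ b, IntervalIntegrable (fun r => masterRate G j r (Pi.single a 1) b) volume s t :=
    fun b => hj.continuousRates.intervalIntegrable_masterRate (m := fun _ => Pi.single a 1) b hs hst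
      ht (fun w => measurable_const) (c := 1) (fun r w => by
        by_cases hw : w = a
        · subst hw; simp
        · simp [Pi.single_eq_of_ne hw])
  have hsum : ∀ f : X → ℝ, ∑ b ∈ S, R.real (V ∩ visit G t b) * f b =
      M * f a + M * (∫ r in s..t, generator G j r f a) + ∑ b ∈ S, e b * f b := by
    intro f
    have h1 : ∫ r in s..t, generator G j r f a =
        ∑ b ∈ S, (∫ r in s..t, masterRate G j r (Pi.single a 1) b) * f b := by
      simp only [← sum_masterRate_single]
      rw [intervalIntegral.integral_finsetSum fun b _ => (hsi b).mul_const (f b)]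
      simp only [intervalIntegral.integral_mul_const, S]
    have h2 : f a = ∑ b ∈ S, (Pi.single a 1 : X → ℝ) b * f b := by
      rw [Finset.sum_eq_single a]
      · simp
      · intro b _ hb
        rw [Pi.single_eq_of_ne hb, zero_mul]
      · intro hn
        exact absurd (Finset.mem_insert_self _ _) hn
    rw [h1, h2, Finset.mul_sum, Finset.mul_sum, ← Finset.sum_add_distrib, ← Finset.sum_add_distrib]
    refine Finset.sum_congr rfl fun b _ => ?_
    simp only [e]
    ring
  have habs : ∀ f : X → ℝ, (∀ b, 0 ≤ f b) → (∀ b, f b ≤ 1) →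
      |∑ b ∈ S, e b * f b| ≤ S.card * (M * δ) := by
    intro f h0 h1
    refine (Finset.abs_sum_le_sum_abs _ _).trans ?_
    rw [← nsmul_eq_mul]
    refine Finset.sum_le_card_nsmul _ _ _ fun b _ => ?_
    rw [abs_mul, abs_of_nonneg (h0 b)]
    exact (mul_le_of_le_one_right (abs_nonneg _) (h1 b)).trans (he b)
  -- decomposition according to whether the walk is in the ball `S` at time `t`
  have hdec : R.real (V ∩ visit G 1 y) = ∑ b ∈ S, R.real (V ∩ visit G t b) * endProb R y t b +
      R.real ((V ∩ visit G 1 y) \ U) := by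
    rw [← measureReal_inter_add_sdiff (μ := R) (s := V ∩ visit G 1 y) hU,
      sum_measureReal_visit_le]
    congr 1
    refine Finset.sum_congr rfl fun b _ => ?_
    rw [← hR.measureReal_inter_end hj.continuousRates (hs.trans hst) ht
      (sigmaAt_mono G (Icc_subset_Icc_right hst) _ hV)]
    congr 1
    ext ω
    simp only [Set.mem_inter_iff]
    tauto
  have hrest : R.real ((V ∩ visit G 1 y) \ U) ≤ S.card * (M * δ) := by
    have h1 : R.real ((V ∩ visit G 1 y) \ U) ≤ R.real (V \ U) :=
      measureReal_mono (Set.sdiff_subset_sdiff_left Set.inter_subset_left)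
    have h2 := measureReal_inter_add_sdiff (μ := R) (s := V) hU
    rw [sum_measureReal_visit_le] at h2
    have h3 := hsum fun _ => 1
    have h4 : ∀ r, generator G j r (fun _ => (1 : ℝ)) a = 0 := fun r => by simp [generator]
    simp only [h4, intervalIntegral.integral_zero, mul_one, mul_zero, add_zero] at h3
    have h5 := habs (fun _ => 1) (fun _ => zero_le_one) (fun _ => le_rfl)
    simp only [mul_one] at h5
    have h6 := neg_abs_le (∑ b ∈ S, e b)
    change _ + _ = M at h2
    linarith
  have hHs : endProb R y s a * M = R.real (V ∩ visit G 1 y) :=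
    div_mul_cancel₀ _ hM.ne'
  have h7 := habs (endProb R y t) (endProb_nonneg R y t) (endProb_le_one R y t)
  rw [hsum] at hdec
  have h8 : 0 ≤ R.real ((V ∩ visit G 1 y) \ U) := measureReal_nonneg
  have h9 : M * |endProb R y s a - endProb R y t a -
      ∫ r in s..t, generator G j r (endProb R y t) a| ≤ M * (2 * (S.card * δ)) := by
    rw [← abs_of_pos hM, ← abs_mul, abs_of_pos hM]
    have h10 : M * (endProb R y s a - endProb R y t a -
        ∫ r in s..t, generator G j r (endProb R y t) a) =
        ∑ b ∈ S, e b * endProb R y t b + R.real ((V ∩ visit G 1 y) \ U) := by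
      linear_combination hHs + hdec
    rw [h10]
    refine (abs_add_le _ _).trans ?_
    rw [abs_of_nonneg h8]
    linarith
  refine (le_of_mul_le_mul_left h9 hM).trans (le_of_eq ?_)
  rw [hS]
  ring

end Backward

end Positivity

section BridgeIntensity

variable {X : Type*} {G : SimpleGraph X}

/-! ### The intensity of a bridge -/

/-- The intensity `j(t, z → z') h(t, z') / h(t, z)` of the bridge of `R` ending at `y`, where
`h(t, z) = R(X_1 = y ∣ X_t = z)`. -/
noncomputable def bridgeRate (R : Measure (PathSpace G)) (j : ℝ → X → X → ℝ) (y : X) (t : ℝ)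
    (z z' : X) : ℝ :=
  j t z z' * endProb R y t z' / endProb R y t z

/-- The closed walk characteristics are invariant under `h`-transforms. -/
theorem walkChar_bridgeRate {R : Measure (PathSpace G)} {j : ℝ → X → X → ℝ} {y : X} {t : ℝ}
    (hpos : ∀ z, 0 < endProb R y t z) {x z : X} (p : G.Walk x z) :
    walkChar (bridgeRate R j y) t p * endProb R y t x = walkChar j t p * endProb R y t z := by
  induction p with
  | nil => simp
  | @cons x w z h p ih =>
    rw [walkChar_cons, walkChar_cons, bridgeRate]
    have h1 := (hpos x).ne'
    field_simp
    linear_combination j t x w * ih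

theorem measureReal_bridge (R : Measure (PathSpace G)) (x y : X) (B : Set (PathSpace G)) :
    (bridge R x y).real B = R.real (B ∩ visit G 0 x ∩ visit G 1 y) / R.real (endpoints G x y) := by
  rw [bridge, measureReal_def, cond_apply (measurableSet_endpoints x y), ENNReal.toReal_mul,
    ENNReal.toReal_inv, mul_comm, ← div_eq_mul_inv, measureReal_def, measureReal_def]
  congr 3
  ext ω
  simp only [endpoints_eq, Set.mem_inter_iff]
  tauto

variable [G.LocallyFinite]

/-! ### Differentiability of the backward solution -/

theorem generator_sub (k : ℝ → X → X → ℝ) (t : ℝ) (u v : X → ℝ) (z : X) :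
    generator G k t u z - generator G k t v z = generator G k t (fun w => u w - v w) z := by
  simp only [generator, ← Finset.sum_sub_distrib]
  exact Finset.sum_congr rfl fun _ _ => by ring

section Backward

variable [Nonempty X] [Countable X] {j : ℝ → X → X → ℝ} {R : Measure (PathSpace G)}
  [IsFiniteMeasure R]

theorem IsForward.exists_abs_endProb_sub_le (hR : IsForward R j) (hj : IsReferenceIntensity G j)
    (hdeg : ∃ d : ℕ, ∀ z, G.degree z ≤ d)
    (hpos : ∀ t ∈ Ico (0 : ℝ) 1, ∀ z, 0 < R.real (visit G t z)) (y : X) :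
    ∃ L : ℝ, ∀ s t : ℝ, 0 ≤ s → s ≤ t → t < 1 → ∀ a,
      |endProb R y s a - endProb R y t a| ≤ L * (t - s) ∧
      |endProb R y s a - endProb R y t a - ∫ r in s..t, generator G j r (endProb R y t) a| ≤
        L * (t - s) ^ 2 := by
  obtain ⟨d, hd⟩ := hdeg
  obtain ⟨C, hC⟩ := hj.bounded
  have hC0 : 0 ≤ C := (hj.totalRate_nonneg (t := 0) (by simp) (Classical.arbitrary X)).trans
    (hC 0 (by simp) _)
  set K := 4 * ((d : ℝ) + 1) * C ^ 2
  have hK : 0 ≤ K := by positivity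
  refine ⟨C + K, fun s t hs hst ht a => ?_⟩
  have hts : 0 ≤ t - s := sub_nonneg.2 hst
  have h2 : |endProb R y s a - endProb R y t a - ∫ r in s..t, generator G j r (endProb R y t) a| ≤
      K * (t - s) ^ 2 := by
    refine (hR.abs_endProb_sub_le hj hC hpos hs hst ht a y).trans ?_
    have : (G.degree a : ℝ) ≤ d := by exact_mod_cast hd a
    simp only [K]
    gcongr
  have h3 : |∫ r in s..t, generator G j r (endProb R y t) a| ≤ C * (t - s) := by
    have := intervalIntegral.norm_integral_le_of_norm_le_const (a := s) (b := t)
      (f := fun r => generator G j r (endProb R y t) a) (C := C * 1) (fun r hr => ?_)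
    · rwa [abs_of_nonneg hts, mul_one] at this
    · rw [Set.uIoc_of_le hst] at hr
      refine hj.abs_generator_le hC ⟨hs.trans hr.1.le, (hr.2.trans_lt ht).le⟩ (fun z z' => ?_) a
      rw [abs_le]
      constructor <;> linarith [endProb_nonneg R y t z, endProb_nonneg R y t z',
        endProb_le_one R y t z, endProb_le_one R y t z']
  refine ⟨?_, h2.trans (mul_le_mul_of_nonneg_right (by linarith) (sq_nonneg _))⟩
  have h4 : endProb R y s a - endProb R y t a =
      (endProb R y s a - endProb R y t a - ∫ r in s..t, generator G j r (endProb R y t) a) +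
      ∫ r in s..t, generator G j r (endProb R y t) a := by ring
  rw [h4]
  refine (abs_add_le _ _).trans ((add_le_add h2 h3).trans ?_)
  have h5 : (t - s) ^ 2 ≤ t - s := by
    have : t - s ≤ 1 := by linarith
    nlinarith
  nlinarith

/-- The backward Kolmogorov equation for the probability of ending at `y`. -/
theorem IsForward.hasDerivWithinAt_endProb (hR : IsForward R j) (hj : IsReferenceIntensity G j)
    (hdeg : ∃ d : ℕ, ∀ z, G.degree z ≤ d)
    (hpos : ∀ t ∈ Ico (0 : ℝ) 1, ∀ z, 0 < R.real (visit G t z)) (y a : X) :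
    ContinuousOn (fun t => generator G j t (endProb R y t) a) (Ico 0 1) ∧
    ∀ t ∈ Ico (0 : ℝ) 1, HasDerivWithinAt (fun t => endProb R y t a)
      (-generator G j t (endProb R y t) a) (Ico 0 1) t := by
  obtain ⟨L, hL⟩ := hR.exists_abs_endProb_sub_le hj hdeg hpos y
  obtain ⟨C, hC⟩ := hj.bounded
  have hC0 : 0 ≤ C := (hj.totalRate_nonneg (t := 0) (by simp) (Classical.arbitrary X)).trans
    (hC 0 (by simp) _)
  have hL0 : 0 ≤ L := by
    have := (abs_nonneg _).trans (hL 0 (1 / 2) le_rfl (by norm_num) (by norm_num) a).1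
    linarith
  have hlip : ∀ z, ∀ s ∈ Ico (0 : ℝ) 1, ∀ t ∈ Ico (0 : ℝ) 1,
      |endProb R y t z - endProb R y s z| ≤ L * |t - s| := by
    intro z s hs t ht
    rcases le_total s t with h | h
    · rw [abs_sub_comm, abs_of_nonneg (sub_nonneg.2 h)]
      exact (hL s t hs.1 h ht.2 z).1
    · rw [abs_of_nonpos (sub_nonpos.2 h), neg_sub]
      exact (hL t s ht.1 h hs.2 z).1
  have hcont : ∀ z, ContinuousOn (fun t => endProb R y t z) (Ico 0 1) := by
    intro z
    have : LipschitzOnWith L.toNNReal (fun t => endProb R y t z) (Ico 0 1) := by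
      refine LipschitzOnWith.of_dist_le_mul fun t ht s hs => ?_
      rw [Real.coe_toNNReal L hL0, Real.dist_eq, Real.dist_eq]
      exact hlip z s hs t ht
    exact this.continuousOn
  set D : ℝ → ℝ := fun t => generator G j t (endProb R y t) a
  have hD : ContinuousOn D (Ico 0 1) := by
    refine continuousOn_finsetSum _ fun b hb => ?_
    exact (hj.continuousRates ((G.mem_neighborFinset a b).1 hb)).mul ((hcont b).sub (hcont a))
  have hDi : ∀ s ∈ Ico (0 : ℝ) 1, ∀ t ∈ Ico (0 : ℝ) 1, IntervalIntegrable D volume s t :=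
    fun s hs t ht => (hD.mono (Set.OrdConnected.uIcc_subset Set.ordConnected_Ico hs
      ht)).intervalIntegrable
  refine ⟨hD, ?_⟩
  let E : ℝ → ℝ := fun t => endProb R y t a + ∫ r in (0 : ℝ)..t, D r
  have h0 : (0 : ℝ) ∈ Ico (0 : ℝ) 1 := by simp
  -- `E` varies quadratically in time, hence it is constant
  have hE : ∀ s t : ℝ, 0 ≤ s → s ≤ t → t < 1 → |E t - E s| ≤ (L + 2 * C * L) * (t - s) ^ 2 := by
    intro s t hs hst ht
    have hs' : s ∈ Ico (0 : ℝ) 1 := ⟨hs, hst.trans_lt ht⟩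
    have ht' : t ∈ Ico (0 : ℝ) 1 := ⟨hs.trans hst, ht⟩
    have e1 : E t - E s = -(endProb R y s a - endProb R y t a -
        ∫ r in s..t, generator G j r (endProb R y t) a) -
        ∫ r in s..t, generator G j r (fun w => endProb R y t w - endProb R y r w) a := by
      simp only [← generator_sub]
      rw [intervalIntegral.integral_sub
        (hj.continuousRates.intervalIntegrable_generator_apply _ a hs hst ht) (hDi s hs' t ht')]
      have := intervalIntegral.integral_add_adjacent_intervals (hDi 0 h0 s hs') (hDi s hs' t ht')
      simp only [E]
      rw [← this]
      simp only [D]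
      ring
    have e2 : |∫ r in s..t, generator G j r (fun w => endProb R y t w - endProb R y r w) a| ≤
        2 * C * L * (t - s) ^ 2 := by
      have := intervalIntegral.norm_integral_le_of_norm_le_const (a := s) (b := t)
        (f := fun r => generator G j r (fun w => endProb R y t w - endProb R y r w) a)
        (C := C * (2 * (L * (t - s)))) (fun r hr => ?_)
      · rw [abs_of_nonneg (sub_nonneg.2 hst)] at this
        refine this.trans (le_of_eq ?_)
        ring
      · rw [Set.uIoc_of_le hst] at hr
        have hr' : r ∈ Ico (0 : ℝ) 1 := ⟨hs.trans hr.1.le, hr.2.trans_lt ht⟩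
        refine hj.abs_generator_le hC ⟨hr'.1, hr'.2.le⟩ (fun z z' => ?_) a
        have hb : ∀ w, |endProb R y t w - endProb R y r w| ≤ L * (t - s) := by
          intro w
          refine (hlip w r hr' t ht').trans ?_
          rw [abs_of_nonneg (sub_nonneg.2 hr.2)]
          exact mul_le_mul_of_nonneg_left (by linarith [hr.1]) hL0
        refine (abs_sub _ _).trans ?_
        linarith [hb z, hb z']
    rw [e1]
    refine (abs_sub _ _).trans ?_
    rw [abs_neg]
    linarith [(hL s t hs hst ht a).2]
  have hE' : ∀ s ∈ Ico (0 : ℝ) 1, ∀ t ∈ Ico (0 : ℝ) 1,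
      |E t - E s| ≤ (L + 2 * C * L) * |t - s| ^ 2 := by
    intro s hs t ht
    rw [sq_abs]
    rcases le_total s t with h | h
    · exact hE s t hs.1 h ht.2
    · rw [abs_sub_comm]
      have := hE t s ht.1 h hs.2
      nlinarith
  have hEd : ∀ t ∈ Ico (0 : ℝ) 1, HasDerivWithinAt E 0 (Ico 0 1) t := by
    intro t ht
    rw [hasDerivWithinAt_iff_isLittleO]
    have hO : (fun x => E x - E t - (x - t) • (0 : ℝ)) =O[𝓝[Ico 0 1] t] fun x => (x - t) ^ 2 := by
      refine Asymptotics.IsBigO.of_bound (L + 2 * C * L) ?_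
      filter_upwards [self_mem_nhdsWithin] with x hx
      simpa [Real.norm_eq_abs] using hE' t ht x hx
    refine hO.trans_isLittleO ?_
    have h1 : (fun x : ℝ => (x - t) ^ 2) =o[𝓝 t] fun x => x - t := by
      have := Asymptotics.isLittleO_pow_sub_sub t (one_lt_two)
      simpa using this
    exact h1.mono nhdsWithin_le_nhds
  have hconst : ∀ t ∈ Ico (0 : ℝ) 1, E t = E 0 := by
    intro t ht
    refine (convex_Ico (0 : ℝ) 1).is_const_of_fderivWithin_eq_zero (𝕜 := ℝ)
      (fun x hx => (hEd x hx).differentiableWithinAt) (fun x hx => ?_) ht h0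
    have hu : UniqueDiffWithinAt ℝ (Ico (0 : ℝ) 1) x := uniqueDiffOn_Ico 0 1 x hx
    have := (hEd x hx).hasFDerivWithinAt.fderivWithin hu
    rw [this]
    ext
    simp
  intro t ht
  refine hasDerivWithinAt_of_eq_integral (φ := fun t => -D t) hD.neg (fun x hx => ?_) ht
  have := hconst x hx
  simp only [E, intervalIntegral.integral_same, add_zero] at this
  rw [intervalIntegral.integral_neg]
  linarith

end Backward

/-! ### Regularity and characteristics of the bridge intensity -/

theorem totalRate_bridgeRate {R : Measure (PathSpace G)} {j : ℝ → X → X → ℝ} {y : X} {t : ℝ} {z : X}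
    (hpos : 0 < endProb R y t z) :
    totalRate G (bridgeRate R j y) t z * endProb R y t z =
      generator G j t (endProb R y t) z + totalRate G j t z * endProb R y t z := by
  simp only [totalRate, generator, Finset.sum_mul, ← Finset.sum_add_distrib]
  refine Finset.sum_congr rfl fun w _ => ?_
  rw [bridgeRate, div_mul_cancel₀ _ hpos.ne']
  ring

section Bridge

variable [Nonempty X] [Countable X] {j : ℝ → X → X → ℝ} {R : Measure (PathSpace G)}
  [IsFiniteMeasure R]

theorem IsForward.isRegularIntensity_bridgeRate (hR : IsForward R j) (hj : IsReferenceIntensity G j)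
    (hdeg : ∃ d : ℕ, ∀ z, G.degree z ≤ d)
    (hpos : ∀ t ∈ Ico (0 : ℝ) 1, ∀ z, 0 < R.real (visit G t z)) {y : X}
    (hend : ∀ t ∈ Ico (0 : ℝ) 1, ∀ z, 0 < endProb R y t z) :
    IsRegularIntensity G (bridgeRate R j y) := by
  have hH : ∀ z, ContDiffOn ℝ 1 (fun t => endProb R y t z) (Ico 0 1) := by
    intro z
    obtain ⟨h1, h2⟩ := hR.hasDerivWithinAt_endProb hj hdeg hpos y z
    have hu : UniqueDiffOn ℝ (Ico (0 : ℝ) 1) := uniqueDiffOn_Ico 0 1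
    rw [show (1 : WithTop ℕ∞) = 0 + 1 by simp, contDiffOn_succ_iff_derivWithin hu]
    refine ⟨fun t ht => (h2 t ht).differentiableWithinAt, by simp, ?_⟩
    refine contDiffOn_zero.2 (h1.neg.congr fun t ht => ?_)
    exact (h2 t ht).derivWithin (hu t ht)
  refine ⟨fun z z' h => ?_, fun t ht z z' h => ?_⟩
  · exact ((hj.isRegularIntensity.contDiff z z' h).mul (hH z')).div (hH z)
      fun t ht => (hend t ht z).ne'
  · have ht' := Ioo_subset_Ico_self ht
    exact div_pos (mul_pos (hj.pos t (Ioo_subset_Icc_self ht) z z' h) (hend t ht' z'))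
      (hend t ht' z)

/-- The arc characteristics are invariant under `h`-transforms. -/
theorem IsForward.arcChar_bridgeRate (hR : IsForward R j) (hj : IsReferenceIntensity G j)
    (hdeg : ∃ d : ℕ, ∀ z, G.degree z ≤ d)
    (hpos : ∀ t ∈ Ico (0 : ℝ) 1, ∀ z, 0 < R.real (visit G t z)) {y : X}
    (hend : ∀ t ∈ Ico (0 : ℝ) 1, ∀ z, 0 < endProb R y t z) {t : ℝ} (ht : t ∈ Ico (0 : ℝ) 1)
    {z z' : X} (h : G.Adj z z') : arcChar G (bridgeRate R j y) t z z' = arcChar G j t z z' := by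
  have hu : UniqueDiffWithinAt ℝ (Ico (0 : ℝ) 1) t := uniqueDiffOn_Ico 0 1 t ht
  have hlog : ∀ w, HasDerivWithinAt (fun s => Real.log (endProb R y s w))
      (-generator G j t (endProb R y t) w / endProb R y t w) (Ico 0 1) t := fun w =>
    ((hR.hasDerivWithinAt_endProb hj hdeg hpos y w).2 t ht).log (hend t ht w).ne'
  have hjd : DifferentiableWithinAt ℝ (fun s => j s z z') (Ico 0 1) t :=
    (hj.isRegularIntensity.contDiff z z' h).differentiableOn one_ne_zero t ht
  have hj0 : ∀ s ∈ Ico (0 : ℝ) 1, j s z z' ≠ 0 := fun s hs =>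
    (hj.pos s (Ico_subset_Icc_self hs) z z' h).ne'
  have hjl := (hjd.log (hj0 t ht)).hasDerivWithinAt
  have hk := ((hjl.add (hlog z')).sub (hlog z)).congr_of_mem
    (f₁ := fun s => Real.log (bridgeRate R j y s z z')) (fun s hs => by
      rw [bridgeRate, Real.log_div (mul_ne_zero (hj0 s hs) (hend s hs z').ne') (hend s hs z).ne',
        Real.log_mul (hj0 s hs) (hend s hs z').ne']
      rfl) ht
  have htot : ∀ w, totalRate G (bridgeRate R j y) t w =
      generator G j t (endProb R y t) w / endProb R y t w + totalRate G j t w := fun w => by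
    have h1 := totalRate_bridgeRate (R := R) (j := j) (hend t ht w)
    have h2 := (hend t ht w).ne'
    field_simp
    linarith
  rw [arcChar, arcChar, hk.derivWithin hu, htot, htot]
  ring

/-- The bridge solves the forward equation of the `h`-transformed intensity. -/
theorem IsForward.isForward_bridge (hR : IsForward R j) (hj : IsReferenceIntensity G j)
    (hdeg : ∃ d : ℕ, ∀ z, G.degree z ≤ d)
    (hpos : ∀ t ∈ Ico (0 : ℝ) 1, ∀ z, 0 < R.real (visit G t z)) (x : X) {y : X}
    (hend : ∀ t ∈ Ico (0 : ℝ) 1, ∀ z, 0 < endProb R y t z) :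
    IsForward (bridge R x y) (bridgeRate R j y) := by
  intro s t hs hst ht A hA z
  have hk := (hR.isRegularIntensity_bridgeRate hj hdeg hpos hend).continuousRates
  have hjc := hj.continuousRates
  have hs1 := hst.trans_lt ht
  set c := R.real (endpoints G x y)
  have hA' : MeasurableSet[sigmaAt G (Icc 0 s)] (A ∩ visit G 0 x) :=
    MeasurableSet.inter hA (measurableSet_visit_sigmaAt (S := Icc 0 s) (left_mem_Icc.2 hs) x)
  let m : ℝ → X → ℝ := fun r w => R.real (A ∩ visit G 0 x ∩ visit G r w)
  let n : ℝ → X → ℝ := fun r w => m r w * endProb R y r w / c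
  have hn : ∀ r ∈ Ico s 1, ∀ w, (bridge R x y).real (A ∩ visit G r w) = n r w := by
    intro r hr w
    rw [measureReal_bridge]
    simp only [n, m]
    rw [← hR.measureReal_inter_end hjc (hs.trans hr.1) hr.2
      (sigmaAt_mono G (Icc_subset_Icc_right hr.1) _ hA')]
    congr 2
    ext ω
    simp only [Set.mem_inter_iff]
    tauto
  have hnd : ∀ r ∈ Ico s 1, ∀ w, HasDerivWithinAt (fun r => n r w)
      (masterRate G (bridgeRate R j y) r (n r) w) (Ico s 1) r := by
    intro r hr w
    have hr' : r ∈ Ico (0 : ℝ) 1 := ⟨hs.trans hr.1, hr.2⟩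
    have h1 := hR.hasDerivWithinAt hjc hs hs1 hA' w hr
    have h2 := ((hR.hasDerivWithinAt_endProb hj hdeg hpos y w).2 r hr').mono
      (Ico_subset_Ico_left hs)
    refine ((h1.mul h2).div_const c).congr_deriv ?_
    have h3 := totalRate_bridgeRate (R := R) (j := j) (hend r hr' w)
    change (masterRate G j r (m r) w * endProb R y r w + m r w * -generator G j r (endProb R y r) w)
      / c = _
    have h4 : ∑ v ∈ G.neighborFinset w, n r v * bridgeRate R j y r v w =
        (∑ v ∈ G.neighborFinset w, m r v * j r v w) * endProb R y r w / c := by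
      rw [Finset.sum_mul, Finset.sum_div]
      refine Finset.sum_congr rfl fun v _ => ?_
      have := (hend r hr' v).ne'
      simp only [n, bridgeRate]
      calc _ = m r v * j r v w * endProb R y r w / c * (endProb R y r v / endProb R y r v) := by ring
        _ = _ := by rw [div_self this, mul_one]
    unfold masterRate
    rw [h4]
    simp only [n]
    linear_combination (m r w / c) * h3
  have hcn : ∀ w, ContinuousOn (fun r => n r w) (Ico s 1) := fun w r hr =>
    (hnd r hr w).continuousWithinAt
  have hsub : Icc s t ⊆ Ico s 1 := Icc_subset_Ico_right ht
  have hmc := continuousOn_masterRate hk hs hcn z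
  have key := intervalIntegral.integral_eq_sub_of_hasDerivAt_of_le hst ((hcn z).mono hsub)
    (fun r hr => (hnd r (hsub (Ioo_subset_Icc_self hr)) z).hasDerivAt
      (Ico_mem_nhds hr.1 (hr.2.trans ht)))
    (by
      refine ContinuousOn.intervalIntegrable ?_
      rw [Set.uIcc_of_le hst]
      exact hmc.mono hsub)
  rw [hn t ⟨hst, ht⟩, hn s ⟨le_rfl, hs1⟩, ← key]
  refine intervalIntegral.integral_congr fun r hr => ?_
  rw [Set.uIcc_of_le hst] at hr
  have : (fun w => (bridge R x y).real (A ∩ visit G r w)) = n r :=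
    funext fun w => hn r (hsub hr) w
  simp only [this]

end Bridge

end BridgeIntensity

section BridgeProperties

variable {X : Type*} {G : SimpleGraph X}

/-! ### The Markov property of bridges -/

/-- The Markov property follows from the conditional independence, given each position at time `t`,
of the events before and after `t`. -/
theorem isMarkov_of_measureReal_mul [Countable X] {P : Measure (PathSpace G)}
    [IsProbabilityMeasure P]
    (h : ∀ t ∈ Ico (0 : ℝ) 1, ∀ A, MeasurableSet[sigmaAt G (Icc 0 t)] A →
      ∀ B, MeasurableSet[sigmaAt G (Icc t 1)] B → ∀ a,
        P.real (A ∩ visit G t a ∩ B) * P.real (visit G t a) =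
          P.real (A ∩ visit G t a) * P.real (visit G t a ∩ B)) : IsMarkov P := by
  intro t ht B hB
  have hBm : MeasurableSet B := sigmaAt_le (Icc_subset_Icc_left ht.1) _ hB
  have hind : Integrable (B.indicator fun _ => (1 : ℝ)) P := (integrable_const 1).indicator hBm
  have hle : sigmaAt G {t} ≤ sigmaAt G (Icc 0 t) :=
    sigmaAt_mono G (Set.singleton_subset_iff.2 (right_mem_Icc.2 ht.1))
  rcases ht.2.lt_or_eq with ht1 | rfl
  · -- the common version of both conditional probabilities is a function of `X_t`
    let f : X → ℝ := fun z => P.real (visit G t z ∩ B) / P.real (visit G t z)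
    have hf0 : ∀ z, 0 ≤ f z := fun z => div_nonneg measureReal_nonneg measureReal_nonneg
    have hf1 : ∀ z, f z ≤ 1 := fun z =>
      div_le_one_of_le₀ (measureReal_mono Set.inter_subset_left) measureReal_nonneg
    have hg : StronglyMeasurable[sigmaAt G {t}] fun ω : PathSpace G => f (coord t ω) := by
      refine Measurable.stronglyMeasurable fun U _ => ?_
      exact measurableSet_coord_mem (mem_singleton t) (f ⁻¹' U)
    have hFt : sigmaAt G (Icc 0 t) ≤ (inferInstance : MeasurableSpace (PathSpace G)) :=
      sigmaAt_le (Icc_subset_Icc_right ht.2)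
    have hgi : Integrable (fun ω : PathSpace G => f (coord t ω)) P := by
      refine Integrable.of_bound (C := 1) (hg.mono (hle.trans hFt)).aestronglyMeasurable ?_
      refine Eventually.of_forall fun ω => ?_
      rw [Real.norm_eq_abs, abs_of_nonneg (hf0 _)]
      exact hf1 _
    have hset : ∀ A, MeasurableSet[sigmaAt G (Icc 0 t)] A →
        ∫ ω in A, f (coord t ω) ∂P = ∫ ω in A, B.indicator (fun _ => (1 : ℝ)) ω ∂P := by
      intro A hA'
      have hAe : A = ⋃ z, A ∩ visit G t z := by
        ext ω
        simp
      have hd : Pairwise (Function.onFun Disjoint fun z => A ∩ visit G t z) := fun z z' hne =>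
        Set.disjoint_left.2 fun ω hω hω' => hne (hω.2.symm.trans hω'.2)
      have hm : ∀ z, MeasurableSet (A ∩ visit G t z) := fun z =>
        (hFt _ hA').inter (measurableSet_visit t z)
      conv_lhs => rw [hAe]
      conv_rhs => rw [hAe]
      rw [integral_iUnion hm hd hgi.integrableOn, integral_iUnion hm hd hind.integrableOn]
      refine tsum_congr fun z => ?_
      have e1 : ∫ ω in A ∩ visit G t z, f (coord t ω) ∂P = ∫ _ in A ∩ visit G t z, f z ∂P :=
        setIntegral_congr_fun (hm z) fun ω hω => by rw [show coord t ω = z from hω.2]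
      have hmul := h t ⟨ht.1, ht1⟩ A hA' B hB z
      rw [e1, setIntegral_const, setIntegral_indicator hBm, setIntegral_const, smul_eq_mul,
        smul_eq_mul, mul_one]
      by_cases h0 : P.real (visit G t z) = 0
      · have h1 : ∀ D : Set (PathSpace G), D ⊆ visit G t z → P.real D = 0 := fun D hD =>
          le_antisymm (h0 ▸ measureReal_mono hD) measureReal_nonneg
        rw [h1 _ Set.inter_subset_right, h1 _ (Set.inter_subset_left.trans Set.inter_subset_right),
          zero_mul]
      · simp only [f]
        rw [← mul_div_assoc, div_eq_iff h0, hmul]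
    have key : ∀ m : MeasurableSpace (PathSpace G), sigmaAt G {t} ≤ m →
        m ≤ sigmaAt G (Icc 0 t) → (fun ω : PathSpace G => f (coord t ω)) =ᵐ[P] P⟦B | m⟧ :=
      fun m hm1 hm2 => ae_eq_condExp_of_forall_setIntegral_eq (hm2.trans hFt) hind
        (fun A _ _ => hgi.integrableOn) (fun A hA _ => hset A (hm2 _ hA))
        (hg.mono hm1).aestronglyMeasurable
    exact (key _ hle le_rfl).symm.trans (key _ le_rfl hle)
  · -- at time `1` the event `B` is determined by `X_1`
    have hB1 : MeasurableSet[sigmaAt G {1}] B := by rwa [Icc_self] at hB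
    have h1 : ∀ m : MeasurableSpace (PathSpace G), MeasurableSet[m] B →
        m ≤ sigmaAt G (Icc 0 1) →
        P⟦B | m⟧ = B.indicator fun _ => (1 : ℝ) := by
      intro m hm hm2
      have hs : StronglyMeasurable[m] (B.indicator fun _ => (1 : ℝ)) :=
        StronglyMeasurable.indicator stronglyMeasurable_const hm
      exact condExp_of_stronglyMeasurable hm2 hs hind
    rw [h1 _ (hle _ hB1) (sigmaAt_le subset_rfl), h1 _ hB1 (sigmaAt_le (Set.singleton_subset_iff.2 ht))]

theorem IsForward.isMarkov_bridge [Nonempty X] [Countable X] [G.LocallyFinite]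
    {R : Measure (PathSpace G)} [IsFiniteMeasure R] {j : ℝ → X → X → ℝ} (hR : IsForward R j)
    (hj : ContinuousRates G j) (hpos : ∀ t ∈ Ico (0 : ℝ) 1, ∀ z, 0 < R.real (visit G t z)) {x y : X}
    (hxy : R (endpoints G x y) ≠ 0) : IsMarkov (bridge R x y) := by
  have : IsProbabilityMeasure (bridge R x y) := cond_isProbabilityMeasure hxy
  refine isMarkov_of_measureReal_mul fun t ht A hA B hB a => ?_
  have h0 : MeasurableSet[sigmaAt G (Icc 0 t)] (visit G 0 x) :=
    measurableSet_visit_sigmaAt (S := Icc 0 t) (left_mem_Icc.2 ht.1) x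
  have hM := fun A hA B hB => hR.markov hj ht.1 ht.2 (A := A) hA (B := B) hB a y
  -- the Markov property of `R` for the pasts `{X_0 = x}` and `A ∩ {X_0 = x}`, with futures
  -- `{X_1 = y}` and `B ∩ {X_1 = y}`
  have e1 := hM _ (MeasurableSet.inter hA h0) B hB
  have e2 := hM _ h0 univ MeasurableSet.univ
  have e3 := hM _ (MeasurableSet.inter hA h0) univ MeasurableSet.univ
  have e4 := hM _ h0 B hB
  have hp := (hpos t ht a).ne'
  simp only [measureReal_bridge, Set.univ_inter] at e1 e2 e3 e4 ⊢
  have c1 : A ∩ visit G t a ∩ B ∩ visit G 0 x ∩ visit G 1 y =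
      A ∩ visit G 0 x ∩ visit G t a ∩ (B ∩ visit G 1 y) := by ext; simp only [mem_inter_iff]; tauto
  have c2 : visit G t a ∩ visit G 0 x ∩ visit G 1 y = visit G 0 x ∩ visit G t a ∩ visit G 1 y := by
    ext; simp only [mem_inter_iff]; tauto
  have c3 : A ∩ visit G t a ∩ visit G 0 x ∩ visit G 1 y =
      A ∩ visit G 0 x ∩ visit G t a ∩ visit G 1 y := by ext; simp only [mem_inter_iff]; tauto
  have c4 : visit G t a ∩ B ∩ visit G 0 x ∩ visit G 1 y =
      visit G 0 x ∩ visit G t a ∩ (B ∩ visit G 1 y) := by ext; simp only [mem_inter_iff]; tauto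
  rw [c1, c2, c3, c4, div_mul_div_comm, div_mul_div_comm]
  congr 1
  rw [← eq_div_iff hp] at e1 e2 e3 e4
  rw [e1, e2, e3, e4]
  ring

/-! ### The bridge has an intensity -/

section Intensity

variable [G.LocallyFinite] [Nonempty X] [Countable X] {j : ℝ → X → X → ℝ}
  {R : Measure (PathSpace G)} [IsFiniteMeasure R]

/-- Weighting by the position of the bridge cancels the denominator of its intensity. -/
theorem IsForward.measureReal_bridge_mul_totalRate_le (hR : IsForward R j)
    (hj : IsReferenceIntensity G j) {C : ℝ} (hC : ∀ t ∈ Icc (0 : ℝ) 1, ∀ z, totalRate G j t z ≤ C)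
    (x : X) {y : X} (hend : ∀ t ∈ Ico (0 : ℝ) 1, ∀ z, 0 < endProb R y t z) {t : ℝ}
    (ht : t ∈ Ico (0 : ℝ) 1) (z : X) :
    (bridge R x y).real (visit G t z) * totalRate G (bridgeRate R j y) t z ≤
      C / R.real (endpoints G x y) * R.real (visit G t z) := by
  have h0 : MeasurableSet[sigmaAt G (Icc 0 t)] (visit G 0 x) :=
    measurableSet_visit_sigmaAt (S := Icc 0 t) (left_mem_Icc.2 ht.1) x
  have h1 := hR.measureReal_inter_end hj.continuousRates ht.1 ht.2 h0 z y
  have ht' := Ico_subset_Icc_self ht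
  have h2 : totalRate G (bridgeRate R j y) t z * endProb R y t z ≤ C := by
    refine le_trans ?_ (hC t ht' z)
    simp only [totalRate, Finset.sum_mul]
    refine Finset.sum_le_sum fun w hw => ?_
    rw [bridgeRate, div_mul_cancel₀ _ (hend t ht z).ne']
    exact mul_le_of_le_one_right (hj.pos t ht' z w ((G.mem_neighborFinset z w).1 hw)).le
      (endProb_le_one R y t w)
  have hC0 : 0 ≤ C := (hj.totalRate_nonneg ht' z).trans (hC t ht' z)
  rw [measureReal_bridge, Set.inter_comm (visit G t z), h1]
  calc _ = R.real (visit G 0 x ∩ visit G t z) *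
        (totalRate G (bridgeRate R j y) t z * endProb R y t z) / R.real (endpoints G x y) := by ring
    _ ≤ R.real (visit G t z) * C / R.real (endpoints G x y) := by
        refine div_le_div_of_nonneg_right ?_ measureReal_nonneg
        exact mul_le_mul (measureReal_mono Set.inter_subset_right) h2
          (mul_nonneg (Finset.sum_nonneg fun w hw => div_nonneg (mul_nonneg
            (hj.pos t ht' z w ((G.mem_neighborFinset z w).1 hw)).le (endProb_nonneg _ _ _ _))
            (endProb_nonneg _ _ _ _)) (endProb_nonneg _ _ _ _)) measureReal_nonneg
    _ = _ := by ring

/-- The expected number of jumps of a bridge is finite. -/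
theorem IsForward.integrable_totalRate_bridgeRate (hR : IsForward R j)
    (hj : IsReferenceIntensity G j) (hdeg : ∃ d : ℕ, ∀ z, G.degree z ≤ d)
    (hpos : ∀ t ∈ Ico (0 : ℝ) 1, ∀ z, 0 < R.real (visit G t z)) {x y : X}
    (hxy : R (endpoints G x y) ≠ 0) (hend : ∀ t ∈ Ico (0 : ℝ) 1, ∀ z, 0 < endProb R y t z) :
    ∀ᵐ ω ∂bridge R x y,
      IntegrableOn (fun s => totalRate G (bridgeRate R j y) s (coord s ω)) (Ico 0 1) := by
  obtain ⟨C, hC⟩ := hj.bounded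
  have hk := hR.isRegularIntensity_bridgeRate hj hdeg hpos hend
  set Q := bridge R x y
  have : IsProbabilityMeasure Q := cond_isProbabilityMeasure hxy
  let K : ℝ → X → ℝ := fun s z => (Ico (0 : ℝ) 1).indicator
    (fun s => totalRate G (bridgeRate R j y) s z) s
  have hK0 : ∀ s z, 0 ≤ K s z := fun s z => Set.indicator_nonneg (fun s hs =>
    Finset.sum_nonneg fun w hw => div_nonneg (mul_nonneg
      (hj.pos s (Ico_subset_Icc_self hs) z w ((G.mem_neighborFinset z w).1 hw)).le
      (endProb_nonneg _ _ _ _)) (endProb_nonneg _ _ _ _)) s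
  have hKm : ∀ z, Measurable fun s => K s z := by
    intro z
    simp only [K]
    have h := (hk.continuousRates.continuousOn_totalRate z).measurable_piecewise
      (g := (0 : ℝ → ℝ)) continuousOn_const measurableSet_Ico
    rwa [Set.piecewise_eq_indicator] at h
  let F : ℝ × PathSpace G → ℝ := fun p => K p.1 (coord p.1 p.2)
  have hFm : Measurable F := by
    intro U hU
    have : F ⁻¹' U = ⋃ z, {p : ℝ × PathSpace G | coord p.1 p.2 = z} ∩ {p | K p.1 z ∈ U} := by
      ext p
      simp [F]
    rw [this]
    exact MeasurableSet.iUnion fun z => (measurableSet_visit_uncurry z).inter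
      ((hKm z).comp measurable_fst hU)
  have hbound : ∀ s, ∫⁻ ω, ENNReal.ofReal (F (s, ω)) ∂Q ≤
      (Ico (0 : ℝ) 1).indicator (fun _ => ENNReal.ofReal (C / R.real (endpoints G x y)) * R univ) s := by
    intro s
    by_cases hs : s ∈ Ico (0 : ℝ) 1
    · rw [Set.indicator_of_mem hs]
      have hC0 : 0 ≤ C / R.real (endpoints G x y) := div_nonneg
        ((hj.totalRate_nonneg (Ico_subset_Icc_self hs) x).trans (hC s (Ico_subset_Icc_self hs) x))
        measureReal_nonneg
      have hun : (univ : Set (PathSpace G)) = ⋃ z, visit G s z := by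
        ext ω
        simp
      have hd : Pairwise (Function.onFun Disjoint fun z => visit G s z) := fun z z' hne =>
        Set.disjoint_left.2 fun ω hω hω' => hne (hω.symm.trans hω')
      rw [← setLIntegral_univ, hun, lintegral_iUnion (measurableSet_visit s) hd,
        measure_iUnion hd (measurableSet_visit s), ← ENNReal.tsum_mul_left]
      refine ENNReal.tsum_le_tsum fun z => ?_
      have e1 : ∫⁻ ω in visit G s z, ENNReal.ofReal (F (s, ω)) ∂Q =
          ∫⁻ _ in visit G s z, ENNReal.ofReal (totalRate G (bridgeRate R j y) s z) ∂Q :=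
        setLIntegral_congr_fun (measurableSet_visit s z) fun ω hω => by
          simp only [F, K, Set.indicator_of_mem hs]
          rw [show coord s ω = z from hω]
      rw [e1, setLIntegral_const, ← ofReal_measureReal, ← ofReal_measureReal,
        ← ENNReal.ofReal_mul' measureReal_nonneg, ← ENNReal.ofReal_mul hC0, mul_comm]
      exact ENNReal.ofReal_le_ofReal (hR.measureReal_bridge_mul_totalRate_le hj hC x hend hs z)
    · rw [Set.indicator_of_notMem hs]
      simp [F, K, Set.indicator_of_notMem hs]
  -- Tonelli's theorem
  have hfin : ∫⁻ ω, (∫⁻ s, ENNReal.ofReal (F (s, ω))) ∂Q ≠ ⊤ := by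
    rw [lintegral_lintegral_swap]
    · refine ne_top_of_le_ne_top ?_ (lintegral_mono hbound)
      rw [lintegral_indicator measurableSet_Ico, setLIntegral_const]
      exact ENNReal.mul_ne_top (ENNReal.mul_ne_top ENNReal.ofReal_ne_top (measure_ne_top R _))
        (by simp)
    · exact (hFm.ennreal_ofReal.comp measurable_swap).aemeasurable
  filter_upwards [ae_lt_top (Measurable.lintegral_prod_left hFm.ennreal_ofReal) hfin] with ω hω
  have h1 : Integrable (fun s => F (s, ω)) := by
    refine ⟨(hFm.comp (measurable_id.prodMk measurable_const)).aestronglyMeasurable, ?_⟩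
    rw [hasFiniteIntegral_iff_ofReal (Eventually.of_forall fun s => hK0 _ _)]
    exact hω
  refine h1.integrableOn.congr_fun (fun s hs => ?_) measurableSet_Ico
  simp only [F, K, Set.indicator_of_mem hs]

theorem IsForward.hasIntensity_bridge (hR : IsForward R j)
    (hj : IsReferenceIntensity G j) (hdeg : ∃ d : ℕ, ∀ z, G.degree z ≤ d)
    (hpos : ∀ t ∈ Ico (0 : ℝ) 1, ∀ z, 0 < R.real (visit G t z)) {x y : X}
    (hxy : R (endpoints G x y) ≠ 0) (hend : ∀ t ∈ Ico (0 : ℝ) 1, ∀ z, 0 < endProb R y t z) :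
    HasIntensity (bridge R x y) (bridgeRate R j y) := by
  have : IsProbabilityMeasure (bridge R x y) := cond_isProbabilityMeasure hxy
  have hk := (hR.isRegularIntensity_bridgeRate hj hdeg hpos hend).continuousRates
  refine ⟨fun z z' h => ?_, fun t ht z z' h => ?_,
    hR.integrable_totalRate_bridgeRate hj hdeg hpos hxy hend, fun u => ?_⟩
  · exact (continuousOn_iff_continuous_domRestrict.1 (hk h)).measurable
  · exact div_nonneg (mul_nonneg (hj.pos t (Ico_subset_Icc_self ht) z z' h).le
      (endProb_nonneg _ _ _ _)) (endProb_nonneg _ _ _ _)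
  · exact Locally.of_prop ((hR.isForward_bridge hj hdeg hpos x hend).martingale_dynkin hk u)

end Intensity

end BridgeProperties

section Mixtures

variable {X : Type*} {G : SimpleGraph X}

/-! ### Existence of bases of closed walks -/

theorem fundamentalWalk_inj {T : SimpleGraph X} (hT : IsSpanningTree G T) {x y x' y' : X}
    {h : G.Adj x y} {h' : G.Adj x' y'} (heq : fundamentalWalk hT h = fundamentalWalk hT h') :
    x = x' ∧ y = y' := by
  refine ⟨congrArg Sigma.fst heq, ?_⟩
  have := congrArg (fun c : BasedWalk G => c.2.getVert 1) heq
  simpa [fundamentalWalk, SimpleGraph.Walk.getVert_cons_succ] using this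

/-- A basis is obtained by orienting the edges along a linear order on the vertices. -/
theorem exists_isClosedWalkBasis {T : SimpleGraph X} (hT : IsSpanningTree G T) :
    ∃ C, IsClosedWalkBasis hT C := by
  let C₀ : Set (BasedWalk G) := {c | ∃ (x y : X) (h : G.Adj x y), ¬ T.Adj x y ∧
    WellOrderingRel x y ∧ c = fundamentalWalk hT h}
  have hmem : ∀ (x y : X) (h : G.Adj x y), ¬ T.Adj x y →
      (fundamentalWalk hT h ∈ C₀ ↔ WellOrderingRel x y) := by
    refine fun x y h hxy => ⟨?_, fun hr => ⟨x, y, h, hxy, hr, rfl⟩⟩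
    rintro ⟨x', y', h', -, hr, heq⟩
    obtain ⟨rfl, rfl⟩ := fundamentalWalk_inj hT heq
    exact hr
  refine ⟨C₀ ∪ edgeWalks G, C₀, fun c ⟨x, y, h, hxy, _, hc⟩ => ⟨x, y, h, hxy, hc⟩,
    fun x y h hxy => ?_, rfl⟩
  rw [hmem x y h hxy, hmem y x h.symm fun h' => hxy h'.symm]
  rcases trichotomous_of WellOrderingRel x y with hlt | heq | hgt
  · exact Or.inl ⟨hlt, asymm_of WellOrderingRel hlt⟩
  · exact absurd heq h.ne
  · exact Or.inr ⟨hgt, asymm_of WellOrderingRel hgt⟩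

/-! ### Mixtures of bridges -/

theorem pairwise_disjoint_endpoints :
    Pairwise (Function.onFun Disjoint fun p : X × X => endpoints G p.1 p.2) := fun _ _ hne =>
  Set.disjoint_left.2 fun _ hω hω' =>
    hne (Prod.ext (hω.1.symm.trans hω'.1) (hω.2.symm.trans hω'.2))

theorem iUnion_endpoints : ⋃ p : X × X, endpoints G p.1 p.2 = univ := by
  ext ω
  simp [endpoints]

theorem measure_smul_bridge (P : Measure (PathSpace G)) [IsFiniteMeasure P] (x y : X) :
    P (endpoints G x y) • bridge P x y = P.restrict (endpoints G x y) := by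
  by_cases h : P (endpoints G x y) = 0
  · rw [h, zero_smul, Measure.restrict_eq_zero.2 h]
  · rw [bridge, ProbabilityTheory.cond, smul_smul, ENNReal.mul_inv_cancel h (measure_ne_top P _),
      one_smul]

/-- The bridges of a mixture of bridges of `R` are bridges of `R`. -/
theorem bridge_eq_of_eq_sum {P R : Measure (PathSpace G)} [IsFiniteMeasure R] {π : PMF (X × X)}
    (hπ : π.support ⊆ endpointSupport R)
    (hP : P = Measure.sum fun p : X × X => π p • bridge R p.1 p.2) {x y : X}
    (hxy : (x, y) ∈ endpointSupport P) : bridge P x y = bridge R x y := by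
  have hE := measurableSet_endpoints (G := G) x y
  have key : ∀ B, MeasurableSet B → P (endpoints G x y ∩ B) = π (x, y) * bridge R x y B := by
    intro B hB
    have h1 : ∀ p : X × X, p ≠ (x, y) → bridge R p.1 p.2 (endpoints G x y ∩ B) = 0 := by
      intro p hp
      rw [bridge, cond_apply (measurableSet_endpoints _ _), ← Set.inter_assoc,
        (pairwise_disjoint_endpoints (G := G) hp).inter_eq, Set.empty_inter, measure_empty,
        mul_zero]
    rw [hP, Measure.sum_apply _ (hE.inter hB), tsum_eq_single (x, y) fun p hp => by
      rw [Measure.smul_apply, h1 p hp, smul_zero], Measure.smul_apply, smul_eq_mul, bridge,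
      cond_inter_self hE]
  have hPE : P (endpoints G x y) = π (x, y) * bridge R x y univ := by
    simpa using key univ MeasurableSet.univ
  have hπ0 : π (x, y) ≠ 0 := fun h0 => hxy (by rw [hPE, h0, zero_mul])
  have hRE : R (endpoints G x y) ≠ 0 := hπ ((PMF.mem_support_iff _ _).2 hπ0)
  have : IsProbabilityMeasure (bridge R x y) := cond_isProbabilityMeasure hRE
  rw [measure_univ, mul_one] at hPE
  refine Measure.ext fun B hB => ?_
  rw [show bridge P x y B = (P (endpoints G x y))⁻¹ * P (endpoints G x y ∩ B) from
    cond_apply hE P B, key B hB, hPE, ← mul_assoc, ENNReal.inv_mul_cancel hπ0 (π.apply_ne_top _),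
    one_mul]

variable [Countable X]

/-- Disintegration of a walk along its endpoints. -/
theorem sum_smul_bridge (P : Measure (PathSpace G)) [IsFiniteMeasure P] :
    P = Measure.sum fun p : X × X => P (endpoints G p.1 p.2) • bridge P p.1 p.2 := by
  simp only [measure_smul_bridge]
  rw [← Measure.restrict_iUnion pairwise_disjoint_endpoints
    fun p => measurableSet_endpoints p.1 p.2, iUnion_endpoints, Measure.restrict_univ]

/-- The law `P₀₁` of the endpoints. -/
noncomputable def endpointLaw (P : Measure (PathSpace G)) [IsProbabilityMeasure P] : PMF (X × X) :=
  ⟨fun p => P (endpoints G p.1 p.2), by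
    have h : ∑' p : X × X, P (endpoints G p.1 p.2) = 1 := by
      rw [← measure_iUnion pairwise_disjoint_endpoints
        fun p => measurableSet_endpoints p.1 p.2, iUnion_endpoints, measure_univ]
    exact h ▸ ENNReal.summable.hasSum⟩

end Mixtures

end ReciprocalWalk

theorem theorem2p3 {X : Type*} [Countable X] (G : SimpleGraph X) [G.LocallyFinite]
    (hconn : G.Connected) (hdeg : ∃ d : ℕ, ∀ z, G.degree z ≤ d)
    (j : ℝ → X → X → ℝ) (hj : IsReferenceIntensity G j)
    (R : Measure (PathSpace G)) [IsProbabilityMeasure R]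
    (hR₀ : ∀ x, R {ω | coord 0 ω = x} ≠ 0) (hR : HasIntensity R j)
    (P : Measure (PathSpace G)) [IsProbabilityMeasure P] :
    P ∈ reciprocalClass R ↔
      ∀ x y : X, (x, y) ∈ endpointSupport P →
        IsMarkov (bridge P x y) ∧ bridge P x y ≪ bridge R x y ∧
        ∃ k : ℝ → X → X → ℝ, HasIntensity (bridge P x y) k ∧ IsRegularIntensity G k ∧
          ∃ (T : SimpleGraph X) (hT : IsSpanningTree G T),
            (∀ t ∈ Set.Ico (0 : ℝ) 1, ∀ z z', T.Adj z z' →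
              arcChar G k t z z' = arcChar G j t z z') ∧
            ∃ C : Set (BasedWalk G), IsClosedWalkBasis hT C ∧
              ∀ t ∈ Set.Ioo (0 : ℝ) 1, ∀ c ∈ C, walkChar k t c.2 = walkChar j t c.2 := by
  have : Nonempty X := hconn.nonempty
  have hRf : IsForward R j := hR.isForward hj.continuousRates
  have hR₀' : ∀ x, 0 < R.real (visit G 0 x) := fun x =>
    ENNReal.toReal_pos (hR₀ x) (measure_ne_top R _)
  have hpos : ∀ t ∈ Ico (0 : ℝ) 1, ∀ z, 0 < R.real (visit G t z) := fun t ht z =>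
    hRf.visit_pos hj hR₀' ht z
  constructor
  · rintro ⟨π, hπ, hP⟩ x y hxy
    have hRE : R (endpoints G x y) ≠ 0 := by
      have h0 : 0 < R.real (visit G 0 x ∩ visit G 1 y) :=
        hRf.visit_one_pos hj hconn hR₀' (by simp) x y
      exact (ENNReal.toReal_pos_iff.1 h0).1.ne'
    have hend : ∀ t ∈ Ico (0 : ℝ) 1, ∀ z, 0 < endProb R y t z := fun t ht z =>
      div_pos (hRf.visit_one_pos hj hconn hR₀' ht z y) (hpos t ht z)
    rw [bridge_eq_of_eq_sum hπ hP hxy]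
    obtain ⟨T, hTG, hT⟩ := hconn.exists_isTree_le
    obtain ⟨C, hC⟩ := exists_isClosedWalkBasis (G := G) ⟨hTG, hT⟩
    refine ⟨hRf.isMarkov_bridge hj.continuousRates hpos hRE, Measure.AbsolutelyContinuous.rfl,
      bridgeRate R j y, hRf.hasIntensity_bridge hj hdeg hpos hRE hend,
      hRf.isRegularIntensity_bridgeRate hj hdeg hpos hend, T, ⟨hTG, hT⟩, fun t ht z z' h =>
      hRf.arcChar_bridgeRate hj hdeg hpos hend ht (hTG h), C, hC, fun t ht c _ => ?_⟩
    have ht' := Ioo_subset_Ico_self ht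
    exact mul_right_cancel₀ (hend t ht' c.1).ne' (walkChar_bridgeRate (hend t ht') c.2)
  · intro h
    have hb : ∀ x y, (x, y) ∈ endpointSupport P →
        R (endpoints G x y) ≠ 0 ∧ bridge P x y = bridge R x y := by
      intro x y hxy
      obtain ⟨-, hac, k, hk, hkr, T, hT, harc, C, hC, hwalk⟩ := h x y hxy
      have : IsProbabilityMeasure (bridge P x y) := cond_isProbabilityMeasure hxy
      have hQE : bridge P x y (endpoints G x y) = 1 := cond_apply_self hxy (measure_ne_top P _)
      -- otherwise `bridge R x y` is the zero measure, and `bridge P x y ≪ bridge R x y` fails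
      have hRE : R (endpoints G x y) ≠ 0 := by
        intro h0
        have h1 : bridge R x y = 0 := by
          rw [bridge, ProbabilityTheory.cond, Measure.restrict_eq_zero.2 h0, smul_zero]
        have h2 := hac (s := endpoints G x y) (by simp [h1])
        simp [hQE] at h2
      obtain ⟨θ, hθ⟩ := exists_isGauge hT hC hkr hj.isRegularIntensity harc hwalk
      exact ⟨hRE, eq_bridge_of_isGauge (hk.isForward hkr.continuousRates) hRf hkr.continuousRates
        hj.continuousRates hθ hQE hRE⟩
    refine ⟨endpointLaw P, fun p hp => (hb p.1 p.2 ((PMF.mem_support_iff _ _).1 hp)).1, ?_⟩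
    conv_lhs => rw [sum_smul_bridge P]
    congr 1
    ext1 p
    change P (endpoints G p.1 p.2) • bridge P p.1 p.2 = P (endpoints G p.1 p.2) • bridge R p.1 p.2
    by_cases hp : P (endpoints G p.1 p.2) = 0
    · rw [hp, zero_smul, zero_smul]
    · rw [(hb p.1 p.2 hp).2]
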